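/- There is an absolute constant $C$ such that for every integer $k \ge 2$ there are a constant $K = K(k)$ and two random-access-machine programs $P_{\mathrm{enc}}, P_{\mathrm{dec}}$ (depending on $k$ only) for which the following holds for all sufficiently large $n$. There exist a code length $N \ge k$ with $$N \le n + C\,k^2 \log_2 k \,\log_2 n,$$ an injective encoding map $\mathsf{Enc} : \{0,1\}^n \to \{0,1\}^N$ and a decoding map $\mathsf{Dec} : \{0,1\}^{N-k} \to \{0,1\}^n \cup \{\mathrm{Fail}\}$ such that, on every input in the respective domain, $P_{\mathrm{enc}}$ computes $\mathsf{Enc}$ and $P_{\mathrm{dec}}$ computes $\mathsf{Dec}$, both in time at most $K\, n (\log_2 n)^4$, and such that for every $s \in \{0,1\}^n$ and every $s' \in \{0,1\}^{N-k}$ that is a subsequence of $\mathsf{Enc}(s)$ (i.e. is obtained from $\mathsf{Enc}(s)$ by deleting $k$ bits), $\mathsf{Dec}(s') = s$. Here the time of a random access machine is its bit cost: every operation is charged for the number of bits of the addresses and values it touches, and multiplication and division for the product of the bit lengths of the operands. The input of each program is only the bit string and its length. -/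

import Mathlib

/-!
Random access machines with a bit-cost measure.

A machine has registers `0, 1, 2, …` and arrays `0, 1, 2, …`, all holding natural numbers. A program
is one fixed finite piece of structured code, so it mentions finitely many registers, arrays and
constants. Array cells are addressed by computed values. Every operation is charged
for the number of bits of all addresses and values that it touches, and multiplication and division
are charged for the product of the bit lengths, as in schoolbook arithmetic.
-/

namespace RAM

/-- Arithmetic operations. -/
inductive Op where
  | add
  | sub
  | mul
  | div
  | mod

/-- The value of an operation (subtraction is truncated at `0`). -/
def Op.eval : Op → ℕ → ℕ → ℕ
  | .add, x, y => x + y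
  | .sub, x, y => x - y
  | .mul, x, y => x * y
  | .div, x, y => x / y
  | .mod, x, y => x % y

/-- The cost of an operation on operands `x` and `y`; `Nat.size` is the length in binary. -/
def Op.cost : Op → ℕ → ℕ → ℕ
  | .add, x, y => 1 + x.size + y.size
  | .sub, x, y => 1 + x.size + y.size
  | .mul, x, y => (1 + x.size) * (1 + y.size)
  | .div, x, y => (1 + x.size) * (1 + y.size)
  | .mod, x, y => (1 + x.size) * (1 + y.size)

/-- Memory contents: `reg i` is register `i`, and `arr a j` is cell `j` of array `a`. -/
structure State where
  reg : ℕ → ℕ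
  arr : ℕ → ℕ → ℕ

/-- Expressions: constants, registers, array cells at a computed address, and operations. -/
inductive Expr where
  | lit (c : ℕ)
  | reg (i : ℕ)
  | get (a : ℕ) (e : Expr)
  | op (o : Op) (e₁ e₂ : Expr)

/-- The value of an expression. -/
def Expr.eval (σ : State) : Expr → ℕ
  | .lit c => c
  | .reg i => σ.reg i
  | .get a e => σ.arr a (e.eval σ)
  | .op o e₁ e₂ => o.eval (e₁.eval σ) (e₂.eval σ)

/-- The cost of evaluating an expression. -/
def Expr.cost (σ : State) : Expr → ℕ
  | .lit c => 1 + c.size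
  | .reg i => 1 + (σ.reg i).size
  | .get a e => e.cost σ + (1 + (e.eval σ).size + (σ.arr a (e.eval σ)).size)
  | .op o e₁ e₂ => e₁.cost σ + e₂.cost σ + o.cost (e₁.eval σ) (e₂.eval σ)

/-- Programs. Tests succeed when the value of the expression is not `0`. -/
inductive Prog where
  | nop
  | assign (i : ℕ) (e : Expr)
  | store (a : ℕ) (idx e : Expr)
  | seq (p q : Prog)
  | ite (e : Expr) (p q : Prog)
  | loop (e : Expr) (p : Prog)

/-- Overwrite register `i` by `v`. -/
def State.setReg (σ : State) (i v : ℕ) : State :=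
  { σ with reg := Function.update σ.reg i v }

/-- Overwrite cell `j` of array `a` by `v`. -/
def State.setArr (σ : State) (a j v : ℕ) : State :=
  { σ with arr := Function.update σ.arr a (Function.update (σ.arr a) j v) }

/-- `Exec p σ t τ`: the program `p`, started in `σ`, halts in `τ` after time exactly `t`. -/
inductive Exec : Prog → State → ℕ → State → Prop where
  | nop (σ : State) : Exec .nop σ 1 σ
  | assign (σ : State) (i : ℕ) (e : Expr) :
      Exec (.assign i e) σ (e.cost σ + 1 + (e.eval σ).size) (σ.setReg i (e.eval σ))
  | store (σ : State) (a : ℕ) (idx e : Expr) :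
      Exec (.store a idx e) σ
        (idx.cost σ + e.cost σ + 1 + (idx.eval σ).size + (e.eval σ).size)
        (σ.setArr a (idx.eval σ) (e.eval σ))
  | seq {p q : Prog} {σ τ υ : State} {t u : ℕ} (hp : Exec p σ t τ) (hq : Exec q τ u υ) :
      Exec (.seq p q) σ (t + u) υ
  | ite_true {e : Expr} {p q : Prog} {σ τ : State} {t : ℕ} (he : e.eval σ ≠ 0)
      (hp : Exec p σ t τ) : Exec (.ite e p q) σ (e.cost σ + 1 + t) τ
  | ite_false {e : Expr} {p q : Prog} {σ τ : State} {t : ℕ} (he : e.eval σ = 0)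
      (hq : Exec q σ t τ) : Exec (.ite e p q) σ (e.cost σ + 1 + t) τ
  | loop_true {e : Expr} {p : Prog} {σ τ υ : State} {t u : ℕ} (he : e.eval σ ≠ 0)
      (hp : Exec p σ t τ) (hl : Exec (.loop e p) τ u υ) :
      Exec (.loop e p) σ (e.cost σ + 1 + t + u) υ
  | loop_false {e : Expr} {p : Prog} {σ : State} (he : e.eval σ = 0) :
      Exec (.loop e p) σ (e.cost σ + 1) σ

/-- The initial state on input `x`: register `0` holds the length of `x`, array `0` holds the bits
of `x`, and everything else is `0`. -/
def State.init (x : List Bool) : State where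
  reg i := if i = 0 then x.length else 0
  arr a j := if a = 0 then (x.getD j false).toNat else 0

/-- The output convention: register `0` is `0` for the answer "Fail"; it is `1` for a string, whose
length is then in register `1` and whose bits are at the beginning of array `1`. -/
def State.HasOutput (σ : State) : Option (List Bool) → Prop
  | none => σ.reg 0 = 0
  | some y => σ.reg 0 = 1 ∧ σ.reg 1 = y.length ∧
      ∀ j, ∀ h : j < y.length, σ.arr 1 j = (y[j]'h).toNat

/-- On input `x`, the program `p` halts within time `T` with output `o`. -/
def Prog.Returns (p : Prog) (x : List Bool) (o : Option (List Bool)) (T : ℝ) : Prop :=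
  ∃ (t : ℕ) (τ : State), Exec p (State.init x) t τ ∧ τ.HasOutput o ∧ (t : ℝ) ≤ T

end RAM

/-! ### Expressions and memory updates -/

namespace RAM

/-! Let `ℓ` be the binary length of `n`, and fix `m` with `4km < 2^m`. The choice `m = log k + log
log k + O(1)` suffices, so there are only `M = 2^m = O(k log k)` patterns of `m` bits. Cutting a
string at the occurrences of a pattern synchronises codeword and received word, unless an occurrence
is created or destroyed by the deletions. A deleted bit lies in at most `m` windows, so at most
`2km` patterns are spoilt, fewer than half of all (`Emb.card_not_aligned`). For every other pattern
the pieces on both sides correspond (`Aligned.piece`), and at most `k` of them change their length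
(`Aligned.card_changed`).

Pieces must be short. Therefore the string is masked first: it is divided into blocks of `J = 2Mℓ`
segments of `m` bits, and segment `j` of every block is shifted by `t j` modulo `M`. A greedy choice
of `t j` realises at least the fraction `1/M` of the pairs (block, pattern) that are still missing
(`unmarked_step`). Since `(1 - 1/M)^J ≤ 2^(-2ℓ)`, every block finally contains every pattern
(`unmarked_eq_zero`), and all pieces are shorter than `4mJ` (`piece_lt`).

A piece is summarised by its length and the colours of its blocks of `L` bits, where `L` depends on
`k` only. The colours separate any two blocks with a common subsequence of `L - k` bits; greedy
colouring needs a number of colours polynomial in `L` (`exists_hash`). Hence for large `L` the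
summary is a number below `2^ℓ`. Since no bit moves by more than `k` places, the `L - k` received
bits at some offset of a piece come from the original block at the same offset (`Emb.sub`), so
summary and received piece determine the original piece.

For each pattern the sequence of summaries suffers at most `k` errors, and `2k` power sums modulo a
prime `q` with `2^ℓ < q ≤ 2 * 2^ℓ` correct them. The number, the places and the values of the errors
are read off from vanishing Hankel determinants (`hank_order_ne_zero`, `hank_locate`, `hank_value`);
the values are found by trying all `q = O(n)` residues.

The mask and the power sums for all patterns take `O(k^2 log k log n)` bits. They are appended in
blocks of constant size, each encoded with rate `1/2` against `k` deletions (`exists_code`). The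
decoder does not know which patterns are good; it decodes with all of them, takes the bitwise
majority (`card_good`) and removes the mask. All this takes `O(n log n)` elementary steps on numbers
of `O(log n)` bits, each of cost `O((log n)^2)`. -/

instance : Add Expr := ⟨.op .add⟩
instance : Sub Expr := ⟨.op .sub⟩
instance : Mul Expr := ⟨.op .mul⟩
instance : Div Expr := ⟨.op .div⟩
instance : Mod Expr := ⟨.op .mod⟩
instance (n : ℕ) : OfNat Expr n := ⟨.lit n⟩

section eval
variable (σ : State) (e e' : Expr)

@[simp] theorem Expr.eval_add : (e + e').eval σ = e.eval σ + e'.eval σ := rfl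
@[simp] theorem Expr.eval_sub : (e - e').eval σ = e.eval σ - e'.eval σ := rfl
@[simp] theorem Expr.eval_mul : (e * e').eval σ = e.eval σ * e'.eval σ := rfl
@[simp] theorem Expr.eval_div : (e / e').eval σ = e.eval σ / e'.eval σ := rfl
@[simp] theorem Expr.eval_mod : (e % e').eval σ = e.eval σ % e'.eval σ := rfl
@[simp] theorem Expr.eval_ofNat (n : ℕ) : Expr.eval σ (no_index (OfNat.ofNat n)) = n := rfl
@[simp] theorem Expr.eval_lit (n : ℕ) : (Expr.lit n).eval σ = n := rfl
@[simp] theorem Expr.eval_reg (i : ℕ) : (Expr.reg i).eval σ = σ.reg i := rfl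
@[simp] theorem Expr.eval_get (a : ℕ) : (Expr.get a e).eval σ = σ.arr a (e.eval σ) := rfl

end eval

/-- Test for `e < e'`. -/
def Expr.lt (e e' : Expr) : Expr := e' - e
/-- Test for `e = e'`. -/
def Expr.eq (e e' : Expr) : Expr := 1 - ((e - e') + (e' - e))

theorem Expr.eval_lt_ne_zero {σ : State} {e e' : Expr} :
    (e.lt e').eval σ ≠ 0 ↔ e.eval σ < e'.eval σ := by
  simp only [Expr.lt, Expr.eval_sub]; omega

theorem Expr.eval_eq_ne_zero {σ : State} {e e' : Expr} :
    (e.eq e').eval σ ≠ 0 ↔ e.eval σ = e'.eval σ := by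
  simp only [Expr.eq, Expr.eval_sub, Expr.eval_add, Expr.eval_ofNat]; omega

section state
variable (σ : State)

@[simp] theorem State.setReg_reg_self (i v : ℕ) : (σ.setReg i v).reg i = v := by
  simp [State.setReg]
@[simp] theorem State.setReg_reg_ne {i j : ℕ} (v : ℕ) (h : j ≠ i) :
    (σ.setReg i v).reg j = σ.reg j := by
  simp [State.setReg, h]
@[simp] theorem State.setReg_arr (i v : ℕ) : (σ.setReg i v).arr = σ.arr := rfl
@[simp] theorem State.setArr_reg (a j v : ℕ) : (σ.setArr a j v).reg = σ.reg := rfl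
@[simp] theorem State.setArr_arr_self (a j v : ℕ) :
    (σ.setArr a j v).arr a = Function.update (σ.arr a) j v := by
  simp [State.setArr]
@[simp] theorem State.setArr_arr_ne {a a' : ℕ} (j v : ℕ) (h : a' ≠ a) :
    (σ.setArr a j v).arr a' = σ.arr a' := by
  simp [State.setArr, h]

end state

/-! ### Costs of expressions when all memory contents are short -/

/-- All values in the state have at most `b` bits. -/
def State.Bdd (b : ℕ) (σ : State) : Prop :=
  (∀ i, σ.reg i < 2 ^ b) ∧ ∀ a j, σ.arr a j < 2 ^ b

theorem State.Bdd.setReg {b : ℕ} {σ : State} (h : σ.Bdd b) {i v : ℕ} (hv : v < 2 ^ b) :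
    (σ.setReg i v).Bdd b := by
  refine ⟨fun j => ?_, h.2⟩
  by_cases hj : j = i
  · subst hj; simpa using hv
  · simpa [hj] using h.1 j

theorem State.Bdd.setArr {b : ℕ} {σ : State} (h : σ.Bdd b) {a i v : ℕ} (hv : v < 2 ^ b) :
    (σ.setArr a i v).Bdd b := by
  refine ⟨h.1, fun a' j => ?_⟩
  by_cases ha : a' = a
  · subst ha
    by_cases hj : j = i
    · subst hj; simpa using hv
    · simpa [hj] using h.2 a' j
  · simpa [ha] using h.2 a' j

/-- `e.wt * (b + 1)` bounds the length of the value of `e` when all memory contents have at most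
`b` bits. -/
def Expr.wt : Expr → ℕ
  | .lit c => c.size + 1
  | .reg _ => 1
  | .get _ _ => 1
  | .op _ e₁ e₂ => e₁.wt + e₂.wt + 1

/-- `e.kc * (b + 1) ^ 2` bounds the cost of `e` when all memory contents have at most `b` bits. -/
def Expr.kc : Expr → ℕ
  | .lit c => 1 + c.size
  | .reg _ => 1
  | .get _ e => e.kc + e.wt + 1
  | .op _ e₁ e₂ => e₁.kc + e₂.kc + (1 + e₁.wt) * (1 + e₂.wt)

/-- A sum has at most one bit more than the longer operand and a product at most the sum of the
lengths; the other results do not exceed the first operand. -/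
theorem Op.size_eval_le (o : Op) (x y : ℕ) : (o.eval x y).size ≤ x.size + y.size + 1 := by
  have hx := Nat.lt_size_self x
  have hy := Nat.lt_size_self y
  have h2 : 2 ^ (x.size + y.size + 1) = 2 * (2 ^ x.size * 2 ^ y.size) := by ring
  have hle : x ≤ 2 ^ (x.size + y.size + 1) - 1 := by
    have : 2 ^ x.size ≤ 2 ^ (x.size + y.size + 1) := Nat.pow_le_pow_right (by norm_num) (by omega)
    omega
  have key : ∀ z, z ≤ x → z.size ≤ x.size + y.size + 1 := fun z hz =>
    (Nat.size_le_size hz).trans (by omega)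
  cases o with
  | add =>
    rw [Nat.size_le, h2]
    have h1 : 1 ≤ 2 ^ x.size := Nat.one_le_two_pow
    have h1' : 1 ≤ 2 ^ y.size := Nat.one_le_two_pow
    simp only [Op.eval]
    nlinarith
  | sub => exact key _ (Nat.sub_le _ _)
  | mul =>
    rw [Nat.size_le, h2]
    have := Nat.mul_lt_mul'' hx hy
    simp only [Op.eval]
    omega
  | div => exact key _ (Nat.div_le_self _ _)
  | mod => exact key _ (Nat.mod_le _ _)

theorem Op.cost_le (o : Op) (x y : ℕ) : o.cost x y ≤ (1 + x.size) * (1 + y.size) := by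
  cases o <;> simp only [Op.cost] <;> nlinarith

theorem Expr.size_eval_le {b : ℕ} {σ : State} (h : σ.Bdd b) (e : Expr) :
    (e.eval σ).size ≤ e.wt * (b + 1) := by
  induction e with
  | lit c => simp only [Expr.eval, Expr.wt]; nlinarith
  | reg i => have := Nat.size_le.2 (h.1 i); simp only [Expr.eval, Expr.wt]; omega
  | get a e _ => have := Nat.size_le.2 (h.2 a (e.eval σ)); simp only [Expr.eval, Expr.wt]; omega
  | op o e₁ e₂ h₁ h₂ =>
    have := Op.size_eval_le o (e₁.eval σ) (e₂.eval σ)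
    simp only [Expr.eval, Expr.wt]
    nlinarith

/-- The shape of an expression is fixed by the program, so it enters through constants only.
Intermediate values may exceed `b` bits, but only by the factor `wt`; the square comes from
multiplication and division. -/
theorem Expr.cost_le {b : ℕ} {σ : State} (h : σ.Bdd b) (e : Expr) :
    e.cost σ ≤ e.kc * (b + 1) ^ 2 := by
  induction e with
  | lit c =>
    simp only [Expr.cost, Expr.kc]
    exact Nat.le_mul_of_pos_right _ (by positivity)
  | reg i => have := Nat.size_le.2 (h.1 i); simp only [Expr.cost, Expr.kc]; nlinarith
  | get a e ih =>
    have h1 := Nat.size_le.2 (h.2 a (e.eval σ))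
    have h2 := Expr.size_eval_le h e
    have h3 : e.wt * (b + 1) ≤ e.wt * (b + 1) ^ 2 := by
      apply Nat.mul_le_mul_left; nlinarith
    simp only [Expr.cost, Expr.kc]
    nlinarith
  | op o e₁ e₂ h₁ h₂ =>
    have s1 := Expr.size_eval_le h e₁
    have s2 := Expr.size_eval_le h e₂
    have h4 := Op.cost_le o (e₁.eval σ) (e₂.eval σ)
    have h5 : (1 + (e₁.eval σ).size) * (1 + (e₂.eval σ).size) ≤
        ((1 + e₁.wt) * (b + 1)) * ((1 + e₂.wt) * (b + 1)) := by
      apply Nat.mul_le_mul <;> nlinarith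
    simp only [Expr.cost, Expr.kc]
    nlinarith

/-! ### A program logic with step counts and frames -/

/-- `p.mx * (b + 1) ^ 2` bounds the cost of every elementary step of `p` when all memory contents
have at most `b` bits. -/
def Prog.mx : Prog → ℕ
  | .nop => 1
  | .assign _ e => e.kc + 1 + e.wt
  | .store _ idx e => idx.kc + e.kc + 1 + idx.wt + e.wt
  | .seq p q => p.mx + q.mx
  | .ite e p q => e.kc + 1 + p.mx + q.mx
  | .loop e p => e.kc + 1 + p.mx

/-- Does the program assign to register `i`? -/
@[simp] def Prog.wr (i : ℕ) : Prog → Bool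
  | .nop => false
  | .assign j _ => i == j
  | .store _ _ _ => false
  | .seq p q => p.wr i || q.wr i
  | .ite _ p q => p.wr i || q.wr i
  | .loop _ p => p.wr i

/-- Does the program store into array `a`? -/
@[simp] def Prog.wa (a : ℕ) : Prog → Bool
  | .nop => false
  | .assign _ _ => false
  | .store a' _ _ => a == a'
  | .seq p q => p.wa a || q.wa a
  | .ite _ p q => p.wa a || q.wa a
  | .loop _ p => p.wa a

/-- The two states agree on everything that `p` does not write. -/
structure Frame (p : Prog) (σ τ : State) : Prop where
  reg : ∀ i, p.wr i = false → τ.reg i = σ.reg i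
  arr : ∀ a, p.wa a = false → τ.arr a = σ.arr a

theorem Frame.refl (p : Prog) (σ : State) : Frame p σ σ := ⟨fun _ _ => rfl, fun _ _ => rfl⟩

theorem Frame.trans {p : Prog} {σ τ υ : State} (h : Frame p σ τ) (h' : Frame p τ υ) :
    Frame p σ υ :=
  ⟨fun i hi => (h'.reg i hi).trans (h.reg i hi), fun i hi => (h'.arr i hi).trans (h.arr i hi)⟩

theorem Frame.of_imp {p q : Prog} {σ τ : State} (h : Frame p σ τ)
    (hr : ∀ i, q.wr i = false → p.wr i = false) (ha : ∀ i, q.wa i = false → p.wa i = false) :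
    Frame q σ τ :=
  ⟨fun i hi => h.reg i (hr i hi), fun i hi => h.arr i (ha i hi)⟩

theorem Exec.frame {p : Prog} {σ τ : State} {t : ℕ} (h : Exec p σ t τ) : Frame p σ τ := by
  induction h with
  | nop σ => exact .refl _ _
  | assign σ i e =>
    refine ⟨fun j hj => ?_, fun _ _ => rfl⟩
    have : j ≠ i := by simpa using hj
    simp [this]
  | store σ a idx e =>
    refine ⟨fun _ _ => rfl, fun j hj => ?_⟩
    have : j ≠ a := by simpa using hj
    simp [this]
  | seq _ _ h1 h2 =>
    exact (h1.of_imp (by simp +contextual) (by simp +contextual)).trans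
      (h2.of_imp (by simp +contextual) (by simp +contextual))
  | ite_true _ _ h => exact h.of_imp (by simp +contextual) (by simp +contextual)
  | ite_false _ _ h => exact h.of_imp (by simp +contextual) (by simp +contextual)
  | loop_true _ _ _ h1 h2 => exact (h1.of_imp (by simp) (by simp)).trans h2
  | loop_false _ => exact .refl _ _

/-- Started in `σ`, the program `p` halts within `c` elementary steps in a state that satisfies
`Q`, and no value ever exceeds `b` bits. -/
def Runs (b : ℕ) (p : Prog) (σ : State) (c : ℕ) (Q : State → Prop) : Prop :=
  σ.Bdd b → ∃ t τ, Exec p σ t τ ∧ t ≤ c * (p.mx * (b + 1) ^ 2) ∧ τ.Bdd b ∧ Q τ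

namespace Runs
variable {b c c' : ℕ} {p q : Prog} {σ : State} {Q R : State → Prop}

theorem mono (h : Runs b p σ c Q) (hc : c ≤ c') : Runs b p σ c' Q := fun hb =>
  let ⟨t, τ, h1, h2, h3⟩ := h hb
  ⟨t, τ, h1, h2.trans (Nat.mul_le_mul_right _ hc), h3⟩

theorem conseq (h : Runs b p σ c R) (hQ : ∀ τ, τ.Bdd b → Frame p σ τ → R τ → Q τ) :
    Runs b p σ c Q := fun hb =>
  let ⟨t, τ, h1, h2, h3, h4⟩ := h hb
  ⟨t, τ, h1, h2, h3, hQ τ h3 h1.frame h4⟩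

theorem of_bdd (h : σ.Bdd b → Runs b p σ c Q) : Runs b p σ c Q := fun hb => h hb hb

theorem nop (h : Q σ) : Runs b .nop σ 1 Q := fun hb =>
  ⟨1, σ, .nop σ, by simpa [Prog.mx] using Nat.one_le_pow _ _ (Nat.succ_pos b), hb, h⟩

theorem assign {i : ℕ} {e : Expr} (v : ℕ) (he : e.eval σ = v) (hv : v < 2 ^ b)
    (h : Q (σ.setReg i v)) : Runs b (.assign i e) σ 1 Q := by
  intro hb
  subst he
  refine ⟨_, _, .assign σ i e, ?_, hb.setReg hv, h⟩
  have h1 := Expr.cost_le hb e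
  have h2 := Expr.size_eval_le hb e
  have h3 : e.wt * (b + 1) ≤ e.wt * (b + 1) ^ 2 := by apply Nat.mul_le_mul_left; nlinarith
  simp only [Prog.mx]
  nlinarith

theorem store {a : ℕ} {idx e : Expr} (j v : ℕ) (hj : idx.eval σ = j) (he : e.eval σ = v)
    (hv : v < 2 ^ b) (h : Q (σ.setArr a j v)) : Runs b (.store a idx e) σ 1 Q := by
  intro hb
  subst he hj
  refine ⟨_, _, .store σ a idx e, ?_, hb.setArr hv, h⟩
  have h1 := Expr.cost_le hb e
  have h2 := Expr.size_eval_le hb e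
  have h3 : e.wt * (b + 1) ≤ e.wt * (b + 1) ^ 2 := by apply Nat.mul_le_mul_left; nlinarith
  have h4 := Expr.cost_le hb idx
  have h5 := Expr.size_eval_le hb idx
  have h6 : idx.wt * (b + 1) ≤ idx.wt * (b + 1) ^ 2 := by apply Nat.mul_le_mul_left; nlinarith
  simp only [Prog.mx]
  nlinarith

theorem seq {c₁ c₂ : ℕ} (h1 : Runs b p σ c₁ R)
    (h2 : ∀ τ, Frame p σ τ → R τ → Runs b q τ c₂ Q) : Runs b (.seq p q) σ (c₁ + c₂) Q := by
  intro hb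
  obtain ⟨t, τ, e1, l1, b1, r1⟩ := h1 hb
  obtain ⟨u, υ, e2, l2, b2, r2⟩ := h2 τ e1.frame r1 b1
  refine ⟨t + u, υ, .seq e1 e2, ?_, b2, r2⟩
  simp only [Prog.mx]
  have : c₁ * (p.mx * (b + 1) ^ 2) ≤ c₁ * ((p.mx + q.mx) * (b + 1) ^ 2) := by gcongr; omega
  have : c₂ * (q.mx * (b + 1) ^ 2) ≤ c₂ * ((p.mx + q.mx) * (b + 1) ^ 2) := by gcongr; omega
  rw [Nat.add_mul]
  omega

theorem ite {e : Expr} (h1 : e.eval σ ≠ 0 → Runs b p σ c Q)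
    (h2 : e.eval σ = 0 → Runs b q σ c Q) : Runs b (.ite e p q) σ (c + 1) Q := by
  intro hb
  have hc := Expr.cost_le hb e
  have hpos : 1 ≤ (b + 1) ^ 2 := Nat.one_le_pow _ _ (by omega)
  by_cases he : e.eval σ = 0
  · obtain ⟨t, τ, e1, l1, b1, r1⟩ := h2 he hb
    refine ⟨_, τ, .ite_false he e1, ?_, b1, r1⟩
    simp only [Prog.mx]
    have : c * (q.mx * (b + 1) ^ 2) ≤ c * ((e.kc + 1 + p.mx + q.mx) * (b + 1) ^ 2) := by
      gcongr; omega
    nlinarith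
  · obtain ⟨t, τ, e1, l1, b1, r1⟩ := h1 he hb
    refine ⟨_, τ, .ite_true he e1, ?_, b1, r1⟩
    simp only [Prog.mx]
    have : c * (p.mx * (b + 1) ^ 2) ≤ c * ((e.kc + 1 + p.mx + q.mx) * (b + 1) ^ 2) := by
      gcongr; omega
    nlinarith

end Runs

/-- Sequential composition of a list of programs. -/
@[simp] def block : List Prog → Prog
  | [] => .nop
  | p :: l => .seq p (block l)

namespace Runs
variable {b c c' : ℕ} {p q : Prog} {l : List Prog} {σ : State} {Q R : State → Prop}

theorem nil (h : Q σ) (hc : 1 ≤ c := by omega) : Runs b (block []) σ c Q := (nop h).mono hc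

/-- The tail receives what is left of the budget `c`. Thus the total is fixed at the beginning, a
block is treated from left to right, and the arithmetic is left to `omega`. -/
theorem cons {c₁ : ℕ} (h1 : Runs b p σ c₁ R)
    (h2 : ∀ τ, Frame p σ τ → R τ → Runs b (block l) τ (c - c₁) Q) (hc : c₁ ≤ c := by omega) :
    Runs b (block (p :: l)) σ c Q :=
  (h1.seq h2).mono (by omega)

theorem cons_assign {i : ℕ} {e : Expr} (v : ℕ) (he : e.eval σ = v) (hv : v < 2 ^ b)
    (h : Runs b (block l) (σ.setReg i v) (c - 1) Q) (hc : 1 ≤ c := by omega) :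
    Runs b (block (.assign i e :: l)) σ c Q :=
  cons (R := fun τ => τ = σ.setReg i v) (assign v he hv rfl) (by rintro τ - rfl; exact h) hc

theorem cons_store {a : ℕ} {idx e : Expr} (j v : ℕ) (hj : idx.eval σ = j) (he : e.eval σ = v)
    (hv : v < 2 ^ b) (h : Runs b (block l) (σ.setArr a j v) (c - 1) Q)
    (hc : 1 ≤ c := by omega) :
    Runs b (block (.store a idx e :: l)) σ c Q :=
  cons (R := fun τ => τ = σ.setArr a j v) (store j v hj he hv rfl)
    (by rintro τ - rfl; exact h) hc

theorem ite' {e : Expr} (h1 : e.eval σ ≠ 0 → Runs b p σ (c - 1) Q)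
    (h2 : e.eval σ = 0 → Runs b q σ (c - 1) Q) (hc : 1 ≤ c := by omega) :
    Runs b (.ite e p q) σ c Q := (ite h1 h2).mono (by omega)

end Runs

/-- Run `body` for the values `0, 1, …` of register `i` that are smaller than `lim`. -/
def forP (i : ℕ) (lim : Expr) (body : Prog) : Prog :=
  .seq (.assign i 0) (.loop ((Expr.reg i).lt lim) (.seq body (.assign i (.reg i + 1))))

-- The `wr` and `wa` lemmas compute the footprint of each program. With them `simp` decides which
-- registers and arrays a frame preserves.
@[simp] theorem forP_wr (i j : ℕ) (lim : Expr) (body : Prog) :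
    (forP i lim body).wr j = (j == i || body.wr j) := by
  simp [forP]; cases (j == i) <;> simp
@[simp] theorem forP_wa (i j : ℕ) (lim : Expr) (body : Prog) :
    (forP i lim body).wa j = body.wa j := by
  simp [forP]

/-- The limit is evaluated anew in every round; `hlim` demands that the frame of the loop fixes its
value. Each round pays two extra steps, for the test and for the increment, and two more pay for the
initialisation and the last test. The cost may depend on the round, as in the sieve. -/
theorem Runs.forP {b i : ℕ} {lim : Expr} {body : Prog} {σ : State} {Q : State → Prop} (n : ℕ)
    (cost : ℕ → ℕ) (Inv : ℕ → State → Prop) (hi : body.wr i = false) (hn : n < 2 ^ b)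
    (hlim : ∀ τ, Frame (forP i lim body) σ τ → lim.eval τ = n)
    (h0 : Inv 0 (σ.setReg i 0))
    (hs : ∀ j τ, j < n → τ.reg i = j → Frame (RAM.forP i lim body) σ τ → Inv j τ →
      Runs b body τ (cost j) (fun τ' => Inv (j + 1) (τ'.setReg i (j + 1))))
    (hQ : ∀ τ, τ.reg i = n → Frame (RAM.forP i lim body) σ τ → Inv n τ → Q τ) :
    Runs b (RAM.forP i lim body) σ (∑ j ∈ Finset.range n, (cost j + 2) + 2) Q := by
  set P := RAM.forP i lim body with hP
  set T := Expr.lt (Expr.reg i) lim with hT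
  set B := Prog.seq body (.assign i (.reg i + 1)) with hB
  have frB : ∀ {τ τ'}, Frame B τ τ' → Frame P τ τ' := fun h =>
    h.of_imp (by simp +contextual [hP, hB]) (by simp +contextual [hP, hB])
  -- Induction on the number `s` of remaining rounds.
  have loop : ∀ s j τ, j + s = n → τ.reg i = j → Frame P σ τ → Inv j τ →
      Runs b (.loop T B) τ (∑ x ∈ Finset.range s, (cost (j + x) + 2) + 1) Q := by
    intro s
    induction s with
    | zero =>
      intro j τ hj hr hf hI hb
      have hjn : j = n := by omega
      subst hjn
      have : T.eval τ = 0 := by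
        simp [hT, Expr.lt, hlim τ hf, hr]
      refine ⟨_, τ, .loop_false this, ?_, hb, hQ τ hr hf hI⟩
      have := Expr.cost_le hb T
      have hpos : 1 ≤ (b + 1) ^ 2 := Nat.one_le_pow _ _ (by omega)
      simp only [Prog.mx, Finset.range_zero, Finset.sum_empty]
      nlinarith
    | succ s ih =>
      intro j τ hj hr hf hI hb
      have ht : T.eval τ ≠ 0 := by
        rw [hT, Expr.eval_lt_ne_zero, hlim τ hf]; simp [hr]; omega
      have step : Runs b B τ (cost j + 1)
          (fun τ' => τ'.reg i = j + 1 ∧ Inv (j + 1) τ') := by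
        refine Runs.seq (hs j τ (by omega) hr hf hI) (fun τ' hf' h' => ?_)
        have h1 : τ'.reg i = j := by rw [hf'.reg i hi, hr]
        exact Runs.assign (j + 1) (by simp [h1]) (by omega) ⟨by simp, h'⟩
      obtain ⟨t, τ', e1, l1, b1, r1, r2⟩ := step hb
      obtain ⟨u, υ, e2, l2, b2, r3⟩ := ih (j + 1) τ' (by omega) r1
        (hf.trans (frB e1.frame)) r2 b1
      refine ⟨_, υ, .loop_true ht e1 e2, ?_, b2, r3⟩
      have hc := Expr.cost_le hb T
      rw [Finset.sum_range_succ']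
      simp only [Prog.mx] at l2 ⊢
      have e3 : ∀ x, j + 1 + x = j + (x + 1) := fun x => by omega
      simp only [e3] at l2
      set S := ∑ x ∈ Finset.range s, (cost (j + (x + 1)) + 2)
      have : (cost j + 1) * (B.mx * (b + 1) ^ 2) ≤
          (cost j + 1) * ((T.kc + 1 + B.mx) * (b + 1) ^ 2) := by gcongr; omega
      have hpos : 1 ≤ (b + 1) ^ 2 := Nat.one_le_pow _ _ (by omega)
      have e4 : (S + (cost (j + 0) + 2) + 1) * ((T.kc + 1 + B.mx) * (b + 1) ^ 2) =
        (S + 1) * ((T.kc + 1 + B.mx) * (b + 1) ^ 2) +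
        (cost j + 1) * ((T.kc + 1 + B.mx) * (b + 1) ^ 2) + (T.kc + 1 + B.mx) * (b + 1) ^ 2 := by
        simp only [Nat.add_zero]; ring
      rw [e4]
      nlinarith
  have := Runs.seq (b := b) (p := .assign i 0) (q := .loop T B) (σ := σ) (c₁ := 1) (Q := Q)
    (c₂ := ∑ x ∈ Finset.range n, (cost (0 + x) + 2) + 1)
    (R := fun τ => τ = σ.setReg i 0)
    (Runs.assign 0 (by simp) (by positivity) rfl) (by
      rintro τ hf rfl
      exact loop n 0 _ (by omega) (by simp) (hf.of_imp (by simp +contextual [hP]) (by simp)) h0)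
  simp only [Nat.zero_add] at this
  exact this.mono (by omega)

/-- The loop rule for a body of constant cost. -/
theorem Runs.for_const {b i : ℕ} {lim : Expr} {body : Prog} {σ : State} {Q : State → Prop}
    (n cost : ℕ) (Inv : ℕ → State → Prop) (hi : body.wr i = false) (hn : n < 2 ^ b)
    (hlim : ∀ τ, Frame (RAM.forP i lim body) σ τ → lim.eval τ = n)
    (h0 : Inv 0 (σ.setReg i 0))
    (hs : ∀ j τ, j < n → τ.reg i = j → Frame (RAM.forP i lim body) σ τ → Inv j τ →
      Runs b body τ cost (fun τ' => Inv (j + 1) (τ'.setReg i (j + 1))))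
    (hQ : ∀ τ, τ.reg i = n → Frame (RAM.forP i lim body) σ τ → Inv n τ → Q τ) :
    Runs b (RAM.forP i lim body) σ (n * (cost + 2) + 2) Q := by
  simpa using Runs.forP n (fun _ => cost) Inv hi hn hlim h0 hs hQ

theorem Runs.cons_for {b i c : ℕ} {lim : Expr} {body : Prog} {l : List Prog} {σ : State}
    {Q : State → Prop} (n cost : ℕ) (Inv : ℕ → State → Prop) (hi : body.wr i = false)
    (hn : n < 2 ^ b) (hlim : ∀ τ, Frame (RAM.forP i lim body) σ τ → lim.eval τ = n)
    (h0 : Inv 0 (σ.setReg i 0))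
    (hs : ∀ j τ, j < n → τ.reg i = j → Frame (RAM.forP i lim body) σ τ → Inv j τ →
      Runs b body τ cost (fun τ' => Inv (j + 1) (τ'.setReg i (j + 1))))
    (hQ : ∀ τ, Frame (RAM.forP i lim body) σ τ → Inv n τ →
      Runs b (block l) τ (c - (n * (cost + 2) + 2)) Q)
    (hc : n * (cost + 2) + 2 ≤ c := by omega) :
    Runs b (block (RAM.forP i lim body :: l)) σ c Q :=
  .cons (R := fun τ => Inv n τ) (.for_const n cost Inv hi hn hlim h0 hs fun _ _ _ h => h) hQ hc

/-- Store the values `f 0, …, f (n - 1)` into array `a`. -/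
def table (a : ℕ) (f : ℕ → ℕ) : ℕ → Prog
  | 0 => .nop
  | n + 1 => .seq (table a f n) (.store a (.lit n) (.lit (f n)))

@[simp] theorem table_wr (a : ℕ) (f : ℕ → ℕ) (n i : ℕ) : (table a f n).wr i = false := by
  induction n <;> simp [table, *]
@[simp] theorem table_wa (a : ℕ) (f : ℕ → ℕ) (n i : ℕ) (h : i ≠ a) : (table a f n).wa i = false := by
  induction n <;> simp [table, *]

theorem Runs.table {b : ℕ} {σ : State} (a : ℕ) (f : ℕ → ℕ) (n : ℕ) (hf : ∀ i < n, f i < 2 ^ b) :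
    Runs b (table a f n) σ (n + 1) (fun τ => ∀ i < n, τ.arr a i = f i) := by
  induction n with
  | zero => exact Runs.nop (by simp)
  | succ n ih =>
    refine Runs.seq (ih fun i hi => hf i (by omega)) fun τ _ h =>
      Runs.store n (f n) (by simp) (by simp) (hf n (by omega)) fun i hi => ?_
    by_cases hin : i = n
    · subst hin; simp
    · simp [hin, h i (by omega)]

/-! ### Digits, windows and bit fields -/

/-- The number with base-`c` digits `F off, …, F (off + w - 1)`, least significant digit first. -/
def dig (c : ℕ) (F : ℕ → ℕ) (off w : ℕ) : ℕ := ∑ i ∈ Finset.range w, F (off + i) * c ^ i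

section dig
variable (c : ℕ) (F : ℕ → ℕ) (off w : ℕ)

@[simp] theorem dig_zero : dig c F off 0 = 0 := by simp [dig]

/-- Horner's rule; the programs that read numbers proceed in this way from the last digit to the
first and never need a power of `c`. -/
theorem dig_succ : dig c F off (w + 1) = c * dig c F (off + 1) w + F off := by
  simp only [dig, Finset.sum_range_succ', Finset.mul_sum]
  simp only [Nat.add_zero, pow_zero, mul_one, Nat.add_right_cancel_iff]
  refine Finset.sum_congr rfl fun i _ => ?_
  rw [show off + 1 + i = off + (i + 1) by omega]; ring

theorem dig_succ_right : dig c F off (w + 1) = dig c F off w + F (off + w) * c ^ w := by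
  simp [dig, Finset.sum_range_succ]

variable {c F off w}

theorem dig_congr {F' : ℕ → ℕ} {off' : ℕ} (h : ∀ i < w, F (off + i) = F' (off' + i)) :
    dig c F off w = dig c F' off' w :=
  Finset.sum_congr rfl fun i hi => by rw [h i (Finset.mem_range.1 hi)]

theorem dig_lt (hF : ∀ i < w, F (off + i) < c) : dig c F off w < c ^ w := by
  induction w with
  | zero => simp
  | succ w ih =>
    rw [dig_succ_right, pow_succ]
    have h1 := ih fun i hi => hF i (by omega)
    have h2 := hF w (by omega)
    have h3 : F (off + w) * c ^ w + c ^ w ≤ c ^ w * c := by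
      rw [← Nat.succ_mul, Nat.mul_comm]; exact Nat.mul_le_mul_left _ h2
    omega

theorem dig_div_mod (hF : ∀ i < w, F (off + i) < c) {i : ℕ} (hi : i < w) :
    dig c F off w / c ^ i % c = F (off + i) := by
  induction w generalizing off i with
  | zero => omega
  | succ w ih =>
    have hc : 0 < c := (Nat.zero_le _).trans_lt (hF 0 (by omega))
    have h0 := hF 0 (by omega)
    rw [Nat.add_zero] at h0
    rw [dig_succ]
    cases i with
    | zero => simp [Nat.add_comm, Nat.add_mul_mod_self_left, Nat.mod_eq_of_lt h0]
    | succ i =>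
      rw [pow_succ', ← Nat.div_div_eq_div_mul, Nat.add_comm (c * _),
        Nat.add_mul_div_left _ _ hc, Nat.div_eq_of_lt h0, Nat.zero_add,
        ih (fun j hj => ?_) (by omega)]
      · congr 1; omega
      · have := hF (j + 1) (by omega)
        rwa [show off + 1 + j = off + (j + 1) by omega]

theorem dig_eq_iff (hF : ∀ i < w, F (off + i) < c) {F' : ℕ → ℕ} {off' : ℕ}
    (hF' : ∀ i < w, F' (off' + i) < c) :
    dig c F off w = dig c F' off' w ↔ ∀ i < w, F (off + i) = F' (off' + i) := by
  refine ⟨fun h i hi => ?_, dig_congr⟩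
  rw [← dig_div_mod hF hi, ← dig_div_mod hF' hi, h]

theorem dig_digits (hc : 0 < c) {v : ℕ} (hv : v < c ^ w) :
    dig c (fun i => v / c ^ i % c) 0 w = v := by
  induction w generalizing v with
  | zero => simp at hv; simp [hv]
  | succ w ih =>
    have hv' : v / c < c ^ w := by
      rw [Nat.div_lt_iff_lt_mul hc, ← pow_succ]; exact hv
    rw [dig_succ]
    have : dig c (fun i => v / c ^ i % c) (0 + 1) w = dig c (fun i => v / c / c ^ i % c) 0 w :=
      dig_congr fun i _ => by
        simp only [Nat.zero_add]
        rw [Nat.add_comm, pow_succ', Nat.div_div_eq_div_mul]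
    rw [this, ih hv', pow_zero, Nat.div_one, Nat.div_add_mod]

end dig

/-- The number with binary digits `X off, …, X (off + w - 1)`, where `X` is cut off at `e`. -/
def win (X : ℕ → ℕ) (e off w : ℕ) : ℕ := dig 2 (fun i => if i < e then X i else 0) off w

/-- Digits beyond the cut are zero. In truncated subtraction `w - (w - (e - off))` is the minimum of
`w` and `e - off`, and it is `0` for a window that begins after `e`. -/
theorem win_eq_dig (X : ℕ → ℕ) (e off w : ℕ) :
    win X e off w = dig 2 X off (w - (w - (e - off))) := by
  set w' := w - (w - (e - off)) with hw'
  have h : ∀ s, w' ≤ s → s ≤ w →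
      dig 2 (fun i => if i < e then X i else 0) off s = dig 2 X off w' := by
    intro s hs
    induction s, hs using Nat.le_induction with
    | base => exact fun _ => dig_congr fun i hi => if_pos (by omega)
    | succ s hs ih =>
      intro hsw
      rw [dig_succ_right, ih (by omega), if_neg (by omega)]; simp
  exact h w (by omega) le_rfl

theorem win_of_le {X : ℕ → ℕ} {e off w : ℕ} (h : off + w ≤ e) : win X e off w = dig 2 X off w := by
  rw [win_eq_dig]; congr 1; omega

theorem win_lt {X : ℕ → ℕ} (hX : ∀ i, X i ≤ 1) (e off w : ℕ) : win X e off w < 2 ^ w :=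
  dig_lt fun i _ => by have := hX (off + i); split <;> omega

theorem win_bit {X : ℕ → ℕ} (hX : ∀ i, X i ≤ 1) {e off w i : ℕ} (hi : i < w) :
    win X e off w / 2 ^ i % 2 = if off + i < e then X (off + i) else 0 :=
  dig_div_mod (fun i _ => by have := hX (off + i); split <;> omega) hi

/-- Overwrite `w` cells from `off` on by the binary digits of `v`. -/
def putBits (X : ℕ → ℕ) (off w v : ℕ) : ℕ → ℕ := fun y =>
  if off ≤ y ∧ y < off + w then v / 2 ^ (y - off) % 2 else X y

theorem putBits_le {X : ℕ → ℕ} (hX : ∀ i, X i ≤ 1) (off w v i : ℕ) : putBits X off w v i ≤ 1 := by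
  unfold putBits; split
  · omega
  · exact hX i

theorem dig_putBits (X : ℕ → ℕ) {off w v : ℕ} (hv : v < 2 ^ w) :
    dig 2 (putBits X off w v) off w = v := by
  rw [← dig_digits (c := 2) (by norm_num) hv]
  refine dig_congr fun i hi => ?_
  simp only [putBits, dig_digits (c := 2) (by norm_num) hv]
  rw [if_pos (by omega)]; congr 3; omega

/-- Read `win a (reg 11) (reg 10) (reg 12)` into register `13`. -/
def readWin (a : ℕ) : Prog := block [
  .assign 14 (.reg 12 - (.reg 12 - (.reg 11 - .reg 10))),
  .assign 13 0,
  forP 15 (.reg 14) (.assign 13 (2 * .reg 13 + .get a (.reg 10 + (.reg 14 - 1 - .reg 15))))]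

@[simp] theorem readWin_wr (a i : ℕ) : (readWin a).wr i = (i == 13 || i == 14 || i == 15) := by
  simp only [readWin, block, Prog.wr, forP_wr]; grind
@[simp] theorem readWin_wa (a i : ℕ) : (readWin a).wa i = false := by simp [readWin]

/-- After `j` rounds of Horner's rule register `13` holds the top `j` digits of the visible part of
the window, hence less than `2 ^ j`; a window of at most `b` bits never overflows. -/
theorem Runs.readWin {b : ℕ} {σ : State} (a : ℕ) (hX : ∀ i, σ.arr a i ≤ 1) (hw : σ.reg 12 ≤ b) :
    Runs b (readWin a) σ (3 * σ.reg 12 + 5)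
      (fun τ => τ.reg 13 = win (σ.arr a) (σ.reg 11) (σ.reg 10) (σ.reg 12)) := by
  have hb : b < 2 ^ b := Nat.lt_two_pow_self
  set w := σ.reg 12 - (σ.reg 12 - (σ.reg 11 - σ.reg 10)) with hw'
  refine .cons_assign w (by simp [hw']) (by omega) ?_
  refine .cons_assign 0 (by simp) (by omega) ?_
  refine .cons (c₁ := w * (1 + 2) + 2) (.for_const w 1
    (fun j τ => τ.reg 13 = dig 2 (σ.arr a) (σ.reg 10 + (w - j)) j)
    (by simp) (by omega) (fun τ h => by simp [h.reg 14]) (by simp) ?_ (fun τ _ _ h => h))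
    (fun τ _ h => .nil ?_)
  · intro j τ hj hr hf hI
    have e1 := dig_succ 2 (σ.arr a) (σ.reg 10 + (w - (j + 1))) j
    rw [show σ.reg 10 + (w - (j + 1)) + 1 = σ.reg 10 + (w - j) by omega] at e1
    have hlt := dig_lt (c := 2) (F := σ.arr a) (off := σ.reg 10 + (w - (j + 1))) (w := j + 1)
      (fun i _ => by have := hX (σ.reg 10 + (w - (j + 1)) + i); omega)
    refine .assign (dig 2 (σ.arr a) (σ.reg 10 + (w - (j + 1))) (j + 1)) ?_
      (hlt.trans_le (Nat.pow_le_pow_right (by norm_num) (by omega))) (by simp)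
    simp only [Expr.eval_add, Expr.eval_mul, Expr.eval_ofNat, Expr.eval_reg, Expr.eval_get, hI,
      hr, Expr.eval_sub, hf.reg 14 (by simp), hf.reg 10 (by simp), hf.arr a (by simp), e1]
    simp [show w - 1 - j = w - (j + 1) by omega]
  · rw [h, win_eq_dig, ← hw']; simp

/-- Write the `reg 21` lowest binary digits of `reg 22` to array `a` from `reg 20` on. -/
def writeBits (a : ℕ) : Prog :=
  forP 23 (.reg 21) (block [.store a (.reg 20 + .reg 23) (.reg 22 % 2), .assign 22 (.reg 22 / 2)])

@[simp] theorem writeBits_wr (a i : ℕ) : (writeBits a).wr i = (i == 22 || i == 23) := by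
  simp only [writeBits, block, Prog.wr, forP_wr]; grind
@[simp] theorem writeBits_wa (a i : ℕ) : (writeBits a).wa i = (i == a) := by simp [writeBits]

theorem Runs.writeBits {b : ℕ} {σ : State} (a : ℕ) (hb : 1 ≤ b) :
    Runs b (writeBits a) σ (5 * σ.reg 21 + 2)
      (fun τ => τ.arr a = putBits (σ.arr a) (σ.reg 20) (σ.reg 21) (σ.reg 22)) := by
  refine .of_bdd fun hbd => ?_
  have h2 : 2 ≤ 2 ^ b := by simpa using Nat.pow_le_pow_right (n := 2) (by norm_num) hb
  refine (Runs.for_const (σ.reg 21) 3 (fun j τ =>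
    τ.arr a = putBits (σ.arr a) (σ.reg 20) j (σ.reg 22) ∧ τ.reg 22 = σ.reg 22 / 2 ^ j)
    (by simp) (hbd.1 21) (fun τ h => by simp [h.reg 21]) ?_ ?_ (fun τ _ _ h => h.1)).mono
    (by omega)
  · refine ⟨?_, by simp⟩
    funext y; simp [putBits]
  · rintro j τ hj hr hf ⟨h1, h3⟩
    refine .cons_store (σ.reg 20 + j) (σ.reg 22 / 2 ^ j % 2) (by simp [hr, hf.reg 20])
      (by simp [h3]) (by omega) ?_
    refine .cons_assign (σ.reg 22 / 2 ^ (j + 1)) ?_ ?_ (.nil ⟨?_, by simp⟩)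
    · simp [h3, Nat.div_div_eq_div_mul, pow_succ]
    · exact (Nat.div_le_self _ _).trans_lt (hbd.1 22)
    · funext y
      simp only [State.setReg_arr, State.setArr_arr_self, h1, Function.update_apply, putBits]
      by_cases hy : y = σ.reg 20 + j
      · subst hy; simp
      · rw [if_neg hy]; congr 1; simp only [eq_iff_iff]; omega

/-! ### Cutting a string at marked positions -/

section split
variable (p : ℕ → Prop) [DecidablePred p] (len : ℕ)

/-- The boundaries of the pieces into which `[0, len)` is cut by the positions with `p`: piece `r`
is `[st p len r, st p len (r + 1))` for `r ≤ Nat.count p len`. -/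
noncomputable def st (r : ℕ) : ℕ :=
  if r = 0 then 0 else if r ≤ Nat.count p len then Nat.nth p (r - 1) else len

variable {p len}

@[simp] theorem st_zero : st p len 0 = 0 := by simp [st]

theorem st_last : st p len (Nat.count p len + 1) = len := by simp [st]

theorem st_of_mark {i : ℕ} (hi : p i) (h : i < len) : st p len (Nat.count p i + 1) = i := by
  have : Nat.count p i + 1 ≤ Nat.count p len := Nat.count_strict_mono hi h
  simp [st, this, Nat.nth_count hi]

theorem exists_mark_of_lt_count {t : ℕ} (h : t < Nat.count p len) :
    ∃ i < len, p i ∧ Nat.count p i = t := by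
  have hf : ∀ hf : (Set.ofPred p).Finite, t < hf.toFinset.card := fun hf =>
    h.trans_le (Nat.count_le_card hf _)
  exact ⟨_, Nat.nth_lt_of_lt_count h, Nat.nth_mem _ hf, Nat.count_nth hf⟩

theorem exists_st {r : ℕ} (h1 : 1 ≤ r) (h2 : r ≤ Nat.count p len) :
    ∃ i < len, p i ∧ Nat.count p i + 1 = r ∧ st p len r = i := by
  obtain ⟨i, hi, hp, hc⟩ := exists_mark_of_lt_count (p := p) (len := len) (t := r - 1) (by omega)
  have hr : Nat.count p i + 1 = r := by omega
  exact ⟨i, hi, hp, hr, hr ▸ st_of_mark hp hi⟩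

/-- Boundaries are compared through the number of marks before them, so that questions about their
order reduce to the monotonicity of `Nat.count`. -/
theorem count_st_succ {r : ℕ} (h : r ≤ Nat.count p len) : Nat.count p (st p len (r + 1)) = r := by
  rcases h.lt_or_eq with h | h
  · obtain ⟨i, _, _, hc, hs⟩ := exists_st (p := p) (len := len) (r := r + 1) (by omega) h
    rw [hs]; omega
  · rw [h, st_last]

theorem st_le_len (r : ℕ) : st p len r ≤ len := by
  unfold st
  split_ifs with h1 h2
  · omega
  · exact (Nat.nth_lt_of_lt_count (by omega)).le
  · rfl

theorem st_le_succ {r : ℕ} (h : r ≤ Nat.count p len) : st p len r ≤ st p len (r + 1) := by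
  rcases Nat.eq_zero_or_pos r with rfl | hr
  · simp
  · obtain ⟨i, hi, hp, hc, hs⟩ := exists_st hr h
    have h1 := count_st_succ h
    rw [hs]
    by_contra hlt
    have h3 := Nat.count_monotone p (show st p len (r + 1) ≤ i by omega)
    omega

theorem not_mark_of_between {r y : ℕ} (h : r ≤ Nat.count p len) (h1 : st p len r < y)
    (h2 : y < st p len (r + 1)) : ¬ p y := fun hy => by
  have h3 := Nat.count_strict_mono hy h2
  rw [count_st_succ h] at h3
  rcases Nat.eq_zero_or_pos r with rfl | hr
  · omega
  · obtain ⟨i, hi, hp, hc, hs⟩ := exists_st hr h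
    have := Nat.count_strict_mono hp (hs ▸ h1)
    omega

end split

/-! ### Deletions as embeddings -/

/-- `z` (of length `n - k`) arises from `x` (of length `n`) by deleting `k` entries; `f` maps
positions of `z` to positions of `x`, and continues beyond `z` as the shift by `k`. -/
structure Emb (k n : ℕ) (x z f : ℕ → ℕ) : Prop where
  le : k ≤ n
  mono : StrictMono f
  top : ∀ i, n - k ≤ i → f i = i + k
  eq : ∀ i < n - k, z i = x (f i)

/-- `X` cut off at `e`. -/
def cut (X : ℕ → ℕ) (e i : ℕ) : ℕ := if i < e then X i else 0

namespace Emb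
variable {k n : ℕ} {x z f : ℕ → ℕ} (E : Emb k n x z f)
include E

theorem le_self (i : ℕ) : i ≤ f i := E.mono.le_apply

theorem add_le (i j : ℕ) : f i + j ≤ f (i + j) := by
  induction j with
  | zero => simp
  | succ j ih => have := E.mono (show i + j < i + (j + 1) by omega); omega

/-- The displacement `f i - i` never decreases, and it equals `k` after `n - k` further positions.
-/
theorem le_add (i : ℕ) : f i ≤ i + k := by
  have h := E.add_le i (n - k)
  rw [E.top (i + (n - k)) (by omega)] at h
  omega

theorem last : f (n - k) = n := by rw [E.top _ le_rfl]; have := E.le; omega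

theorem lt_iff (i : ℕ) : f i < n ↔ i < n - k := by
  rw [← E.mono.lt_iff_lt (a := i) (b := n - k), E.last]

theorem le_of_le {i : ℕ} (h : i ≤ n - k) : f i ≤ n := by
  rw [← E.last]; exact E.mono.monotone h

/-- Because `f` continues as a shift and both sequences are cut off at their ends, the
correspondence holds at every index, and windows that reach over the end need no special treatment.
-/
theorem cut_eq (i : ℕ) : cut z (n - k) i = cut x n (f i) := by
  unfold cut
  by_cases h : i < n - k
  · rw [if_pos h, if_pos ((E.lt_iff i).2 h), E.eq i h]
  · rw [if_neg h, if_neg (fun h' => h ((E.lt_iff i).1 h'))]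

theorem card_missing : (Finset.range n \ (Finset.range (n - k)).image f).card = k := by
  rw [Finset.card_sdiff_of_subset, Finset.card_image_of_injective _ E.mono.injective]
  · simp; have := E.le; omega
  · intro i hi
    simp only [Finset.mem_image, Finset.mem_range] at hi ⊢
    obtain ⟨j, hj, rfl⟩ := hi
    exact (E.lt_iff j).2 hj

/-- The extended `f` covers everything from `n` on, so the deleted positions are exactly those
outside its range. -/
theorem mem_missing {i : ℕ} :
    i ∈ Finset.range n \ (Finset.range (n - k)).image f ↔ ∀ j, f j ≠ i := by
  simp only [Finset.mem_sdiff, Finset.mem_range, Finset.mem_image, not_exists, not_and]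
  constructor
  · rintro ⟨h1, h2⟩ j rfl
    exact h2 j ((E.lt_iff j).1 h1) rfl
  · refine fun h => ⟨?_, fun j _ => h j⟩
    by_contra hi
    have := E.le
    exact h (i - k) (by rw [E.top _ (by omega)]; omega)

end Emb

/-! ### Corresponding pieces of the two strings -/

/-- The positions with `px` are exactly the images of the positions with `pz`. -/
structure Aligned (k n : ℕ) (f : ℕ → ℕ) (px pz : ℕ → Prop) : Prop where
  iff : ∀ i < n - k, pz i ↔ px (f i)
  surj : ∀ i < n, px i → ∃ j, f j = i

namespace Aligned
variable {k n : ℕ} {x z f : ℕ → ℕ} {px pz : ℕ → Prop} [DecidablePred px] [DecidablePred pz]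

/-- Only deleted positions lie between `f i` and `f (i + 1)`, and none of them is marked, since
marks lie in the range of `f`. So both counts advance together. -/
theorem count_eq (E : Emb k n x z f) (A : Aligned k n f px pz) {i : ℕ} (hi : i ≤ n - k) :
    Nat.count px (f i) = Nat.count pz i := by
  have gap : ∀ a s, (∀ y, a ≤ y → y < a + s → ¬ px y) →
      Nat.count px (a + s) = Nat.count px a := fun a s h => by
    rw [Nat.count_add, Nat.add_eq_left, Nat.count_iff_forall_not]
    exact fun y hy => h _ (by omega) (by omega)
  induction i with
  | zero =>
    have := gap 0 (f 0) fun y _ hy hp => by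
      obtain ⟨j, rfl⟩ := A.surj y (by have := E.le_of_le hi; omega) hp
      have := E.mono.lt_iff_lt.1 (show f j < f 0 by omega)
      omega
    simpa using this
  | succ i ih =>
    have h1 := E.add_le i 1
    have := gap (f i + 1) (f (i + 1) - (f i + 1)) fun y h2 hy hp => by
      obtain ⟨j, rfl⟩ := A.surj y (by have := E.le_of_le hi; omega) hp
      have := E.mono.lt_iff_lt.1 (show f j < f (i + 1) by omega)
      have := E.mono.lt_iff_lt.1 (show f i < f j by omega)
      omega
    rw [show f i + 1 + (f (i + 1) - (f i + 1)) = f (i + 1) by omega] at this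
    rw [this, Nat.count_succ, Nat.count_succ, ih (by omega)]
    simp only [A.iff i (by omega)]

theorem cnt_eq (E : Emb k n x z f) (A : Aligned k n f px pz) :
    Nat.count px n = Nat.count pz (n - k) := by
  rw [← A.count_eq E le_rfl, E.last]

/-- The boundary `r = 0` is excluded: if the string begins with deleted bits, then `f 0` is positive
although the first piece begins at `0`. -/
theorem st_eq (E : Emb k n x z f) (A : Aligned k n f px pz) (r : ℕ) (hr : 1 ≤ r) :
    st px n r = f (st pz (n - k) r) := by
  by_cases h : r ≤ Nat.count pz (n - k)
  · obtain ⟨i, hi, hp, hc, hs⟩ := exists_st hr h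
    rw [hs]
    have := st_of_mark ((A.iff i hi).1 hp) ((E.lt_iff i).2 hi)
    rwa [A.count_eq E hi.le, hc] at this
  · have h' : ¬ r ≤ Nat.count px n := by rwa [A.cnt_eq E]
    have h0 : r ≠ 0 := by omega
    simp [st, h, h', h0, E.last]

/-- The embedding restricted to a piece, shifted to the beginnings of the pieces. -/
theorem piece (E : Emb k n x z f) (A : Aligned k n f px pz) {r : ℕ}
    (hr : r ≤ Nat.count pz (n - k)) :
    ∃ g : ℕ → ℕ, Emb ((st px n (r + 1) - st px n r) - (st pz (n - k) (r + 1) - st pz (n - k) r))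
        (st px n (r + 1) - st px n r) (fun i => x (st px n r + i))
        (fun i => z (st pz (n - k) r + i)) g ∧
      st pz (n - k) (r + 1) - st pz (n - k) r ≤ st px n (r + 1) - st px n r ∧
      st px n (r + 1) - st px n r ≤ st pz (n - k) (r + 1) - st pz (n - k) r + k := by
  have hrx : r ≤ Nat.count px n := by rwa [A.cnt_eq E]
  have m1 := st_le_succ hr
  have m2 := st_le_succ hrx
  have l1 := st_le_len (p := pz) (len := n - k) (r + 1)
  set a := st pz (n - k) r
  set e := st pz (n - k) (r + 1)
  set a' := st px n r with ha'
  set e' := st px n (r + 1) with he'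
  have E1 : e' = f e := A.st_eq E (r + 1) (by omega)
  -- Only an inequality at the left end, because of the exceptional boundary `0`.
  have E2 : ∀ i, a' + i ≤ f (a + i) := by
    intro i
    have : a' ≤ f a := by
      rcases Nat.eq_zero_or_pos r with h | h
      · simp [ha', h]
      · exact (A.st_eq E r h).le
    have := E.add_le a i
    omega
  have E4 : a ≤ a' := by
    rcases Nat.eq_zero_or_pos r with h | h
    · simp [a, h]
    · rw [ha', A.st_eq E r h]; exact E.le_self _
  have E3 := E2 (e - a)
  rw [show a + (e - a) = e by omega, ← E1] at E3
  have E5 := E.le_add e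
  rw [← E1] at E5
  -- Inside the piece `f` is recentred; beyond it the map continues as the shift by the number of
  -- bits that this piece loses.
  refine ⟨fun i => if i < e - a then f (a + i) - a' else i + ((e' - a') - (e - a)),
    ⟨by omega, ?_, ?_, ?_⟩, by omega, by omega⟩
  · refine strictMono_nat_of_lt_succ fun i => ?_
    have h1 := E2 i
    have h2 := E2 (i + 1)
    have h3 := E.mono (show a + i < a + (i + 1) by omega)
    split_ifs with h4 h5
    · omega
    · have h6 := E.add_le (a + i) (e - (a + i))
      rw [show a + i + (e - (a + i)) = e by omega, ← E1] at h6
      omega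
    · omega
    · omega
  · intro i hi
    rw [if_neg (by omega)]
  · intro i hi
    have hi' : i < e - a := by omega
    have h1 := E2 i
    rw [if_pos hi', E.eq _ (by omega)]
    congr 1; omega

end Aligned

theorem st_monotone (p : ℕ → Prop) [DecidablePred p] (len : ℕ) : Monotone (st p len) := by
  refine monotone_nat_of_le_succ fun r => ?_
  by_cases h : r ≤ Nat.count p len
  · exact st_le_succ h
  · have h1 : st p len (r + 1) = len := by
      simp only [st]; rw [if_neg (by omega), if_neg (by omega)]
    rw [h1]; exact st_le_len r

theorem sum_st (p : ℕ → Prop) [DecidablePred p] (len : ℕ) :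
    ∑ r ∈ Finset.range (Nat.count p len + 1), (st p len (r + 1) - st p len r) = len := by
  rw [Finset.sum_range_tsub (st_monotone p len), st_last]; simp

/-- The `L - k` bit string `z` arises from the `L` bit string `u` by deleting `k` bits. -/
def Sub (k L z u : ℕ) : Prop :=
  ∃ g : ℕ → ℕ, StrictMono g ∧ (∀ i, g i ≤ i + k) ∧ ∀ i < L - k, z / 2 ^ i % 2 = u / 2 ^ g i % 2

/-- Deleting at most `k` bits from `x` deletes at most `k` bits from each window of `x`. -/
theorem Emb.sub {κ k n L : ℕ} {x z f : ℕ → ℕ} (E : Emb κ n x z f) (hκ : κ ≤ k)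
    (hx : ∀ i, x i ≤ 1) (hz : ∀ i, z i ≤ 1) (o : ℕ) :
    Sub k L (win z (n - κ) o (L - k)) (win x n o L) := by
  -- Bits move to the left by at most `κ ≤ k` places. Hence `L - k` bits of `z` from offset `o` come
  -- from the `L` bits of `x` at the same offset.
  have hmono : StrictMono fun i => f (o + i) - o := fun i j hij => by
    have h1 := E.mono (show o + i < o + j by omega)
    have h2 := E.le_self (o + i)
    dsimp only; omega
  refine ⟨_, hmono, fun i => ?_, fun i hi => ?_⟩
  · have := E.le_add (o + i); omega
  · have h1 := E.le_add (o + i)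
    have h2 := E.le_self (o + i)
    rw [win_bit hz hi, win_bit hx (by omega)]
    have := E.cut_eq (o + i)
    rw [show o + (f (o + i) - o) = f (o + i) by omega]
    exact this

/-- The first `n - k` received bits come from the first `n` bits, as no bit moves by more than `k`
places; surplus bits of the prefix count as deleted. -/
theorem Emb.prefix {k N n : ℕ} {x z f : ℕ → ℕ} (E : Emb k N x z f) (hn : n ≤ N) (hk : k ≤ n) :
    Emb k n x z (fun i => if i < n - k then f i else i + k) where
  le := hk
  mono := by
    refine strictMono_nat_of_lt_succ fun i => ?_
    have h1 := E.mono (show i < i + 1 by omega)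
    have h2 := E.le_add i
    split_ifs <;> omega
  top i hi := by rw [if_neg (by omega)]
  eq i hi := by rw [if_pos hi, E.eq i (by omega)]

/-! ### Patterns that survive the deletions -/

/-- The pattern `p` of length `m` occurs at position `i`. -/
def mark (X : ℕ → ℕ) (len m p i : ℕ) : Prop := win X len i m = p

instance (X : ℕ → ℕ) (len m p : ℕ) : DecidablePred (mark X len m p) := fun _ =>
  inferInstanceAs (Decidable (_ = _))

open Classical in
/-- Few patterns have occurrences that are created or destroyed by `k` deletions. -/
theorem Emb.card_not_aligned {k n : ℕ} {x z f : ℕ → ℕ} (E : Emb k n x z f) {m : ℕ} (hm : 1 ≤ m)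
    (M : ℕ) : ((Finset.range M).filter fun p =>
      ¬ Aligned k n f (mark x n m p) (mark z (n - k) m p)).card ≤ 2 * (k * m) := by
  -- A deleted position together with its offset in a window that contains it. `A` collects the
  -- patterns that `x` shows in such windows, and `B` those that `z` shows at the places mapped to
  -- the beginnings of such windows.
  set S := (Finset.range n \ (Finset.range (n - k)).image f) ×ˢ Finset.range m
  have hS : S.card = k * m := by rw [Finset.card_product, E.card_missing, Finset.card_range]
  set A := S.image fun y => win x n (y.1 - y.2) m
  set B := S.image fun y => win z (n - k) (Function.invFun f (y.1 - y.2)) m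
  have hsub : ((Finset.range M).filter fun p =>
      ¬ Aligned k n f (mark x n m p) (mark z (n - k) m p)) ⊆ A ∪ B := by
    intro p hp
    by_contra hnot
    simp only [Finset.mem_union, not_or, A, B, Finset.mem_image, not_exists, not_and, S,
      Finset.mem_product, E.mem_missing, Finset.mem_range, Prod.forall] at hnot
    obtain ⟨hA, hB⟩ := hnot
    refine (Finset.mem_filter.1 hp).2 ⟨fun j hj => ?_, fun i hi hp => ?_⟩
    -- If the window at `j` has a contiguous image, then both strings show the same pattern there.
    · by_cases hc : ∀ c < m, f (j + c) = f j + c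
      · have : win z (n - k) j m = win x n (f j) m := by
          refine dig_congr fun i hi => ?_
          have := E.cut_eq (j + i)
          rw [hc i hi] at this
          exact this
        simp only [mark, this]
      -- Otherwise the position `f j + c` at the first gap is deleted. The patterns of `x` at `f j`
      -- and of `z` at `j` then belong to `A` and `B`, so neither of them is `p`.
      · push Not at hc
        obtain ⟨hcm, hcn⟩ := Nat.find_spec hc
        have hmin := fun c' (h : c' < Nat.find hc) => Nat.find_min hc h
        set c := Nat.find hc
        have hc0 : c ≠ 0 := fun h => by simp [h] at hcn
        have h1 : f (j + (c - 1)) = f j + (c - 1) := by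
          by_contra h; exact hmin (c - 1) (by omega) ⟨by omega, h⟩
        have h2 := E.add_le j c
        have hmiss : ∀ i, f i ≠ f j + c := fun i hi => by
          have h3 := E.mono.lt_iff_lt.1 (show f (j + (c - 1)) < f i by omega)
          have h4 := E.mono.lt_iff_lt.1 (show f i < f (j + c) by omega)
          omega
        have hA' := hA _ c ⟨hmiss, hcm⟩
        have hB' := hB _ c ⟨hmiss, hcm⟩
        rw [Nat.add_sub_cancel] at hA' hB'
        rw [Function.leftInverse_invFun E.mono.injective] at hB'
        simp only [mark, hA', hB']
    -- An occurrence that begins at a deleted position is in `A` with offset `0`.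
    · by_contra hno
      push Not at hno
      exact hA i 0 ⟨hno, by omega⟩ hp
  refine (Finset.card_le_card hsub).trans ((Finset.card_union_le _ _).trans ?_)
  have h1 : A.card ≤ k * m := hS ▸ Finset.card_image_le
  have h2 : B.card ≤ k * m := hS ▸ Finset.card_image_le
  omega

section pieces
variable {k n : ℕ} {x z f : ℕ → ℕ} {px pz : ℕ → Prop} [DecidablePred px] [DecidablePred pz]

/-- At most `k` pieces change their length. -/
theorem Aligned.card_changed (E : Emb k n x z f) (A : Aligned k n f px pz) :
    ((Finset.range (Nat.count pz (n - k) + 1)).filter fun r =>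
      st px n (r + 1) - st px n r ≠ st pz (n - k) (r + 1) - st pz (n - k) r).card ≤ k := by
  set R := Finset.range (Nat.count pz (n - k) + 1)
  have h1 : ∑ r ∈ R, (st pz (n - k) (r + 1) - st pz (n - k) r) = n - k := sum_st pz (n - k)
  have h2 : ∑ r ∈ R, (st px n (r + 1) - st px n r) = n := by
    simp only [R, ← A.cnt_eq E]; exact sum_st px n
  have hle : ∀ r ∈ R, st pz (n - k) (r + 1) - st pz (n - k) r ≤ st px n (r + 1) - st px n r :=
    fun r hr => by
      obtain ⟨g, -, h, -⟩ := A.piece E (r := r) (by have := Finset.mem_range.1 hr; omega)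
      exact h
  -- Every changed piece loses at least one bit, and all pieces together lose `k` bits.
  have h3 : ∑ r ∈ R, (st pz (n - k) (r + 1) - st pz (n - k) r) + (R.filter fun r =>
      st px n (r + 1) - st px n r ≠ st pz (n - k) (r + 1) - st pz (n - k) r).card ≤
      ∑ r ∈ R, (st px n (r + 1) - st px n r) := by
    rw [Finset.card_filter, ← Finset.sum_add_distrib]
    refine Finset.sum_le_sum fun r hr => ?_
    have := hle r hr
    split_ifs <;> omega
  have := E.le
  omega

/-- If every block of length `d` contains every pattern, then pieces are short. -/
theorem piece_lt {m d p : ℕ} (hd : 0 < d) (hm : 1 ≤ m)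
    (hmix : ∀ i < n / d, ∃ y, i * d ≤ y ∧ y + m ≤ (i + 1) * d ∧ dig 2 x y m = p) {r : ℕ}
    (hr : r ≤ Nat.count (mark x n m p) n) :
    st (mark x n m p) n (r + 1) - st (mark x n m p) n r < 4 * d := by
  by_contra hlt
  have hle := st_le_len (p := mark x n m p) (len := n) (r + 1)
  have hbt := fun y => not_mark_of_between (y := y) hr
  set a := st (mark x n m p) n r
  set e := st (mark x n m p) n (r + 1)
  have h0 := Nat.div_add_mod a d
  have h1 := Nat.mod_lt a hd
  -- A piece of length `4 * d` contains the whole block after the one in which it begins. That block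
  -- shows the pattern, which would have cut the piece.
  have hi : a / d + 1 < n / d := by
    rw [← Nat.succ_le_iff, Nat.le_div_iff_mul_le hd]
    have : (a / d + 1 + 1) * d = d * (a / d) + d + d := by ring
    simp only [Nat.succ_eq_add_one]
    omega
  obtain ⟨y, hy1, hy2, hy⟩ := hmix _ hi
  have e1 : (a / d + 1) * d = d * (a / d) + d := by ring
  have e2 : (a / d + 1 + 1) * d = d * (a / d) + d + d := by ring
  refine hbt y (by omega) (by omega) ?_
  rw [mark, win_of_le (by omega), hy]

end pieces

/-! ### Hankel determinants of power sums -/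

/-- The Hankel determinant of order `μ` of a sequence. -/
def hank {F : Type*} [CommRing F] (μ : ℕ) (S : ℕ → F) : F :=
  Matrix.det (Matrix.of fun i j : Fin μ => S (i + j))

section hankel
variable {F : Type*} [Field F]

theorem hank_congr {μ : ℕ} {S T : ℕ → F} (h : ∀ j, j + 1 < 2 * μ → S j = T j) :
    hank μ S = hank μ T := by
  unfold hank
  congr 1
  ext i j
  exact h _ (by omega)

/-- The Hankel matrix of a sum of `μ` geometric sequences factors as transposed Vandermonde matrix,
diagonal matrix of the coefficients, Vandermonde matrix. -/
theorem hank_sum {μ : ℕ} (e α : Fin μ → F) :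
    hank μ (fun j => ∑ i, e i * α i ^ j) = (∏ i, e i) * (Matrix.vandermonde α).det ^ 2 := by
  have : Matrix.of (fun i j : Fin μ => ∑ l, e l * α l ^ ((i : ℕ) + j)) =
      (Matrix.vandermonde α).transpose * Matrix.diagonal e * Matrix.vandermonde α := by
    ext i j
    rw [Matrix.mul_apply]
    simp only [Matrix.of_apply, Matrix.mul_diagonal, Matrix.transpose_apply,
      Matrix.vandermonde_apply]
    exact Finset.sum_congr rfl fun l _ => by rw [pow_add]; ring
  rw [hank, this, Matrix.det_mul, Matrix.det_mul, Matrix.det_transpose, Matrix.det_diagonal]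
  ring

variable [DecidableEq F] (R : Finset ℕ) (e α : ℕ → F)

theorem sum_support (j : ℕ) :
    ∑ r ∈ R, e r * α r ^ j = ∑ r ∈ R.filter (e · ≠ 0), e r * α r ^ j := by
  rw [Finset.sum_filter]
  exact Finset.sum_congr rfl fun r _ => by split_ifs with h <;> simp_all

/-- When the order equals the number of nonzero coefficients, the diagonal factor is invertible, and
so is the Vandermonde factor, as the nodes are distinct. -/
theorem hank_ne_zero (hα : Set.InjOn α R) :
    hank (R.filter (e · ≠ 0)).card (fun j => ∑ r ∈ R, e r * α r ^ j) ≠ 0 := by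
  simp only [sum_support R e α]
  set S := R.filter (e · ≠ 0) with hS
  have h1 : ∀ j, ∑ r ∈ S, e r * α r ^ j =
      ∑ i : Fin S.card, e (S.equivFin.symm i) * α (S.equivFin.symm i) ^ j := fun j => by
    rw [← Finset.sum_coe_sort S]
    exact (Equiv.sum_comp S.equivFin.symm fun r : S => e r * α r ^ j).symm
  simp only [h1]
  rw [hank_sum (fun i => e (S.equivFin.symm i)) (fun i => α (S.equivFin.symm i))]
  refine mul_ne_zero (Finset.prod_ne_zero_iff.2 fun i _ => ?_) (pow_ne_zero _ ?_)
  · exact (Finset.mem_filter.1 (S.equivFin.symm i).2).2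
  · rw [Matrix.det_vandermonde_ne_zero_iff]
    intro i j hij
    have := hα (Finset.mem_filter.1 (S.equivFin.symm i).2).1
      (Finset.mem_filter.1 (S.equivFin.symm j).2).1 hij
    exact S.equivFin.symm.injective (Subtype.ext this)

/-- Padding with terms of coefficient `0` brings the number of terms to `μ` and puts a zero on the
diagonal. -/
theorem hank_eq_zero {μ : ℕ} (h : (R.filter (e · ≠ 0)).card < μ) :
    hank μ (fun j => ∑ r ∈ R, e r * α r ^ j) = 0 := by
  simp only [sum_support R e α]
  set S := R.filter (e · ≠ 0) with hS
  let g : Fin μ → ℕ := fun i => if h : (i : ℕ) < S.card then S.equivFin.symm ⟨i, h⟩ else 0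
  let e' : Fin μ → F := fun i => if (i : ℕ) < S.card then e (g i) else 0
  have h1 : ∀ j, ∑ r ∈ S, e r * α r ^ j = ∑ i : Fin μ, e' i * α (g i) ^ j := fun j => by
    rw [← Finset.sum_coe_sort S,
      ← Equiv.sum_comp S.equivFin.symm fun r : S => e r * α r ^ j]
    rw [← Finset.sum_subset (Finset.subset_univ (Finset.univ.map (Fin.castLEEmb h.le)))]
    · rw [Finset.sum_map]
      refine Finset.sum_congr rfl fun i _ => ?_
      simp [e', g]
    · intro i _ hi
      have : ¬ (i : ℕ) < S.card := fun hlt => hi (by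
        simp only [Finset.mem_map, Finset.mem_univ, true_and]
        exact ⟨⟨i, hlt⟩, rfl⟩)
      simp [e', this]
  simp only [h1]
  rw [hank_sum e' fun i => α (g i)]
  rw [Finset.prod_eq_zero (Finset.mem_univ ⟨S.card, h⟩) (by simp [e']), zero_mul]

end hankel

/-! ### Correcting errors from power sums modulo a prime -/

section decode
variable {q R : ℕ} [Fact q.Prime] {a b : ℕ → ℕ} {Δ : ℕ → ZMod q} {N : ℕ}

theorem cast_injOn (hR : R ≤ q) :
    Set.InjOn (fun r : ℕ => (r : ZMod q)) (Finset.range R : Finset ℕ) := by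
  intro r hr s hs h
  simp only [Finset.coe_range, Set.mem_Iio] at hr hs
  have := (ZMod.natCast_eq_natCast_iff' r s q).1 h
  rwa [Nat.mod_eq_of_lt (by omega), Nat.mod_eq_of_lt (by omega)] at this

theorem cast_sub_ne_zero (ha : ∀ r < R, a r < q) (hb : ∀ r < R, b r < q) {r : ℕ} (hr : r < R) :
    (a r : ZMod q) - b r ≠ 0 ↔ a r ≠ b r := by
  rw [sub_ne_zero, Ne, ZMod.natCast_eq_natCast_iff', Nat.mod_eq_of_lt (ha r hr),
    Nat.mod_eq_of_lt (hb r hr)]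

variable (hR : R ≤ q) (ha : ∀ r < R, a r < q) (hb : ∀ r < R, b r < q)
  (hΔ : ∀ j < N, Δ j = ∑ r ∈ Finset.range R, ((a r : ZMod q) - b r) * (r : ZMod q) ^ j)
include ha hb hΔ

/-- Together with `hank_order_ne_zero` this identifies the number of errors as the largest order
with nonzero determinant. -/
theorem hank_order_eq_zero {μ : ℕ} (hN : 2 * μ ≤ N)
    (hμ : ((Finset.range R).filter fun r => a r ≠ b r).card < μ) : hank μ Δ = 0 := by
  have h : (Finset.range R).filter (fun r => a r ≠ b r) =
      (Finset.range R).filter fun r => (a r : ZMod q) - b r ≠ 0 :=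
    Finset.filter_congr fun r hr => (cast_sub_ne_zero ha hb (Finset.mem_range.1 hr)).symm
  rw [h] at hμ
  rw [hank_congr fun j hj => hΔ j (by omega)]
  exact hank_eq_zero _ _ _ hμ

include hR

theorem hank_order_ne_zero (hN : 2 * ((Finset.range R).filter fun r => a r ≠ b r).card ≤ N) :
    hank ((Finset.range R).filter fun r => a r ≠ b r).card Δ ≠ 0 := by
  have h : (Finset.range R).filter (fun r => a r ≠ b r) =
      (Finset.range R).filter fun r => (a r : ZMod q) - b r ≠ 0 :=
    Finset.filter_congr fun r hr => (cast_sub_ne_zero ha hb (Finset.mem_range.1 hr)).symm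
  rw [h] at hN ⊢
  have := hank_ne_zero (Finset.range R) (fun r => (a r : ZMod q) - b r) (fun r => (r : ZMod q))
    (cast_injOn hR)
  rwa [hank_congr fun j hj => hΔ j (by omega)]

/-- Location of the errors. -/
theorem hank_locate {μ : ℕ} (hμ : ((Finset.range R).filter fun r => a r ≠ b r).card = μ)
    (hN : 2 * μ ≤ N) {r : ℕ} (hr : r < R) :
    hank μ (fun j => Δ (j + 1) - r * Δ j) = 0 ↔ a r ≠ b r := by
  classical
  -- Passing from `Δ j` to `Δ (j + 1) - r * Δ j` multiplies the coefficient of node `l` by `l - r`.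
  -- This removes node `r` and no other, so the number of errors drops exactly if there is one at
  -- `r`.
  set e : ℕ → ZMod q := fun l => ((a l : ZMod q) - b l) * ((l : ZMod q) - r)
  have h1 : hank μ (fun j => Δ (j + 1) - r * Δ j) =
      hank μ (fun j => ∑ l ∈ Finset.range R, e l * (l : ZMod q) ^ j) := by
    refine hank_congr fun j hj => ?_
    rw [hΔ _ (by omega), hΔ _ (by omega), Finset.mul_sum, ← Finset.sum_sub_distrib]
    exact Finset.sum_congr rfl fun l _ => by simp only [e]; ring
  have hs : (Finset.range R).filter (e · ≠ 0) =
      ((Finset.range R).filter fun r => a r ≠ b r).erase r := by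
    ext l
    simp only [Finset.mem_filter, Finset.mem_range, Finset.mem_erase, e, mul_ne_zero_iff]
    have h2 : l < R → ((l : ZMod q) - r ≠ 0 ↔ l ≠ r) := fun hl => by
      rw [sub_ne_zero, Ne, (cast_injOn hR).eq_iff (by simpa using hl) (by simpa using hr)]
    constructor
    · rintro ⟨hl, h3, h4⟩
      exact ⟨(h2 hl).1 h4, hl, (cast_sub_ne_zero ha hb hl).1 h3⟩
    · rintro ⟨h3, hl, h4⟩
      exact ⟨hl, (cast_sub_ne_zero ha hb hl).2 h4, (h2 hl).2 h3⟩
  rw [h1]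
  constructor
  · intro h0 hab
    refine hank_ne_zero (Finset.range R) e (fun r => (r : ZMod q)) (cast_injOn hR) ?_
    rw [hs, Finset.erase_eq_of_notMem (by simp [hab]), hμ]
    exact h0
  · intro hab
    refine hank_eq_zero (Finset.range R) e (fun r => (r : ZMod q)) ?_
    rw [hs, Finset.card_erase_of_mem (by simp [hr, hab]), hμ]
    have : 0 < ((Finset.range R).filter fun r => a r ≠ b r).card :=
      Finset.card_pos.2 ⟨r, by simp [hr, hab]⟩
    omega

/-- The values of the errors. -/
theorem hank_value {μ : ℕ} (hμ : ((Finset.range R).filter fun r => a r ≠ b r).card = μ)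
    (hN : 2 * μ ≤ N) {r : ℕ} (hr : r < R) (hab : a r ≠ b r) {c : ℕ} (hc : c < q) :
    hank μ (fun j => Δ j - ((c : ZMod q) - b r) * (r : ZMod q) ^ j) = 0 ↔ c = a r := by
  classical
  -- Subtracting the conjectured error at `r` leaves the coefficient `a r - c` there, so the number
  -- of errors drops exactly for `c = a r`.
  set e : ℕ → ZMod q := fun l =>
    ((a l : ZMod q) - b l) - if l = r then ((c : ZMod q) - b r) else 0
  have h1 : hank μ (fun j => Δ j - ((c : ZMod q) - b r) * (r : ZMod q) ^ j) =
      hank μ (fun j => ∑ l ∈ Finset.range R, e l * (l : ZMod q) ^ j) := by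
    refine hank_congr fun j hj => ?_
    rw [hΔ _ (by omega)]
    simp only [e, sub_mul, Finset.sum_sub_distrib, ite_mul, zero_mul]
    simp [hr]
  have her : e r = (a r : ZMod q) - c := by simp [e]
  have hel : ∀ l, l ≠ r → e l = (a l : ZMod q) - b l := fun l h => by simp [e, h]
  have hac : (a r : ZMod q) - c = 0 ↔ c = a r := by
    rw [sub_eq_zero, ZMod.natCast_eq_natCast_iff', Nat.mod_eq_of_lt (ha r hr),
      Nat.mod_eq_of_lt hc, eq_comm]
  rw [h1]
  constructor
  · intro h0
    by_contra hca
    refine hank_ne_zero (Finset.range R) e (fun r => (r : ZMod q)) (cast_injOn hR) ?_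
    have hs : (Finset.range R).filter (e · ≠ 0) = (Finset.range R).filter fun r => a r ≠ b r :=
      Finset.filter_congr fun l hl => by
        by_cases h : l = r
        · subst h; rw [her]; exact iff_of_true (fun h => hca (hac.1 h)) hab
        · rw [hel l h]; exact cast_sub_ne_zero ha hb (Finset.mem_range.1 hl)
    rw [hs, hμ]
    exact h0
  · intro hca
    refine hank_eq_zero (Finset.range R) e (fun r => (r : ZMod q)) ?_
    have hs : (Finset.range R).filter (e · ≠ 0) ⊆
        ((Finset.range R).filter fun r => a r ≠ b r).erase r := fun l hl => by
      rw [Finset.mem_filter, Finset.mem_range] at hl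
      rw [Finset.mem_erase, Finset.mem_filter, Finset.mem_range]
      have : l ≠ r := by rintro rfl; exact hl.2 (by rw [her]; exact hac.2 hca)
      rw [hel l this] at hl
      exact ⟨this, hl.1, (cast_sub_ne_zero ha hb hl.1).1 hl.2⟩
    have h2 := Finset.card_le_card hs
    have hmem : r ∈ (Finset.range R).filter fun r => a r ≠ b r := by simp [hr, hab]
    rw [Finset.card_erase_of_mem hmem] at h2
    have := Finset.card_pos.2 ⟨r, hmem⟩
    omega

end decode

/-- The determinant of a matrix of expressions modulo register `5`. -/
def detE : (μ : ℕ) → (Fin μ → Fin μ → Expr) → Expr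
  | 0, _ => 1
  | μ + 1, A => (List.ofFn fun j : Fin (μ + 1) =>
      -- The alternating sign; subtraction from the modulus is exact for entries up to the modulus.
      (if (j : ℕ) % 2 = 0 then A 0 j else Expr.reg 5 - A 0 j) *
        detE μ fun i l => A i.succ (j.succAbove l)).foldr (fun t s => (t + s) % Expr.reg 5) 0

theorem eval_foldr_cast (q : ℕ) (σ : State) (h5 : σ.reg 5 = q) (l : List Expr) :
    ((((l.foldr (fun t s => (t + s) % Expr.reg 5) 0).eval σ : ℕ)) : ZMod q) =
      (l.map fun t => ((t.eval σ : ℕ) : ZMod q)).sum := by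
  induction l with
  | nil => simp
  | cons t l ih => simp [h5, ih, Nat.cast_add]

/-- Laplace expansion along the first row. Its factorial size is harmless, since the order is at
most `k` and the expression is a constant of the program. -/
theorem detE_cast {q : ℕ} {σ : State} (h5 : σ.reg 5 = q) (μ : ℕ) (A : Fin μ → Fin μ → Expr)
    (hA : ∀ i j, (A i j).eval σ ≤ q) :
    ((((detE μ A).eval σ : ℕ)) : ZMod q) =
      Matrix.det (Matrix.of fun i j => (((A i j).eval σ : ℕ) : ZMod q)) := by
  induction μ with
  | zero => simp [detE]
  | succ μ ih =>
    rw [detE, eval_foldr_cast q σ h5, Matrix.det_succ_row_zero, List.map_ofFn, List.sum_ofFn]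
    refine Finset.sum_congr rfl fun j _ => ?_
    simp only [Function.comp, Expr.eval_mul, Nat.cast_mul]
    rw [ih _ fun i l => hA _ _]
    congr 1
    split_ifs with hj
    · rw [Even.neg_one_pow (Nat.even_iff.2 hj)]; simp
    · rw [Odd.neg_one_pow (Nat.odd_iff.2 (by omega))]
      simp [h5, Nat.cast_sub (hA 0 j)]

/-- The value is a reduced residue, so testing it against `0` decides whether the determinant
vanishes modulo `q`. -/
theorem detE_lt {q : ℕ} {σ : State} (h5 : σ.reg 5 = q) (hq : 1 < q) (μ : ℕ)
    (A : Fin μ → Fin μ → Expr) : (detE μ A).eval σ < q := by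
  cases μ with
  | zero => simpa [detE] using hq
  | succ μ =>
    rw [detE, List.ofFn_succ]
    simp only [List.foldr_cons, Expr.eval_mod, Expr.eval_reg, h5]
    exact Nat.mod_lt _ (by omega)

/-! ### Colours and a short code by counting -/

section counting

theorem exists_insertIdx_sublist {z u : List ℕ} (h : z.Sublist u) (hl : z.length < u.length) :
    ∃ i ≤ z.length, ∃ b ∈ u, (z.insertIdx i b).Sublist u := by
  induction h with
  | slnil => simp at hl
  | @cons z u a h _ => exact ⟨0, Nat.zero_le _, a, by simp, by simpa using h⟩
  | @cons_cons z u a h ih =>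
    obtain ⟨i, hi, b, hb, hs⟩ := ih (by simpa using hl)
    exact ⟨i + 1, by simpa using hi, b, by simp [hb], by simpa using hs⟩

theorem exists_sublist_eraseIdx {z u : List ℕ} (h : z.Sublist u) (hl : z.length < u.length) :
    ∃ i < u.length, z.Sublist (u.eraseIdx i) := by
  induction h with
  | slnil => simp at hl
  | @cons z u a h _ => exact ⟨0, by simp, by simpa using h⟩
  | @cons_cons z u a h ih =>
    obtain ⟨i, hi, hs⟩ := ih (by simpa using hl)
    exact ⟨i + 1, by simpa using hi, by simpa using hs⟩

/-- The lists obtained by `k` deletions. -/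
def del : ℕ → List ℕ → Finset (List ℕ)
  | 0, u => {u}
  | k + 1, u => (Finset.range u.length).biUnion fun i => del k (u.eraseIdx i)

/-- The lists obtained by `k` insertions of bits. -/
def ins : ℕ → List ℕ → Finset (List ℕ)
  | 0, z => {z}
  | k + 1, z => (Finset.range (z.length + 1) ×ˢ Finset.range 2).biUnion
      fun y => ins k (z.insertIdx y.1 y.2)

theorem mem_del {k : ℕ} {z u : List ℕ} (h : z.Sublist u) (hl : u.length = z.length + k) :
    z ∈ del k u := by
  induction k generalizing u with
  | zero => simp [del, h.eq_of_length (by omega)]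
  | succ k ih =>
    obtain ⟨i, hi, hs⟩ := exists_sublist_eraseIdx h (by omega)
    simp only [del, Finset.mem_biUnion, Finset.mem_range]
    exact ⟨i, hi, ih hs (by rw [List.length_eraseIdx_of_lt hi]; omega)⟩

theorem mem_ins {k : ℕ} {z u : List ℕ} (h : z.Sublist u) (hl : u.length = z.length + k)
    (hu : ∀ b ∈ u, b < 2) : u ∈ ins k z := by
  induction k generalizing z with
  | zero => simp [ins, h.eq_of_length (by omega)]
  | succ k ih =>
    obtain ⟨i, hi, b, hb, hs⟩ := exists_insertIdx_sublist h (by omega)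
    simp only [ins, Finset.mem_biUnion, Finset.mem_product, Finset.mem_range]
    exact ⟨(i, b), ⟨by omega, hu b hb⟩, ih hs (by rw [List.length_insertIdx_of_le_length hi]; omega)⟩

theorem card_del_le {k L : ℕ} {u : List ℕ} (hu : u.length ≤ L) : (del k u).card ≤ L ^ k := by
  induction k generalizing u with
  | zero => simp [del]
  | succ k ih =>
    rw [del, pow_succ']
    refine Finset.card_biUnion_le.trans ((Finset.sum_le_card_nsmul _ _ (L ^ k) fun i _ =>
      ih ((List.length_eraseIdx_le _ _).trans hu)).trans ?_)
    simp only [Finset.card_range, smul_eq_mul]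
    gcongr

theorem card_ins_le {k L : ℕ} {z : List ℕ} (hz : z.length + k ≤ L) :
    (ins k z).card ≤ (2 * L) ^ k := by
  induction k generalizing z with
  | zero => simp [ins]
  | succ k ih =>
    rw [ins, pow_succ']
    refine Finset.card_biUnion_le.trans ((Finset.sum_le_card_nsmul _ _ ((2 * L) ^ k)
      fun y hy => ih ?_).trans ?_)
    · have : (z.insertIdx y.1 y.2).length ≤ z.length + 1 := List.length_insertIdx_le_succ
      omega
    · simp only [Finset.card_product, Finset.card_range, smul_eq_mul]
      exact Nat.mul_le_mul_right _ (by omega)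

/-- The list of the `L` lowest binary digits. -/
def bitList (L u : ℕ) : List ℕ := (List.range L).map fun i => u / 2 ^ i % 2

theorem bitList_inj {L u v : ℕ} (hu : u < 2 ^ L) (hv : v < 2 ^ L)
    (h : bitList L u = bitList L v) : u = v := by
  rw [← dig_digits (c := 2) (by norm_num) hu, ← dig_digits (c := 2) (by norm_num) hv]
  refine dig_congr fun i hi => ?_
  simp only [bitList, List.map_inj_left, List.mem_range] at h
  simpa using h i hi

theorem Sub.sublist {k L z u : ℕ} (h : Sub k L z u) :
    (bitList (L - k) z).Sublist (bitList L u) := by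
  obtain ⟨g, hg, hle, he⟩ := h
  have h1 : bitList (L - k) z = ((List.range (L - k)).map g).map fun i => u / 2 ^ i % 2 := by
    simp only [bitList, List.map_map, List.map_inj_left, List.mem_range]
    exact he
  rw [h1]
  refine List.Sublist.map _ ?_
  refine List.sublist_of_subperm_of_pairwise (r := (· < ·)) ?_ ?_ ?_
  · refine List.subperm_of_subset ((List.nodup_range).map hg.injective) fun y hy => ?_
    simp only [List.mem_map, List.mem_range] at hy ⊢
    obtain ⟨i, hi, rfl⟩ := hy
    have := hle i; omega
  · rw [List.pairwise_map]
    exact List.pairwise_lt_range.imp fun h => hg h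
  · exact List.pairwise_lt_range

-- A confusable string arises from `u` by `k` deletions, in at most `L ^ k` ways, followed by `k`
-- insertions of bits, in at most `(2 * L) ^ k` ways.
open Classical in
theorem card_confusable {k L u : ℕ} (hk : k ≤ L) : ((Finset.range (2 ^ L)).filter fun v =>
    ∃ z, Sub k L z u ∧ Sub k L z v).card < (2 * L ^ 2) ^ k + 1 := by
  rw [Nat.lt_succ_iff]
  have hlen : ∀ L u, (bitList L u).length = L := fun L u => by simp [bitList]
  calc _ ≤ ((del k (bitList L u)).biUnion fun z => ins k z).card := by
        refine Finset.card_le_card_of_injOn (bitList L) (fun v hv => ?_) fun v hv w hw h => ?_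
        · obtain ⟨-, z, h1, h2⟩ := Finset.mem_filter.1 hv
          rw [Finset.mem_coe, Finset.mem_biUnion]
          refine ⟨_, mem_del h1.sublist (by simp only [hlen]; omega),
            mem_ins h2.sublist (by simp only [hlen]; omega) fun b hb => ?_⟩
          simp only [bitList, List.mem_map] at hb
          obtain ⟨i, -, rfl⟩ := hb
          omega
        · simp only [Finset.coe_filter, Finset.mem_range, Set.mem_ofPred_eq] at hv hw
          exact bitList_inj hv.1 hw.1 h
    _ ≤ (del k (bitList L u)).card * (2 * L) ^ k := by
        refine Finset.card_biUnion_le.trans (Finset.sum_le_card_nsmul _ _ _ fun z hz => ?_)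
        refine card_ins_le ?_
        have : ∀ {k : ℕ} {z u : List ℕ}, z ∈ del k u → k ≤ u.length → z.length + k ≤ u.length := by
          intro k
          induction k with
          | zero => intro z u h _; simp only [del, Finset.mem_singleton] at h; simp [h]
          | succ k ih =>
            intro z u h _
            simp only [del, Finset.mem_biUnion, Finset.mem_range] at h
            obtain ⟨i, hi, h⟩ := h
            have h2 := List.length_eraseIdx_of_lt hi
            have := ih h (by omega)
            omega
        simpa [hlen] using this hz (by simpa [hlen] using hk)
    _ ≤ L ^ k * (2 * L) ^ k := by gcongr; exact card_del_le (hlen L u).le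
    _ = _ := by rw [← mul_pow]; congr 1; ring

/-- Greedy colouring: a vertex has fewer than `c` neighbours, so one of the `c` colours is always
free. -/
theorem exists_coloring {N c : ℕ} {adj : ℕ → ℕ → Prop} [∀ u, DecidablePred (adj u)]
    (hs : ∀ u v, adj u v → adj v u)
    (hd : ∀ u, ((Finset.range N).filter (adj u)).card < c) :
    ∃ h : ℕ → ℕ, (∀ u, h u < c) ∧ ∀ u < N, ∀ v < N, u ≠ v → adj u v → h u ≠ h v := by
  have key : ∀ n ≤ N, ∃ h : ℕ → ℕ, (∀ u, h u < c) ∧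
      ∀ u < n, ∀ v < n, u ≠ v → adj u v → h u ≠ h v := by
    intro n
    induction n with
    | zero => exact fun _ => ⟨fun _ => 0, fun u => (Nat.zero_le _).trans_lt (hd u), by simp⟩
    | succ n ih =>
      intro hn
      obtain ⟨h, hc, hp⟩ := ih (by omega)
      obtain ⟨col, hcol, hnot⟩ := Finset.exists_mem_notMem_of_card_lt_card
        (s := ((Finset.range N).filter (adj n)).image h) (t := Finset.range c)
        (by rw [Finset.card_range]; exact Finset.card_image_le.trans_lt (hd n))
      have hcol' : ∀ v < n, adj n v → col ≠ h v := fun v hv ha hcv => hnot (by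
        rw [hcv]
        exact Finset.mem_image_of_mem _ (by simp only [Finset.mem_filter, Finset.mem_range]; exact ⟨by omega, ha⟩))
      refine ⟨Function.update h n col, fun u => ?_, fun u hu v hv huv ha => ?_⟩
      · by_cases hun : u = n
        · subst hun; simpa using hcol
        · simpa [hun] using hc u
      · by_cases h1 : u = n
        · subst h1
          rw [Function.update_self, Function.update_of_ne huv.symm]
          exact hcol' v (by omega) ha
        · by_cases h2 : v = n
          · subst h2
            rw [Function.update_self, Function.update_of_ne h1]
            exact (hcol' u (by omega) (hs _ _ ha)).symm
          · rw [Function.update_of_ne h1, Function.update_of_ne h2]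
            exact hp u (by omega) v (by omega) huv ha
  exact key N le_rfl

/-- Colours that tell apart any two strings that may become equal by `k` deletions. -/
theorem exists_hash {k L : ℕ} (hk : k ≤ L) :
    ∃ h : ℕ → ℕ, (∀ u, h u < (2 * L ^ 2) ^ k + 1) ∧ ∀ z, ∀ u < 2 ^ L, ∀ v < 2 ^ L,
      Sub k L z u → Sub k L z v → h u = h v → u = v := by
  classical
  obtain ⟨h, hc, hp⟩ := exists_coloring (N := 2 ^ L) (c := (2 * L ^ 2) ^ k + 1)
    (adj := fun u v => ∃ z, Sub k L z u ∧ Sub k L z v) (fun u v ⟨z, h1, h2⟩ => ⟨z, h2, h1⟩)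
    (fun u => by convert card_confusable hk)
  refine ⟨h, hc, fun z u hu v hv h1 h2 h3 => ?_⟩
  by_contra huv
  exact hp u hu v hv huv ⟨z, h1, h2⟩ h3

/-- A code of rate `1 / 2` that corrects `k` deletions. -/
theorem exists_code {k L : ℕ} (hk : k ≤ 2 * L) (hL : (2 * (2 * L) ^ 2) ^ k + 1 ≤ 2 ^ L) :
    ∃ encT decT : ℕ → ℕ, (∀ u < 2 ^ L, encT u < 2 ^ (2 * L)) ∧ (∀ z, decT z < 2 ^ L) ∧
      ∀ z, ∀ u < 2 ^ L, Sub k (2 * L) z (encT u) → decT z = u := by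
  classical
  obtain ⟨h, hc, hp⟩ := exists_hash hk
  -- There are at most `2 ^ L` colours for `2 ^ (2 * L)` strings, so some colour class has at least
  -- `2 ^ L` members. These are the codewords: equal colours forbid confusion.
  obtain ⟨col, -, hcol⟩ := Finset.exists_le_card_fiber_of_mul_le_card_of_maps_to
    (s := Finset.range (2 ^ (2 * L))) (t := Finset.range ((2 * (2 * L) ^ 2) ^ k + 1)) (f := h)
    (n := 2 ^ L) (fun u _ => by simpa using hc u) (by simp) (by
      simp only [Finset.card_range]
      rw [show 2 * L = L + L by ring] at *
      rw [pow_add]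
      gcongr)
  set S := (Finset.range (2 ^ (2 * L))).filter fun x => h x = col with hS
  have hmem : ∀ (u : ℕ) (hu : u < 2 ^ L), ((S.equivFin.symm ⟨u, by omega⟩ : S) : ℕ) ∈ S :=
    fun u hu => Finset.coe_mem _
  let encT : ℕ → ℕ := fun u => if hu : u < 2 ^ L then S.equivFin.symm ⟨u, by omega⟩ else 0
  have henc : ∀ u < 2 ^ L, encT u ∈ S := fun u hu => by
    simp only [encT, dif_pos hu]; exact hmem u hu
  have hinj : ∀ u < 2 ^ L, ∀ v < 2 ^ L, encT u = encT v → u = v := fun u hu v hv he => by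
    simp only [encT, dif_pos hu, dif_pos hv] at he
    have := S.equivFin.symm.injective (Subtype.ext he)
    simpa using this
  let decT : ℕ → ℕ := fun z =>
    if hz : ∃ u < 2 ^ L, Sub k (2 * L) z (encT u) then hz.choose else 0
  refine ⟨encT, decT, fun u hu => ?_, fun z => ?_, fun z u hu hs => ?_⟩
  · simpa using (Finset.mem_filter.1 (henc u hu)).1
  · simp only [decT]
    split_ifs with hz
    · exact hz.choose_spec.1
    · positivity
  · have hz : ∃ u < 2 ^ L, Sub k (2 * L) z (encT u) := ⟨u, hu, hs⟩
    simp only [decT, dif_pos hz]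
    obtain ⟨h1, h2⟩ := hz.choose_spec
    have m1 := Finset.mem_filter.1 (henc _ h1)
    have m2 := Finset.mem_filter.1 (henc u hu)
    exact hinj _ h1 u hu (hp z _ (by simpa using m1.1) _ (by simpa using m2.1) h2 hs
      (m1.2.trans m2.2.symm))

end counting

/-! ### Parameters of the code -/

/-- Constants and finite tables of the code for `k` deletions. -/
structure Par where
  (k m L c : ℕ)
  (h encT decT decA : ℕ → ℕ)
  two_le_k : 2 ≤ k
  one_le_m : 1 ≤ m
  -- Makes the `2 * k * m` spoilt patterns fewer than half of all.
  lt_pow_m : 4 * k * m < 2 ^ m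
  k_le_L : k ≤ L
  h_lt : ∀ u, h u < c
  decA_lt : ∀ i, decA i < 2 ^ L
  decA_eq : ∀ z, ∀ u < 2 ^ L, Sub k L z u → decA (z * c + h u) = u
  -- A colour costs at most `L / (64 * m * 2 ^ m)` bits. A piece has about `8 * m * 2 ^ m * ℓ / L`
  -- blocks, so its colours take about `ℓ / 8` bits.
  c_pow_le : c ^ (64 * m * 2 ^ m) ≤ 2 ^ L
  encT_lt : ∀ u < 2 ^ L, encT u < 2 ^ (2 * L)
  decT_lt : ∀ z, decT z < 2 ^ L
  decT_eq : ∀ z, ∀ u < 2 ^ L, Sub k (2 * L) z (encT u) → decT z = u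

theorem eventually_pow_le (E : ℕ) : ∀ᶠ L : ℕ in Filter.atTop, L ^ E ≤ 2 ^ L := by
  have h := tendsto_pow_const_div_const_pow_of_one_lt E (r := (2 : ℝ)) (by norm_num)
  filter_upwards [h.eventually_le_const (show (0 : ℝ) < 1 by norm_num)] with L hL
  rw [div_le_one (by positivity)] at hL
  exact_mod_cast hL

/-- For fixed `k` the number of colours is polynomial in `L`, and so is any fixed power of it; a
large `L` wins. As `L` does not depend on `n`, all tables for `L`-bit strings are constants of the
programs. -/
theorem exists_par {k m : ℕ} (hk : 2 ≤ k) (hm : 1 ≤ m) (hkm : 4 * k * m < 2 ^ m) :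
    ∃ P : Par, P.k = k ∧ P.m = m := by
  classical
  obtain ⟨L, h1, h2, hL⟩ := ((eventually_pow_le (5 * k * (64 * m * 2 ^ m))).and
    ((eventually_pow_le (7 * k)).and (Filter.eventually_ge_atTop (k + 2)))).exists
  have hc : ∀ L, 2 ≤ L → (2 * L ^ 2) ^ k + 1 ≤ L ^ (5 * k) := fun L hL => by
    have hLpos : 0 < L := by omega
    have e1 : (2 * L ^ 2) ^ k + 1 ≤ 2 * (2 * L ^ 2) ^ k := by
      have : 1 ≤ (2 * L ^ 2) ^ k := Nat.one_le_pow _ _ (by positivity)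
      omega
    calc _ ≤ 2 * (2 * L ^ 2) ^ k := e1
      _ ≤ 2 ^ k * (2 * L ^ 2) ^ k := by
        gcongr; exact Nat.le_self_pow (by omega) 2
      _ = (2 ^ 2 * L ^ 2) ^ k := by rw [← mul_pow]; congr 1; ring
      _ ≤ (L ^ 2 * L ^ 2) ^ k := by gcongr
      _ = L ^ (4 * k) := by rw [← pow_add, ← pow_mul]
      _ ≤ L ^ (5 * k) := Nat.pow_le_pow_right (by omega) (by omega)
  have hLpos : 0 < L := by omega
  have hc2 : (2 * (2 * L) ^ 2) ^ k + 1 ≤ L ^ (7 * k) := by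
    have e1 : (2 * (2 * L) ^ 2) ^ k + 1 ≤ 2 * (2 * (2 * L) ^ 2) ^ k := by
      have : 1 ≤ (2 * (2 * L) ^ 2) ^ k := Nat.one_le_pow _ _ (by positivity)
      omega
    calc _ ≤ 2 * (2 * (2 * L) ^ 2) ^ k := e1
      _ ≤ 2 ^ k * (2 * (2 * L) ^ 2) ^ k := by
        gcongr; exact Nat.le_self_pow (by omega) 2
      _ = (2 ^ 4 * L ^ 2) ^ k := by rw [← mul_pow]; congr 1; ring
      _ ≤ (L ^ 4 * L ^ 2) ^ k := by gcongr; omega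
      _ = L ^ (6 * k) := by rw [← pow_add, ← pow_mul]
      _ ≤ L ^ (7 * k) := Nat.pow_le_pow_right (by omega) (by omega)
  obtain ⟨h, h_lt, hh⟩ := exists_hash (k := k) (L := L) (by omega)
  obtain ⟨encT, decT, e1, e2, e3⟩ := exists_code (k := k) (L := L) (by omega) (hc2.trans h2)
  set c := (2 * L ^ 2) ^ k + 1 with hcdef
  let decA : ℕ → ℕ := fun i => if hz : ∃ u < 2 ^ L, Sub k L (i / c) u ∧ h u = i % c then
    hz.choose else 0
  refine ⟨⟨k, m, L, c, h, encT, decT, decA, hk, hm, hkm, by omega, h_lt, fun i => ?_,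
    fun z u hu hs => ?_, ?_, e1, e2, e3⟩, rfl, rfl⟩
  · simp only [decA]
    split_ifs with hz
    · exact hz.choose_spec.1
    · positivity
  · have d1 : (z * c + h u) / c = z := by
      rw [Nat.mul_comm, Nat.mul_add_div (by omega), Nat.div_eq_of_lt (h_lt u), Nat.add_zero]
    have d2 : (z * c + h u) % c = h u := by
      rw [Nat.mul_comm, Nat.mul_add_mod, Nat.mod_eq_of_lt (h_lt u)]
    have hz : ∃ v < 2 ^ L, Sub k L ((z * c + h u) / c) v ∧ h v = (z * c + h u) % c :=
      ⟨u, hu, by rwa [d1], d2.symm⟩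
    simp only [decA, dif_pos hz]
    obtain ⟨w1, w2, w3⟩ := hz.choose_spec
    have w2' : Sub k L z hz.choose := by convert w2 using 1; exact d1.symm
    exact hh z _ w1 u hu w2' hs (w3.trans d2)
  · calc c ^ (64 * m * 2 ^ m) ≤ (L ^ (5 * k)) ^ (64 * m * 2 ^ m) := by
          gcongr; exact hc L (by omega)
      _ = L ^ (5 * k * (64 * m * 2 ^ m)) := by rw [← pow_mul]
      _ ≤ 2 ^ L := h1

theorem win_shift (X : ℕ → ℕ) (a len o w : ℕ) :
    win (fun i => X (a + i)) len o w = win X (a + len) (a + o) w := by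
  refine dig_congr fun i _ => ?_
  dsimp only
  rw [Nat.add_assoc]
  simp only [Nat.add_lt_add_iff_left]

namespace Par
variable (P : Par)

/-- The number of patterns. -/
abbrev M : ℕ := 2 ^ P.m
/-- The number of segments of a mask. -/
def J (ℓ : ℕ) : ℕ := 2 * P.M * ℓ
/-- The length of a mask. -/
def d (ℓ : ℕ) : ℕ := P.m * P.J ℓ
/-- A strict upper bound for the lengths of the pieces of a masked string. -/
def D (ℓ : ℕ) : ℕ := 4 * P.d ℓ
/-- The number of blocks that are hashed for one piece. -/
def nb (ℓ : ℕ) : ℕ := P.D ℓ / P.L + 1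
/-- The length of the mask together with the syndromes. -/
def rho (ℓ : ℕ) : ℕ := P.d ℓ + 2 * P.k * P.M * (ℓ + 1)
/-- The number of code blocks. -/
def nB (ℓ : ℕ) : ℕ := P.rho ℓ / P.L + 1

theorem c_pos : 0 < P.c := (Nat.zero_le _).trans_lt (P.h_lt 0)
theorem L_pos : 0 < P.L := by have := P.k_le_L; have := P.two_le_k; omega
theorem D_le (ℓ : ℕ) : P.D ℓ ≤ P.nb ℓ * P.L := by
  have := Nat.lt_div_mul_add (a := P.D ℓ) P.L_pos
  rw [nb, Nat.add_mul, Nat.one_mul]; omega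
theorem rho_le (ℓ : ℕ) : P.rho ℓ ≤ P.nB ℓ * P.L := by
  have := Nat.lt_div_mul_add (a := P.rho ℓ) P.L_pos
  rw [nB, Nat.add_mul, Nat.one_mul]; omega

end Par

/-- The modulus of the syndromes. -/
def modulus (ℓ : ℕ) : ℕ := Nat.findGreatest Nat.Prime (2 * 2 ^ ℓ)

/-- Bertrand's postulate. The upper bound lets a residue fit into `ℓ + 1` bits. -/
theorem modulus_spec (ℓ : ℕ) : (modulus ℓ).Prime ∧ 2 ^ ℓ < modulus ℓ ∧ modulus ℓ ≤ 2 * 2 ^ ℓ := by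
  obtain ⟨p, hp, h1, h2⟩ := Nat.exists_prime_lt_and_le_two_mul (2 ^ ℓ) (by positivity)
  exact ⟨Nat.findGreatest_spec h2 hp, h1.trans_le (Nat.le_findGreatest h2 hp),
    Nat.findGreatest_le _⟩

instance (ℓ : ℕ) : Fact (modulus ℓ).Prime := ⟨(modulus_spec ℓ).1⟩

/-! ### Hash values, syndromes and codewords -/

section defs
variable (P : Par) (ℓ : ℕ) (X : ℕ → ℕ)

/-- The hash value of the piece `[a, e)` of `X`: its length and the colours of its blocks. -/
def hashV (a e : ℕ) : ℕ :=
  dig P.c (fun b => P.h (win X e (a + b * P.L) P.L)) 0 (P.nb ℓ) * P.D ℓ + (e - a)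

/-- The boundaries of the pieces of `X` with respect to the pattern `p`. -/
noncomputable def bd (len p r : ℕ) : ℕ := st (mark X len P.m p) len r

/-- The number of occurrences of the pattern `p`. -/
def cnt (len p : ℕ) : ℕ := Nat.count (mark X len P.m p) len

/-- The hash value of piece `r` of `X` with respect to the pattern `p`. -/
noncomputable def pieceV (len p r : ℕ) : ℕ :=
  hashV P ℓ X (bd P X len p r) (bd P X len p (r + 1))

/-- The syndromes of the sequence of hash values. -/
noncomputable def synd (len p j : ℕ) : ℕ :=
  (∑ r ∈ Finset.range (cnt P X len p + 1), pieceV P ℓ X len p r * r ^ j) % modulus ℓ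

/-- Every block contains every pattern. -/
def Mixed (n : ℕ) : Prop := ∀ i < n / P.d ℓ, ∀ p < P.M, ∃ y, i * P.d ℓ ≤ y ∧
  y + P.m ≤ (i + 1) * P.d ℓ ∧ dig 2 X y P.m = p

/-- `x` arises from `s` by shifting the segments by `t` periodically. -/
structure Shifted (n : ℕ) (s t x : ℕ → ℕ) : Prop where
  seg : ∀ g < n / P.d ℓ * P.J ℓ,
    dig 2 x (g * P.m) P.m = (dig 2 s (g * P.m) P.m + t (g % P.J ℓ)) % P.M
  tail : ∀ i < n, n / P.d ℓ * P.d ℓ ≤ i → x i = s i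

/-- `y` is a codeword for `s` with mask `t` and redundancy `R`. -/
structure IsCodeword (n : ℕ) (s t R y : ℕ → ℕ) : Prop where
  y_le : ∀ i, y i ≤ 1
  R_le : ∀ i, R i ≤ 1
  t_lt : ∀ j < P.J ℓ, t j < P.M
  shifted : Shifted P ℓ n s t y
  mixed : Mixed P ℓ y n
  blocks : ∀ B < P.nB ℓ, dig 2 y (n + B * (2 * P.L)) (2 * P.L) = P.encT (dig 2 R (B * P.L) P.L)
  R_t : ∀ j < P.J ℓ, dig 2 R (j * P.m) P.m = t j
  R_s : ∀ p < P.M, ∀ j < 2 * P.k,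
    dig 2 R (P.d ℓ + (p * (2 * P.k) + j) * (ℓ + 1)) (ℓ + 1) = synd P ℓ y n p j

/-- What the decoder needs to recover `x` from `w` by means of the pattern `p`. -/
structure Good (n p : ℕ) (w x S a : ℕ → ℕ) : Prop where
  cnt_lt : cnt P w (n - P.k) p + 1 ≤ modulus ℓ
  a_lt : ∀ r < cnt P w (n - P.k) p + 1, a r < modulus ℓ
  b_lt : ∀ r < cnt P w (n - P.k) p + 1, pieceV P ℓ w (n - P.k) p r < modulus ℓ
  card_le : ((Finset.range (cnt P w (n - P.k) p + 1)).filter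
    fun r => a r ≠ pieceV P ℓ w (n - P.k) p r).card ≤ P.k
  S_zero : S 0 = 0
  S_last : S (cnt P w (n - P.k) p + 1) = n
  S_le : ∀ r < cnt P w (n - P.k) p + 1, S r ≤ S (r + 1)
  S_le_nb : ∀ r < cnt P w (n - P.k) p + 1, S (r + 1) ≤ S r + P.nb ℓ * P.L
  a_mod : ∀ r < cnt P w (n - P.k) p + 1, a r % P.D ℓ = S (r + 1) - S r
  -- The received bits at the offset of a block and the colour of the original block, extracted from
  -- `a r`, determine the original block.
  block : ∀ r < cnt P w (n - P.k) p + 1, ∀ b < P.nb ℓ,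
    P.decA (win w (bd P w (n - P.k) p (r + 1)) (bd P w (n - P.k) p r + b * P.L) (P.L - P.k) * P.c +
      a r / P.D ℓ / P.c ^ b % P.c) = win x (S (r + 1)) (S r + b * P.L) P.L
  syn : ∀ j < 2 * P.k, ((synd P ℓ x n p j : ℕ) : ZMod (modulus ℓ)) =
    ∑ r ∈ Finset.range (cnt P w (n - P.k) p + 1), (a r : ZMod (modulus ℓ)) * (r : ZMod _) ^ j

end defs

variable {P : Par} {ℓ : ℕ}

theorem hashV_mod {X : ℕ → ℕ} {a e : ℕ} (h : e - a < P.D ℓ) :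
    hashV P ℓ X a e % P.D ℓ = e - a := by
  rw [hashV, Nat.mul_comm, Nat.mul_add_mod, Nat.mod_eq_of_lt h]

theorem hashV_div {X : ℕ → ℕ} {a e : ℕ} (h : e - a < P.D ℓ) :
    hashV P ℓ X a e / P.D ℓ = dig P.c (fun b => P.h (win X e (a + b * P.L) P.L)) 0 (P.nb ℓ) := by
  rw [hashV, Nat.mul_comm, Nat.mul_add_div (by omega), Nat.div_eq_of_lt h, Nat.add_zero]

theorem hash_dig_lt (X : ℕ → ℕ) (a e : ℕ) :
    dig P.c (fun b => P.h (win X e (a + b * P.L) P.L)) 0 (P.nb ℓ) < P.c ^ P.nb ℓ :=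
  dig_lt fun _ _ => P.h_lt _

theorem hashV_lt {X : ℕ → ℕ} {a e : ℕ} (h : e - a < P.D ℓ) :
    hashV P ℓ X a e < P.D ℓ * P.c ^ P.nb ℓ := by
  have := hash_dig_lt (P := P) (ℓ := ℓ) X a e
  rw [hashV]
  calc _ < _ + P.D ℓ := Nat.add_lt_add_left h _
    _ = (dig P.c (fun b => P.h (win X e (a + b * P.L) P.L)) 0 (P.nb ℓ) + 1) * P.D ℓ := by ring
    _ ≤ P.c ^ P.nb ℓ * P.D ℓ := Nat.mul_le_mul_right _ this
    _ = _ := Nat.mul_comm _ _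

/-- The combinatorial facts meet here. Mixing bounds the pieces and thereby the hash values, which
stay below the modulus; alignment confines the errors to the at most `k` pieces that change their
length; inside a piece the blocks are recovered from their colours. -/
theorem good_of_aligned {n p : ℕ} {x w f : ℕ → ℕ} (hx : ∀ i, x i ≤ 1) (hw : ∀ i, w i ≤ 1)
    (hn : n < 2 ^ ℓ) (hD : P.D ℓ * P.c ^ P.nb ℓ ≤ 2 ^ ℓ) (hℓ : 1 ≤ ℓ) (hp : p < P.M)
    (E : Emb P.k n x w f) (hmix : Mixed P ℓ x n)
    (A : Aligned P.k n f (mark x n P.m p) (mark w (n - P.k) P.m p)) :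
    Good P ℓ n p w x (bd P x n p) (pieceV P ℓ x n p) := by
  obtain ⟨-, hq, -⟩ := modulus_spec ℓ
  have hcnt : cnt P w (n - P.k) p = cnt P x n p := (A.cnt_eq E).symm
  have hd : 0 < P.d ℓ := by
    have := P.one_le_m
    simp only [Par.d, Par.J, Par.M]; positivity
  have hcx : cnt P x n p ≤ n := Nat.count_le _
  have hlen : ∀ r < cnt P w (n - P.k) p + 1,
      bd P x n p (r + 1) - bd P x n p r < P.D ℓ := fun r hr =>
    piece_lt hd P.one_le_m (fun i hi => hmix i hi p hp)
      (by rw [hcnt] at hr; exact Nat.lt_succ_iff.1 hr)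
  have hpc := fun r (hr : r < cnt P w (n - P.k) p + 1) => A.piece E (r := r) (Nat.lt_succ_iff.1 hr)
  have hlenw : ∀ r < cnt P w (n - P.k) p + 1,
      bd P w (n - P.k) p (r + 1) - bd P w (n - P.k) p r < P.D ℓ := fun r hr => by
    obtain ⟨g, -, h, -⟩ := hpc r hr
    exact h.trans_lt (hlen r hr)
  have hSx : ∀ r, bd P x n p r ≤ bd P x n p (r + 1) := fun r => st_monotone _ _ (by omega)
  have hSw : ∀ r, bd P w (n - P.k) p r ≤ bd P w (n - P.k) p (r + 1) :=
    fun r => st_monotone _ _ (by omega)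
  refine ⟨by omega, fun r hr => ?_, fun r hr => ?_, ?_, ?_, ?_, fun r _ => hSx r,
    fun r hr => ?_, fun r hr => hashV_mod (hlen r hr), fun r hr b hb => ?_, fun j _ => ?_⟩
  · have := hashV_lt (X := x) (hlen r hr)
    simp only [pieceV]; omega
  · have := hashV_lt (X := w) (hlenw r hr)
    simp only [pieceV]; omega
  · refine (Finset.card_le_card fun r hr => ?_).trans (A.card_changed E)
    rw [Finset.mem_filter] at hr ⊢
    refine ⟨hr.1, fun heq => hr.2 ?_⟩
    have hr' : r < cnt P w (n - P.k) p + 1 := Finset.mem_range.1 hr.1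
    obtain ⟨g, Eg, h1, h2⟩ := hpc r hr'
    have e0 := hSx r
    have e1 := hSw r
    -- A piece that keeps its length loses no bit: its embedding is the identity, and both hash
    -- values agree.
    rw [heq] at Eg
    simp only [pieceV, bd] at e0 e1 ⊢
    set a := st (mark w (n - P.k) P.m p) (n - P.k) r
    set e := st (mark w (n - P.k) P.m p) (n - P.k) (r + 1)
    set a' := st (mark x n P.m p) n r
    set e' := st (mark x n P.m p) n (r + 1)
    have hpt : ∀ i < e - a, w (a + i) = x (a' + i) := fun i hi => by
      have := Eg.eq i (by omega)
      have h3 := Eg.le_self i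
      have h4 := Eg.le_add i
      rw [show g i = i by omega] at this
      exact this
    simp only [hashV, heq]
    congr 2
    refine dig_congr fun i _ => ?_
    congr 1
    have w1 := win_shift x a' (e - a) ((0 + i) * P.L) P.L
    have w2 := win_shift w a (e - a) ((0 + i) * P.L) P.L
    rw [show a' + (e - a) = e' by omega] at w1
    rw [show a + (e - a) = e by omega] at w2
    rw [← w1, ← w2]
    refine dig_congr fun i _ => ?_
    dsimp only
    split_ifs with h
    · exact (hpt _ h).symm
    · rfl
  · exact st_zero
  · rw [hcnt]; exact st_last
  · have := hlen r hr
    have := P.D_le ℓ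
    have := hSx r
    omega
  · obtain ⟨g, Eg, h1, h2⟩ := hpc r hr
    have e0 := hSx r
    have e1 := hSw r
    -- A piece loses at most `k` bits, so windows at equal offsets from the beginnings of the two
    -- pieces correspond.
    have hs := Eg.sub (k := P.k) (L := P.L) (by omega) (fun i => hx _) (fun i => hw _) (b * P.L)
    rw [win_shift, win_shift, Nat.sub_sub_self h1] at hs
    change Sub P.k P.L (win w (bd P w (n - P.k) p r +
      (bd P w (n - P.k) p (r + 1) - bd P w (n - P.k) p r)) _ _) (win x (bd P x n p r +
      (bd P x n p (r + 1) - bd P x n p r)) _ _) at hs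
    rw [show bd P w (n - P.k) p r + (bd P w (n - P.k) p (r + 1) - bd P w (n - P.k) p r) =
        bd P w (n - P.k) p (r + 1) by omega,
      show bd P x n p r + (bd P x n p (r + 1) - bd P x n p r) = bd P x n p (r + 1) by omega] at hs
    have hdig : pieceV P ℓ x n p r / P.D ℓ / P.c ^ b % P.c =
        P.h (win x (bd P x n p (r + 1)) (bd P x n p r + b * P.L) P.L) := by
      rw [pieceV, hashV_div (hlen r hr), dig_div_mod (c := P.c) (off := 0)
        (F := fun b => P.h (win x (bd P x n p (r + 1)) (bd P x n p r + b * P.L) P.L))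
        (fun _ _ => P.h_lt _) hb, Nat.zero_add]
    rw [hdig]
    exact P.decA_eq _ _ (win_lt hx _ _ _) hs
  · simp only [synd, ZMod.natCast_mod, hcnt]
    push_cast
    rfl

open Classical in
/-- More than half of the patterns are good. -/
theorem card_good {n : ℕ} {x w f : ℕ → ℕ} (E : Emb P.k n x w f) :
    P.M < 2 * ((Finset.range P.M).filter fun p =>
      Aligned P.k n f (mark x n P.m p) (mark w (n - P.k) P.m p)).card := by
  have h1 := E.card_not_aligned P.one_le_m P.M
  have h2 := Finset.card_filter_add_card_filter_not (s := Finset.range P.M) (fun p =>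
      Aligned P.k n f (mark x n P.m p) (mark w (n - P.k) P.m p))
  have h3 := P.lt_pow_m
  rw [Finset.card_range] at h2
  have : 4 * P.k * P.m = 4 * (P.k * P.m) := by ring
  simp only [Par.M] at *
  omega

/-- The blocks of the redundancy survive the deletions. -/
theorem IsCodeword.decT_eq {n : ℕ} {s t R y w f : ℕ → ℕ} (h : IsCodeword P ℓ n s t R y)
    (hw : ∀ i, w i ≤ 1) (E : Emb P.k (n + 2 * P.L * P.nB ℓ) y w f) {B : ℕ} (hB : B < P.nB ℓ) :
    P.decT (dig 2 w (n + B * (2 * P.L)) (2 * P.L - P.k)) = dig 2 R (B * P.L) P.L := by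
  -- The beginning of the block in the codeword is known, and the `2 * L - k` received bits from
  -- this position on come from the block.
  have hs := E.sub (k := P.k) (L := 2 * P.L) le_rfl h.y_le hw (n + B * (2 * P.L))
  have h1 : (B + 1) * (2 * P.L) ≤ 2 * P.L * P.nB ℓ := by
    rw [Nat.mul_comm (2 * P.L)]; exact Nat.mul_le_mul_right _ hB
  have h2 : (B + 1) * (2 * P.L) = B * (2 * P.L) + 2 * P.L := by ring
  have h3 := P.k_le_L
  rw [win_of_le (by omega), win_of_le (by omega), h.blocks B hB] at hs
  exact P.decT_eq _ _ (dig_lt fun i _ => Nat.lt_succ_iff.2 (h.R_le _)) hs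

/-! ### Parameter registers and size conditions -/

/-- The registers that hold the parameters of the code. -/
structure Ctx (P : Par) (ℓ n : ℕ) (σ : State) : Prop where
  r2 : σ.reg 2 = n
  r3 : σ.reg 3 = ℓ
  r4 : σ.reg 4 = 2 ^ ℓ
  r5 : σ.reg 5 = modulus ℓ
  r6 : σ.reg 6 = P.J ℓ
  r7 : σ.reg 7 = P.d ℓ
  r8 : σ.reg 8 = P.D ℓ
  r9 : σ.reg 9 = P.nb ℓ
  r16 : σ.reg 16 = n / P.d ℓ * P.J ℓ

/-- Does the program leave the parameter registers alone? -/
def Prog.keeps (p : Prog) : Bool :=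
  !(p.wr 2 || p.wr 3 || p.wr 4 || p.wr 5 || p.wr 6 || p.wr 7 || p.wr 8 || p.wr 9 || p.wr 16)

theorem Ctx.frame {P : Par} {ℓ n : ℕ} {σ τ : State} (h : Ctx P ℓ n σ) {p : Prog}
    (hf : Frame p σ τ) (hp : p.keeps = true) : Ctx P ℓ n τ := by
  simp only [Prog.keeps, Bool.not_eq_true', Bool.or_eq_false_iff] at hp
  obtain ⟨⟨⟨⟨⟨⟨⟨⟨h2, h3⟩, h4⟩, h5⟩, h6⟩, h7⟩, h8⟩, h9⟩, h16⟩ := hp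
  exact ⟨(hf.reg 2 h2).trans h.r2, (hf.reg 3 h3).trans h.r3, (hf.reg 4 h4).trans h.r4,
    (hf.reg 5 h5).trans h.r5, (hf.reg 6 h6).trans h.r6, (hf.reg 7 h7).trans h.r7,
    (hf.reg 8 h8).trans h.r8, (hf.reg 9 h9).trans h.r9, (hf.reg 16 h16).trans h.r16⟩

/-- The length `n` is large enough, so that all numbers that occur have at most `b` bits. -/
structure Sizes (P : Par) (ℓ n b : ℕ) : Prop where
  n_lt : n < 2 ^ ℓ
  pow_le : (2 ^ ℓ) ^ 6 ≤ 2 ^ b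
  D_mul_le : P.D ℓ * P.c ^ P.nb ℓ ≤ 2 ^ ℓ
  nb_le : P.nb ℓ * P.L ≤ 2 ^ ℓ
  L_le : 2 * P.L ≤ ℓ
  m_le : P.m ≤ ℓ
  le_b : ℓ + 1 ≤ b
  code_le : 2 * P.L * P.nB ℓ ≤ 2 ^ ℓ
  const_le : 2 ^ (2 * P.L) * P.c ≤ 2 ^ ℓ
  synd_le : 2 * P.k * P.M ≤ 2 ^ ℓ
  two_le : 2 ≤ ℓ

namespace Sizes
variable {P : Par} {ℓ n b : ℕ} (S : Sizes P ℓ n b)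
include S

theorem four_le : 4 ≤ 2 ^ ℓ := by
  have := Nat.pow_le_pow_right (n := 2) (by norm_num) S.two_le
  simpa using this

theorem lt_of_le {v : ℕ} (h : v ≤ 2 ^ ℓ * 2 ^ ℓ * 2 ^ ℓ * 2 ^ ℓ * 2 ^ ℓ) : v < 2 ^ b := by
  refine lt_of_lt_of_le ?_ S.pow_le
  have h4 := S.four_le
  have : 0 < 2 ^ ℓ * 2 ^ ℓ * 2 ^ ℓ * 2 ^ ℓ * 2 ^ ℓ := by positivity
  nlinarith

theorem lt_of_le_mul {v a c : ℕ} (h : v ≤ a * c) (ha : a ≤ 2 ^ ℓ * 2 ^ ℓ)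
    (hc : c ≤ 2 ^ ℓ * 2 ^ ℓ) : v < 2 ^ b := by
  refine S.lt_of_le (h.trans ((Nat.mul_le_mul ha hc).trans ?_))
  have h4 := S.four_le
  have : 0 < 2 ^ ℓ * 2 ^ ℓ * 2 ^ ℓ * 2 ^ ℓ := by positivity
  nlinarith

theorem lt_of_lin {v : ℕ} (h : v ≤ 16 * 2 ^ ℓ) : v < 2 ^ b := by
  refine S.lt_of_le_mul (h.trans (Nat.mul_le_mul_right _ ?_)) le_rfl ?_
  · have := S.four_le; nlinarith
  · have := S.four_le; nlinarith

theorem D_le : P.D ℓ ≤ 2 ^ ℓ :=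
  le_trans (Nat.le_mul_of_pos_right _ (Nat.pow_pos P.c_pos)) S.D_mul_le

theorem d_pos : 0 < P.d ℓ := by
  have := P.one_le_m
  have := S.two_le
  simp only [Par.d, Par.J, Par.M]; positivity

theorem J_pos : 0 < P.J ℓ := by
  have := S.two_le
  simp only [Par.J, Par.M]; positivity

theorem d_le : P.d ℓ ≤ 2 ^ ℓ := by have := S.D_le; simp only [Par.D] at this; omega

theorem J_le : P.J ℓ ≤ 2 ^ ℓ := by
  have := S.d_le
  simp only [Par.d] at this
  exact (Nat.le_mul_of_pos_left _ P.one_le_m).trans this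

theorem c_pow_le : P.c ^ P.nb ℓ ≤ 2 ^ ℓ :=
  le_trans (Nat.le_mul_of_pos_left _ (by have := S.d_pos; simp only [Par.D]; omega)) S.D_mul_le

theorem M_le : P.M ≤ 2 ^ ℓ := by
  have := P.two_le_k
  exact le_trans (Nat.le_mul_of_pos_left _ (by omega)) S.synd_le

theorem k_le : 2 * P.k ≤ 2 ^ ℓ :=
  le_trans (Nat.le_mul_of_pos_right _ (by positivity)) S.synd_le

theorem c_le : P.c ≤ 2 ^ ℓ := le_trans (Nat.le_mul_of_pos_left _ (by positivity)) S.const_le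

theorem pow_L_le : 2 ^ (2 * P.L) ≤ 2 ^ ℓ :=
  le_trans (Nat.le_mul_of_pos_right _ P.c_pos) S.const_le

theorem h_lt (u : ℕ) : P.h u ≤ 2 ^ ℓ := (P.h_lt u).le.trans S.c_le

end Sizes

/-! ### Computing pieces, hash values and syndromes -/

/-- Split the first `reg 24` bits of array `a` at the occurrences of the pattern `reg 25`; the
number of occurrences is put into register `27`, the boundaries of the pieces into array `8`. -/
def splitP (P : Par) (a : ℕ) : Prog := block [
  .assign 27 0,
  .store 8 0 0,
  .assign 11 (.reg 24),
  .assign 12 (.lit P.m),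
  forP 28 (.reg 24) (block [
    .assign 10 (.reg 28),
    readWin a,
    .ite ((Expr.reg 13).eq (.reg 25))
      (block [.assign 27 (.reg 27 + 1), .store 8 (.reg 27) (.reg 28)]) .nop]),
  .store 8 (.reg 27 + 1) (.reg 24)]

/-- The invariant places each mark seen so far at the index given by the number of marks before it
plus one, which is its index as a boundary; the end of the string follows after the last mark. -/
theorem Runs.splitP {P : Par} {ℓ n b a : ℕ} {σ : State} (S : Sizes P ℓ n b)
    (hX : ∀ i, σ.arr a i ≤ 1) (ha : a ≠ 8) (hlen : σ.reg 24 < 2 ^ ℓ) :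
    Runs b (splitP P a) σ (σ.reg 24 * (3 * P.m + 12 + 2) + 10) (fun τ =>
      τ.reg 27 = cnt P (σ.arr a) (σ.reg 24) (σ.reg 25) ∧
      ∀ r ≤ cnt P (σ.arr a) (σ.reg 24) (σ.reg 25) + 1,
        τ.arr 8 r = bd P (σ.arr a) (σ.reg 24) (σ.reg 25) r) := by
  have hm := S.m_le
  have hlb := S.le_b
  set len := σ.reg 24 with hlen'
  set p := σ.reg 25 with hp
  set X := σ.arr a with hXdef
  have bound : ∀ v, v ≤ len + 2 → v < 2 ^ b := fun v hv => S.lt_of_lin (by omega)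
  refine .cons_assign 0 (by simp) (bound _ (by omega)) ?_
  refine .cons_store 0 0 (by simp) (by simp) (bound _ (by omega)) ?_
  refine .cons_assign len (by simp [hlen']) (bound _ (by omega)) ?_
  refine .cons_assign P.m (by simp) (Nat.lt_two_pow_self.trans_le
    (Nat.pow_le_pow_right (by norm_num) (by omega))) ?_
  refine .cons_for len (3 * P.m + 12)
    (fun j τ => τ.reg 27 = Nat.count (mark X len P.m p) j ∧ τ.arr 8 0 = 0 ∧
      ∀ i < j, mark X len P.m p i → τ.arr 8 (Nat.count (mark X len P.m p) i + 1) = i)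
    (by simp) (bound _ (by omega)) (fun τ hf => by simp [hf.reg 24, hlen']) (by simp) ?_ ?_ (by omega)
  · rintro j τ hj hr hf ⟨h1, h2, h3⟩
    have hcj : Nat.count (mark X len P.m p) j ≤ j := Nat.count_le _
    refine .cons_assign j (by simp [hr]) (bound _ (by omega)) ?_
    have f12 : τ.reg 12 = P.m := by simp [hf.reg 12]
    have f11 : τ.reg 11 = len := by simp [hf.reg 11]
    have fa : τ.arr a = X := by simp [hf.arr a, ha, hXdef]
    have f25 : τ.reg 25 = p := by simp [hf.reg 25, hp]
    refine .cons (c₁ := 3 * P.m + 5) (.mono (.readWin a (by simpa [fa] using hX)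
      (by simp [f12]; omega)) (by simp [f12])) (fun τ' hf' h' => ?_) (by omega)
    simp only [State.setReg_arr, fa, State.setReg_reg_self] at h'
    simp [f11, f12] at h'
    have g27 : τ'.reg 27 = τ.reg 27 := by simp [hf'.reg 27]
    have g8 : τ'.arr 8 = τ.arr 8 := by simp [hf'.arr 8]
    refine .cons (c₁ := 4) (.ite' (fun he => ?_) (fun he => ?_) (by omega))
      (fun τ _ h => .nil h (by omega)) (by omega)
    · rw [Expr.eval_eq_ne_zero] at he
      have hmark : mark X len P.m p j := by
        simp [hf'.reg 25, f25, h'] at he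
        exact he
      refine .cons_assign (Nat.count (mark X len P.m p) j + 1) (by simp [g27, h1])
        (bound _ (by omega)) ?_
      refine .cons_store (Nat.count (mark X len P.m p) j + 1) j (by simp)
        (by simp [hf'.reg 28, hr]) (bound _ (by omega)) (.nil ?_)
      refine ⟨by simp [Nat.count_succ, hmark], by simp [g8, h2], fun i hi hmi => ?_⟩
      rcases Nat.lt_succ_iff_lt_or_eq.1 hi with hi' | rfl
      · have := Nat.count_strict_mono hmi hi'
        have hne : Nat.count (mark X len P.m p) i ≠ Nat.count (mark X len P.m p) j := by omega
        simp [g8, hne, h3 i hi' hmi]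
      · simp
    · have hmark : ¬ mark X len P.m p j := fun hm => by
        refine Expr.eval_eq_ne_zero.2 ?_ he
        simp [hf'.reg 25, f25, h']
        exact hm
      refine (Runs.nop ?_).mono (by omega)
      refine ⟨by simp [g27, h1, Nat.count_succ, hmark], by simp [g8, h2], fun i hi hmi => ?_⟩
      rcases Nat.lt_succ_iff_lt_or_eq.1 hi with hi' | rfl
      · simp [g8, h3 i hi' hmi]
      · exact absurd hmi hmark
  · rintro τ hf ⟨h1, h2, h3⟩
    change τ.reg 27 = cnt P X len p at h1
    have hc : cnt P X len p ≤ len := Nat.count_le _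
    refine .cons_store (cnt P X len p + 1) len (by simp [h1]) (by simp [hf.reg 24, hlen'])
      (bound _ (by omega)) (.nil ⟨by simpa using h1, fun r hr => ?_⟩ (by omega))
    rcases Nat.lt_or_ge (cnt P X len p) r with h | h
    · obtain rfl : r = cnt P X len p + 1 := by omega
      simp [bd, cnt, st_last]
    · have hne : r ≠ cnt P X len p + 1 := by omega
      simp only [State.setArr_arr_self, Function.update_of_ne hne]
      rcases Nat.eq_zero_or_pos r with rfl | h0
      · simp [h2, bd]
      · obtain ⟨i, hi, hp, hci, hs⟩ := exists_st h0 h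
        rw [bd, hs, ← hci]
        exact h3 i hi hp

@[simp] theorem splitP_wr (P : Par) (a i : ℕ) : (splitP P a).wr i =
    (i == 10 || i == 11 || i == 12 || i == 13 || i == 14 || i == 15 || i == 27 || i == 28) := by
  simp only [splitP, block, Prog.wr, forP_wr, readWin_wr]; grind
@[simp] theorem splitP_wa (P : Par) (a i : ℕ) : (splitP P a).wa i = (i == 8) := by
  simp only [splitP, block, Prog.wa, forP_wa, readWin_wa]; grind

/-- Put the hash value of piece `reg 29` of array `a` into register `31`. -/
def hashP (P : Par) (a : ℕ) : Prog := block [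
  .assign 31 0,
  .assign 11 (.get 8 (.reg 29 + 1)),
  .assign 12 (.lit P.L),
  .assign 32 (.get 8 (.reg 29)),
  forP 33 (.reg 9) (block [
    .assign 10 (.reg 32 + (.reg 9 - 1 - .reg 33) * .lit P.L),
    readWin a,
    .assign 31 (.reg 31 * .lit P.c + .get 3 (.reg 13))]),
  .assign 31 (.reg 31 * .reg 8 + (.reg 11 - .reg 32))]

@[simp] theorem hashP_wr (P : Par) (a i : ℕ) : (hashP P a).wr i =
    (i == 10 || i == 11 || i == 12 || i == 13 || i == 14 || i == 15 || i == 31 || i == 32 ||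
      i == 33) := by
  simp only [hashP, block, Prog.wr, forP_wr, readWin_wr]; grind
@[simp] theorem hashP_wa (P : Par) (a i : ℕ) : (hashP P a).wa i = false := by
  simp [hashP]

/-- Horner's rule over the blocks from the last to the first, with colours from the table in array
`3`. Every piece is treated as `nb` blocks; windows are cut off at its end, so missing bits count as
zeros. -/
theorem Runs.hashP {P : Par} {ℓ n b a : ℕ} {σ : State} (S : Sizes P ℓ n b) (hc : Ctx P ℓ n σ)
    (hX : ∀ i, σ.arr a i ≤ 1) (h3 : ∀ i < 2 ^ P.L, σ.arr 3 i = P.h i)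
    (hA : σ.arr 8 (σ.reg 29) < 2 ^ ℓ) (hA' : σ.arr 8 (σ.reg 29 + 1) < 2 ^ ℓ) :
    Runs b (hashP P a) σ (P.nb ℓ * (3 * P.L + 8 + 2) + 8) (fun τ =>
      τ.reg 31 = hashV P ℓ (σ.arr a) (σ.arr 8 (σ.reg 29)) (σ.arr 8 (σ.reg 29 + 1))) := by
  have hL := S.L_le
  have hlb := S.le_b
  have hLpos := P.L_pos
  set s := σ.arr 8 (σ.reg 29)
  set e := σ.arr 8 (σ.reg 29 + 1)
  set X := σ.arr a with hXdef
  set F : ℕ → ℕ := fun b => P.h (win X e (s + b * P.L) P.L) with hF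
  have lin : ∀ v, v ≤ 16 * 2 ^ ℓ → v < 2 ^ b := fun v hv => S.lt_of_lin hv
  have hnbL : P.nb ℓ ≤ 2 ^ ℓ := (Nat.le_mul_of_pos_right _ hLpos).trans S.nb_le
  refine .cons_assign 0 (by simp) (by positivity) ?_
  refine .cons_assign e (by simp [e]) (lin _ (by omega)) ?_
  refine .cons_assign P.L (by simp) (Nat.lt_two_pow_self.trans_le
    (Nat.pow_le_pow_right (by norm_num) (by omega))) ?_
  refine .cons_assign s (by simp [s]) (lin _ (by omega)) ?_
  refine .cons_for (P.nb ℓ) (3 * P.L + 8)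
    (fun j τ => τ.reg 31 = dig P.c F (P.nb ℓ - j) j)
    (by simp) (lin _ (by omega)) (fun τ hf => by simp [hf.reg 9, hc.r9]) (by simp) ?_ ?_ (by omega)
  · intro j τ hj hr hf h1
    have hmul : (P.nb ℓ - 1 - j) * P.L ≤ P.nb ℓ * P.L := Nat.mul_le_mul_right _ (by omega)
    have hnb := S.nb_le
    refine .cons_assign (s + (P.nb ℓ - 1 - j) * P.L)
      (by simp [hf.reg 32, hf.reg 9, hc.r9, hr]) (lin _ (by omega)) ?_
    have f12 : τ.reg 12 = P.L := by simp [hf.reg 12]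
    have f11 : τ.reg 11 = e := by simp [hf.reg 11]
    have fa : τ.arr a = X := by simp [hf.arr a, hXdef]
    have f3 : τ.arr 3 = σ.arr 3 := by simp [hf.arr 3]
    refine .cons (c₁ := 3 * P.L + 5) (.mono (.readWin a (by simpa [fa] using hX)
      (by simp [f12]; omega)) (by simp [f12])) (fun τ' hf' h' => ?_) (by omega)
    simp only [State.setReg_arr, fa, State.setReg_reg_self] at h'
    simp [f11, f12] at h'
    have g31 : τ'.reg 31 = τ.reg 31 := by simp [hf'.reg 31]
    have g3 : τ'.arr 3 = σ.arr 3 := by simp [hf'.arr 3, f3]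
    have e1 := dig_succ P.c F (P.nb ℓ - (j + 1)) j
    rw [show P.nb ℓ - (j + 1) + 1 = P.nb ℓ - j by omega] at e1
    have hlt : dig P.c F (P.nb ℓ - (j + 1)) (j + 1) < P.c ^ (j + 1) :=
      dig_lt fun i _ => P.h_lt _
    have hle : P.c ^ (j + 1) ≤ P.c ^ P.nb ℓ := Nat.pow_le_pow_right P.c_pos (by omega)
    have := S.c_pow_le
    refine .cons_assign (dig P.c F (P.nb ℓ - (j + 1)) (j + 1)) ?_ (lin _ (by omega))
      (.nil (by simp))
    have hFj : F (P.nb ℓ - (j + 1)) = P.h (τ'.reg 13) := by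
      simp only [hF, h', show P.nb ℓ - (j + 1) = P.nb ℓ - 1 - j by omega]
    have h13 : τ'.reg 13 < 2 ^ P.L := h' ▸ win_lt hX _ _ _
    simp only [Expr.eval_add, Expr.eval_mul, Expr.eval_reg, Expr.eval_lit, Expr.eval_get, g31, h1,
      g3, h3 _ h13, e1, hFj]
    ring
  · intro τ hf h1
    rw [Nat.sub_self] at h1
    have hlt : dig P.c F 0 (P.nb ℓ) < P.c ^ P.nb ℓ := hash_dig_lt X s e
    refine .cons_assign (hashV P ℓ X s e) ?_ ?_ (.nil (by simp) (by omega))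
    · simp [h1, hf.reg 8, hc.r8, hf.reg 11, hf.reg 32, hashV, hF]
    · have h1 : dig P.c F 0 (P.nb ℓ) * P.D ℓ ≤ P.c ^ P.nb ℓ * P.D ℓ :=
        Nat.mul_le_mul_right _ hlt.le
      have h2 := S.D_mul_le
      rw [Nat.mul_comm] at h2
      refine lin _ ?_
      simp only [hashV]
      change dig P.c F 0 (P.nb ℓ) * P.D ℓ + (e - s) ≤ _
      omega

/-- Add the syndromes of the first `reg 24` bits of array `a` with respect to the pattern `reg 25`
to array `o` from `reg 26` on. The hash values of the pieces are put into array `9`. -/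
def sketchP (P : Par) (a o : ℕ) : Prog := block [
  splitP P a,
  forP 29 (.reg 27 + 1) (block [
    hashP P a,
    .store 9 (.reg 29) (.reg 31),
    .assign 34 1,
    forP 35 (.lit (2 * P.k)) (block [
      .store o (.reg 26 + .reg 35)
        ((.get o (.reg 26 + .reg 35) + .reg 31 * .reg 34) % .reg 5),
      .assign 34 ((.reg 34 * .reg 29) % .reg 5)])])]

@[simp] theorem sketchP_wr (P : Par) (a o i : ℕ) : (sketchP P a o).wr i =
    (i == 10 || i == 11 || i == 12 || i == 13 || i == 14 || i == 15 || i == 27 || i == 28 ||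
      i == 29 || i == 31 || i == 32 || i == 33 || i == 34 || i == 35) := by
  simp only [sketchP, block, Prog.wr, forP_wr, splitP_wr, hashP_wr]; grind
@[simp] theorem sketchP_wa (P : Par) (a o i : ℕ) :
    (sketchP P a o).wa i = (i == 8 || i == 9 || i == o) := by
  simp only [sketchP, block, Prog.wa, forP_wa, splitP_wa, hashP_wa]; grind

/-- A bound for the number of steps of `sketchP`. -/
def sketchCost (P : Par) (ℓ len : ℕ) : ℕ :=
  len * (3 * P.m + 12 + 2) + 10 +
    ((len + 1) * (P.nb ℓ * (3 * P.L + 8 + 2) + 8 + (2 * P.k * (3 + 2) + 2) + 3 + 2) + 2) + 1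

/-- A hash value is added to all `2 * k` power sums as soon as it is known, with the current power
of `r` kept modulo `q` in register `34`. -/
theorem Runs.sketchP {P : Par} {ℓ n b a o : ℕ} {σ : State} (S : Sizes P ℓ n b)
    (hc : Ctx P ℓ n σ) (hX : ∀ i, σ.arr a i ≤ 1) (h3 : ∀ i < 2 ^ P.L, σ.arr 3 i = P.h i)
    (ha8 : a ≠ 8) (ha9 : a ≠ 9) (hao : a ≠ o) (ho3 : o ≠ 3) (ho8 : o ≠ 8) (ho9 : o ≠ 9)
    (hlen : σ.reg 24 < 2 ^ ℓ) (h0 : ∀ j < 2 * P.k, σ.arr o (σ.reg 26 + j) = 0) :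
    Runs b (sketchP P a o) σ (sketchCost P ℓ (σ.reg 24)) (fun τ =>
      τ.reg 27 = cnt P (σ.arr a) (σ.reg 24) (σ.reg 25) ∧
      (∀ r ≤ cnt P (σ.arr a) (σ.reg 24) (σ.reg 25) + 1,
        τ.arr 8 r = bd P (σ.arr a) (σ.reg 24) (σ.reg 25) r) ∧
      (∀ r < cnt P (σ.arr a) (σ.reg 24) (σ.reg 25) + 1,
        τ.arr 9 r = pieceV P ℓ (σ.arr a) (σ.reg 24) (σ.reg 25) r) ∧
      τ.arr o = fun y => if σ.reg 26 ≤ y ∧ y < σ.reg 26 + 2 * P.k then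
        synd P ℓ (σ.arr a) (σ.reg 24) (σ.reg 25) (y - σ.reg 26) else σ.arr o y) := by
  set len := σ.reg 24
  set p := σ.reg 25
  set X := σ.arr a
  set base := σ.reg 26 with hbase
  set C := cnt P X len p
  have hC : C ≤ len := Nat.count_le _
  have hcost : C + 1 ≤ len + 1 := by omega
  have hcost' := Nat.mul_le_mul_right
    (P.nb ℓ * (3 * P.L + 8 + 2) + 8 + (2 * P.k * (3 + 2) + 2) + 3 + 2) hcost
  obtain ⟨hqp, hq1, hq2⟩ := modulus_spec ℓ
  set q := modulus ℓ with hq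
  have lin : ∀ v, v ≤ 16 * 2 ^ ℓ → v < 2 ^ b := fun v hv => S.lt_of_lin hv
  have hq0 : 1 < q := hqp.one_lt
  have hbdle : ∀ r, bd P X len p r ≤ len := fun r => st_le_len r
  have hsum : ∀ r j : ℕ, (∑ r' ∈ Finset.range (r + 1), pieceV P ℓ X len p r' * r' ^ j) % q =
      ((∑ r' ∈ Finset.range r, pieceV P ℓ X len p r' * r' ^ j) % q +
        pieceV P ℓ X len p r * (r ^ j % q)) % q := fun r j => by
    simp [Finset.sum_range_succ, Nat.add_mod, Nat.mul_mod]
  refine .cons (c₁ := len * (3 * P.m + 12 + 2) + 10) (.splitP S hX ha8 hlen) ?_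
    (by simp only [sketchCost]; omega)
  rintro τ0 f0 ⟨c0, b0⟩
  change τ0.reg 27 = C at c0
  change ∀ r ≤ C + 1, τ0.arr 8 r = bd P X len p r at b0
  refine .cons_for (C + 1) (P.nb ℓ * (3 * P.L + 8 + 2) + 8 + (2 * P.k * (3 + 2) + 2) + 3)
    (fun r τ => (∀ r' < r, τ.arr 9 r' = pieceV P ℓ X len p r') ∧
      τ.arr o = fun y => if base ≤ y ∧ y < base + 2 * P.k then
        (∑ r' ∈ Finset.range r, pieceV P ℓ X len p r' * r' ^ (y - base)) % q else σ.arr o y)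
    (by simp) (lin _ (by omega)) (fun τ hf => by simpa [hf.reg 27] using c0) ?_ ?_ ?_
    (by simp only [sketchCost]; omega)
  · refine ⟨by simp, ?_⟩
    funext y
    simp only [State.setReg_arr, f0.arr o (by simp [ho8])]
    split_ifs with hy
    · obtain ⟨j, rfl⟩ := Nat.exists_eq_add_of_le hy.1
      simpa using h0 j (by omega)
    · rfl
  · rintro r τ hr hr29 hf ⟨i1, i2⟩
    have f8 : τ.arr 8 = τ0.arr 8 := hf.arr 8 (by simp [ho8.symm])
    have fX : τ.arr a = X := by
      rw [hf.arr a (by simp [ha9, hao]), f0.arr a (by simp [ha8])]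
    have A1 : τ.arr 8 (τ.reg 29) = bd P X len p r := by rw [f8, hr29, b0 r (by omega)]
    have A2 : τ.arr 8 (τ.reg 29 + 1) = bd P X len p (r + 1) := by
      rw [f8, hr29, b0 (r + 1) (by omega)]
    have hcτ : Ctx P ℓ n τ := (hc.frame f0 (by simp [Prog.keeps])).frame hf (by simp [Prog.keeps])
    refine .cons (c₁ := P.nb ℓ * (3 * P.L + 8 + 2) + 8) (.hashP (a := a) S hcτ
      (by rw [fX]; exact hX)
      (by rw [hf.arr 3 (by simp [ho3.symm]), f0.arr 3 (by simp)]; exact h3)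
      (by rw [A1]; exact (hbdle r).trans_lt hlen)
      (by rw [A2]; exact (hbdle (r + 1)).trans_lt hlen)) ?_
    intro τ1 f1 e1
    rw [A1, A2, fX] at e1
    change τ1.reg 31 = pieceV P ℓ X len p r at e1
    -- The hash value fits into a cell because it already stands in a register; no bound on the
    -- length of the piece is needed.
    refine .of_bdd fun hbd => ?_
    refine .cons_store r (pieceV P ℓ X len p r) (by simp [f1.reg 29, hr29]) (by simp [e1])
      (e1 ▸ hbd.1 31) ?_
    refine .cons_assign 1 (by simp) (lin _ (by omega)) ?_
    have k_le := S.k_le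
    have g9 : τ1.arr 9 = τ.arr 9 := f1.arr 9 (by simp)
    have go : τ1.arr o = τ.arr o := f1.arr o (by simp)
    have g29 : τ1.reg 29 = r := by simp [f1.reg 29, hr29]
    have g26 : τ1.reg 26 = base := by
      simp [f1.reg 26, hf.reg 26, f0.reg 26, hbase]
    have g5 : τ1.reg 5 = q := (hcτ.frame f1 (by simp [Prog.keeps])).r5
    -- In the midst of the update the first `j` power sums already contain piece `r`, and the others
    -- do not.
    refine .cons_for (2 * P.k) 3 (fun j τ =>
      τ.reg 34 = r ^ j % q ∧ τ.arr o = fun y => if base ≤ y ∧ y < base + 2 * P.k then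
        (∑ r' ∈ Finset.range (if y < base + j then r + 1 else r),
          pieceV P ℓ X len p r' * r' ^ (y - base)) % q else σ.arr o y)
      (by simp) (lin _ (by omega)) (fun τ hf => by simp) ?_ ?_ ?_
    · refine ⟨by simp [Nat.mod_eq_of_lt hq0], ?_⟩
      simp only [State.setReg_arr, State.setArr_arr_ne _ _ _ ho9, go, i2]
      funext y
      by_cases hy : base ≤ y ∧ y < base + 2 * P.k
      · simp [hy, show ¬ y < base by omega]
      · simp only [if_neg hy]
    · rintro j τ' hj hj35 hf' ⟨u1, u2⟩
      have k29 : τ'.reg 29 = r := by simp [hf'.reg 29, g29]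
      have k5 : τ'.reg 5 = q := by simp [hf'.reg 5, g5]
      have k26 : τ'.reg 26 = base := by simp [hf'.reg 26, g26]
      have k31 : τ'.reg 31 = pieceV P ℓ X len p r := by simp [hf'.reg 31, e1]
      have hval : τ'.arr o (base + j) =
          (∑ r' ∈ Finset.range r, pieceV P ℓ X len p r' * r' ^ j) % q := by
        rw [u2]; simp [hj]
      refine .cons_store (base + j)
        ((∑ r' ∈ Finset.range (r + 1), pieceV P ℓ X len p r' * r' ^ j) % q)
        (by simp [k26, hj35]) ?_ (lin _ ?_) ?_
      · simp only [Expr.eval_mod, Expr.eval_add, Expr.eval_mul, Expr.eval_reg, Expr.eval_get,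
          k26, hj35, k31, u1, k5, hval, hsum]
      · have := Nat.mod_lt (∑ r' ∈ Finset.range (r + 1), pieceV P ℓ X len p r' * r' ^ j)
          (show 0 < q by omega)
        omega
      refine .cons_assign (r ^ (j + 1) % q) ?_ (lin _ ?_) (.nil ⟨by simp, ?_⟩)
      · simp [u1, k29, k5, pow_succ, Nat.mul_mod]
      · have := Nat.mod_lt (r ^ (j + 1)) (show 0 < q by omega)
        omega
      · simp only [State.setReg_arr, State.setArr_arr_self, u2]
        funext y
        rw [Function.update_apply]
        by_cases hy : y = base + j
        · subst hy; simp [hj]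
        · rw [if_neg hy]
          have : y < base + (j + 1) ↔ y < base + j := by omega
          simp only [this]
    · rintro τ' hf' ⟨-, u2⟩
      refine .nil ⟨fun r' hr' => ?_, ?_⟩
      · rw [State.setReg_arr, hf'.arr 9 (by simp [ho9.symm])]
        simp only [State.setReg_arr, State.setArr_arr_self, g9]
        by_cases h : r' = r
        · subst h; simp
        · rw [Function.update_of_ne h, i1 r' (by omega)]
      · rw [State.setReg_arr, u2]
        funext y
        by_cases hy : base ≤ y ∧ y < base + 2 * P.k
        · simp [hy]
        · simp only [if_neg hy]
  · rintro τ hf ⟨u1, u2⟩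
    refine .nil ⟨?_, fun r hr => ?_, u1, u2⟩ (by simp only [sketchCost]; omega)
    · simpa [hf.reg 27] using c0
    · rw [hf.arr 8 (by simp [ho8.symm])]; exact b0 r hr

/-! ### Correcting the hash values by machine -/

/-- Put the Hankel determinant of order `reg 41 ≤ μ` of array `12` into register `42`. -/
def detP : ℕ → Prog
  | 0 => .assign 42 1
  | μ + 1 => .ite ((Expr.reg 41).eq (.lit (μ + 1)))
      (.assign 42 (detE (μ + 1) fun i j => .get 12 (.lit (i + j)))) (detP μ)

@[simp] theorem detP_wr (μ i : ℕ) : (detP μ).wr i = (i == 42) := by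
  induction μ <;> simp [detP, *]
@[simp] theorem detP_wa (μ i : ℕ) : (detP μ).wa i = false := by
  induction μ <;> simp [detP, *]

/-- The order is known only at run time, while an expression has a fixed shape. So the program
contains one determinant for each order up to `μ` and selects by register `41`. -/
theorem Runs.detP {b ℓ : ℕ} {σ : State} (μ : ℕ) (h5 : σ.reg 5 = modulus ℓ)
    (h12 : ∀ j, j + 1 < 2 * μ → σ.arr 12 j < modulus ℓ) (hμ : σ.reg 41 ≤ μ) :
    Runs b (detP μ) σ (μ + 1) (fun τ =>
      τ.reg 42 = 0 ↔ hank (σ.reg 41) (fun j => (σ.arr 12 j : ZMod (modulus ℓ))) = 0) := by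
  have hq := (modulus_spec ℓ).1.one_lt
  refine .of_bdd fun hbd => ?_
  have h5b := hbd.1 5
  induction μ with
  | zero =>
    have h0 : σ.reg 41 = 0 := by omega
    refine .assign 1 (by simp) (by omega) ?_
    rw [State.setReg_reg_self, h0]
    simp [hank]
  | succ μ ih =>
    refine .ite (fun he => ?_) (fun he => ?_)
    · rw [Expr.eval_eq_ne_zero] at he
      simp only [Expr.eval_reg, Expr.eval_lit] at he
      set A : Fin (μ + 1) → Fin (μ + 1) → Expr := fun i j => .get 12 (.lit (i + j))
      have hlt := detE_lt h5 hq (μ + 1) A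
      have hcast := detE_cast h5 (μ + 1) A fun i j => by
        have := h12 (i + j) (by omega)
        simpa [A] using this.le
      refine Runs.mono (.assign ((detE (μ + 1) A).eval σ) rfl (by omega) ?_)
        (show 1 ≤ μ + 1 by omega)
      rw [State.setReg_reg_self, he, hank]
      simp only [A, Expr.eval_get, Expr.eval_lit] at hcast hlt ⊢
      rw [← hcast, ZMod.natCast_eq_zero_iff]
      exact ⟨fun h => h ▸ Nat.dvd_zero _, fun h => Nat.eq_zero_of_dvd_of_lt h hlt⟩
    · have hne : σ.reg 41 ≠ μ + 1 := fun h => Expr.eval_eq_ne_zero.2 (by simpa using h) he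
      exact ih (fun j hj => h12 j (by omega)) (by omega)

/-- Put the difference of the syndromes in the arrays `5` and `10` into the arrays `11` and `12`. -/
def deltaP (P : Par) : Prog :=
  forP 40 (.lit (2 * P.k)) (block [
    .store 11 (.reg 40)
      -- The added modulus keeps the truncated subtraction exact.
      ((.get 5 (.reg 26 + .reg 40) + .reg 5 - .get 10 (.reg 26 + .reg 40)) % .reg 5),
    .store 12 (.reg 40) (.get 11 (.reg 40))])

@[simp] theorem deltaP_wr (P : Par) (i : ℕ) : (deltaP P).wr i = (i == 40) := by
  simp [deltaP]
@[simp] theorem deltaP_wa (P : Par) (i : ℕ) : (deltaP P).wa i = (i == 11 || i == 12) := by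
  simp [deltaP]

theorem Runs.deltaP {P : Par} {ℓ n b : ℕ} {σ : State} (S : Sizes P ℓ n b)
    (h5 : σ.reg 5 = modulus ℓ) (h10 : ∀ j < 2 * P.k, σ.arr 10 (σ.reg 26 + j) < modulus ℓ) :
    Runs b (deltaP P) σ (2 * P.k * (3 + 2) + 2) (fun τ =>
      (∀ j < 2 * P.k, τ.arr 11 j < modulus ℓ ∧ τ.arr 12 j = τ.arr 11 j) ∧
      ∀ j < 2 * P.k, (τ.arr 11 j : ZMod (modulus ℓ)) =
        (σ.arr 5 (σ.reg 26 + j) : ZMod (modulus ℓ)) - σ.arr 10 (σ.reg 26 + j)) := by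
  obtain ⟨hqp, -, hq2⟩ := modulus_spec ℓ
  have k_le := S.k_le
  refine .for_const (2 * P.k) 3 (fun J τ =>
      (∀ j < J, τ.arr 11 j < modulus ℓ ∧ τ.arr 12 j = τ.arr 11 j) ∧
      ∀ j < J, (τ.arr 11 j : ZMod (modulus ℓ)) =
        (σ.arr 5 (σ.reg 26 + j) : ZMod (modulus ℓ)) - σ.arr 10 (σ.reg 26 + j))
    (by simp) (S.lt_of_lin (by omega)) (fun τ hf => by simp) (by simp) ?_ (fun τ _ _ h => h)
  rintro J τ hJ hr hf ⟨i1, i2⟩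
  set v := (σ.arr 5 (σ.reg 26 + J) + modulus ℓ - σ.arr 10 (σ.reg 26 + J)) % modulus ℓ with hv
  have hvlt : v < modulus ℓ := Nat.mod_lt _ hqp.pos
  have hvb : v < 2 ^ b := S.lt_of_lin (by omega)
  have h10J := h10 J hJ
  refine .cons_store J v (by simp [hr]) ?_ hvb ?_
  · simp [hf.reg 26, hf.reg 5, h5, hr, hf.arr 5, hf.arr 10, hv]
  refine .cons_store J v (by simp [hr]) (by simp [hr]) hvb (.nil ⟨fun j hj => ?_, fun j hj => ?_⟩)
  · by_cases h : j = J
    · subst h; simp [hvlt]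
    · simpa [h] using i1 j (by omega)
  · by_cases h : j = J
    · subst h
      simp only [State.setReg_arr]
      rw [State.setArr_arr_ne _ _ _ (by norm_num), State.setArr_arr_self, Function.update_self,
        hv, ZMod.natCast_mod, Nat.cast_sub (by omega)]
      simp
    · simpa [h] using i2 j (by omega)

/-- Put the largest `μ ≤ k` with nonzero Hankel determinant of array `12` into register `41`. -/
def orderP (P : Par) : Prog := block [
  .assign 41 (.lit P.k),
  forP 43 (.lit P.k) (block [detP P.k, .ite ((Expr.reg 42).eq 0) (.assign 41 (.reg 41 - 1)) .nop])]

@[simp] theorem orderP_wr (P : Par) (i : ℕ) :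
    (orderP P).wr i = (i == 41 || i == 42 || i == 43) := by
  simp only [orderP, block, Prog.wr, forP_wr, detP_wr]; grind
@[simp] theorem orderP_wa (P : Par) (i : ℕ) : (orderP P).wa i = false := by
  simp [orderP]

/-- The order starts at `k` and decreases while the determinant vanishes; order `0` has determinant
`1`, so `k` rounds suffice. Correctness is conditional, but the running time is not: the program
also runs on spoilt patterns, for which the data are meaningless. -/
theorem Runs.orderP {P : Par} {ℓ n b : ℕ} {σ : State} (S : Sizes P ℓ n b)
    (h5 : σ.reg 5 = modulus ℓ) (h12 : ∀ j < 2 * P.k, σ.arr 12 j < modulus ℓ) :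
    Runs b (orderP P) σ (P.k * (P.k + 4 + 2) + 4) (fun τ => τ.reg 41 ≤ P.k ∧
      ∀ ν ≤ P.k, hank ν (fun j => (σ.arr 12 j : ZMod (modulus ℓ))) ≠ 0 →
        (∀ μ ≤ P.k, ν < μ → hank μ (fun j => (σ.arr 12 j : ZMod (modulus ℓ))) = 0) →
        τ.reg 41 = ν) := by
  have k_le := S.k_le
  have bk : ∀ v, v ≤ P.k → v < 2 ^ b := fun v hv => S.lt_of_lin (by omega)
  refine .cons_assign P.k (by simp) (bk _ le_rfl) ?_
  refine .cons_for P.k (P.k + 4) (fun j τ => τ.reg 41 ≤ P.k ∧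
      ∀ ν ≤ P.k, hank ν (fun j => (σ.arr 12 j : ZMod (modulus ℓ))) ≠ 0 →
        (∀ μ ≤ P.k, ν < μ → hank μ (fun j => (σ.arr 12 j : ZMod (modulus ℓ))) = 0) →
        -- Either the search has stopped at `ν`, or it has decreased in each of the `j` rounds.
        ν ≤ τ.reg 41 ∧ (τ.reg 41 = ν ∨ τ.reg 41 = P.k - j)) (by simp) (bk _ le_rfl)
    (fun τ hf => by simp) (by simp +contextual) ?_ ?_ (by omega)
  · rintro j τ hj hr hf ⟨i1, i2⟩
    have f12 : τ.arr 12 = σ.arr 12 := by simp [hf.arr 12]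
    refine .cons (c₁ := P.k + 1) (.detP (ℓ := ℓ) P.k (by simp [hf.reg 5, h5])
      (fun j hj => by rw [f12]; exact h12 j (by omega)) i1) ?_ (by omega)
    intro τ' hf' h'
    rw [f12] at h'
    have g41 : τ'.reg 41 = τ.reg 41 := hf'.reg 41 (by simp)
    refine .cons (c₁ := 2) (.ite' (fun he => ?_) (fun he => ?_) (by omega))
      (fun τ _ h => .nil h (by omega)) (by omega)
    · rw [Expr.eval_eq_ne_zero] at he
      have h0 := h'.1 (by simpa using he)
      refine .assign (τ.reg 41 - 1) (by simp [g41]) (bk _ (by omega)) ⟨by simp; omega, ?_⟩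
      intro ν h1 h2 h3
      obtain ⟨h4, h5⟩ := i2 ν h1 h2 h3
      have hne : τ.reg 41 ≠ ν := fun h => h2 (h ▸ h0)
      simp only [State.setReg_reg_ne _ _ (show 41 ≠ 43 by norm_num), State.setReg_reg_self]
      omega
    · have h0 : τ'.reg 42 ≠ 0 := fun h => Expr.eval_eq_ne_zero.2 (by simpa using h) he
      refine .nop ⟨by simpa [g41] using i1, fun ν h1 h2 h3 => ?_⟩
      obtain ⟨h4, h5⟩ := i2 ν h1 h2 h3
      have : τ.reg 41 = ν := by
        by_contra hne
        exact h0 (h'.2 (h3 _ i1 (by omega)))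
      simp [g41, this]
  · rintro τ hf ⟨i1, i2⟩
    refine .nil ⟨i1, fun ν h1 h2 h3 => ?_⟩ (by omega)
    have := i2 ν h1 h2 h3
    omega

/-- Copy the hash values to array `19` and put the positions of at most `k` errors into array `18`
and their number into register `45`. -/
def locateP (P : Par) : Prog := block [
  .assign 45 0,
  forP 46 (.reg 27 + 1) (block [
    .store 19 (.reg 46) (.get 9 (.reg 46)),
    forP 40 (.lit (2 * P.k - 1)) (.store 12 (.reg 40)
      ((.get 11 (.reg 40 + 1) + (.reg 5 - .reg 46) * .get 11 (.reg 40)) % .reg 5)),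
    detP P.k,
    .ite ((Expr.reg 42).eq 0) (.ite ((Expr.reg 45).lt (.lit P.k))
      (block [.store 18 (.reg 45) (.reg 46), .assign 45 (.reg 45 + 1)]) .nop) .nop])]

@[simp] theorem locateP_wr (P : Par) (i : ℕ) :
    (locateP P).wr i = (i == 40 || i == 42 || i == 45 || i == 46) := by
  simp only [locateP, block, Prog.wr, forP_wr, detP_wr]; grind
@[simp] theorem locateP_wa (P : Par) (i : ℕ) :
    (locateP P).wa i = (i == 12 || i == 18 || i == 19) := by
  simp only [locateP, block, Prog.wa, forP_wa, detP_wa]; grind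

/-- The guard keeps at most `k` positions even for a spoilt pattern, which limits the time of the
subsequent search. For a good pattern it never rejects anything, as the set `B` of errors has at
most `k` members. -/
theorem Runs.locateP {P : Par} {ℓ n b : ℕ} {σ : State} (S : Sizes P ℓ n b)
    (h5 : σ.reg 5 = modulus ℓ)
    (h41 : σ.reg 41 ≤ P.k) (h27 : σ.reg 27 < 2 ^ ℓ) :
    Runs b (locateP P) σ
      ((σ.reg 27 + 1) * ((2 * P.k - 1) * (1 + 2) + P.k + 14 + 2) + 4) (fun τ => τ.reg 45 ≤ P.k ∧
        (∀ e < τ.reg 45, τ.arr 18 e < σ.reg 27 + 1) ∧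
        (∀ r < σ.reg 27 + 1, τ.arr 19 r = σ.arr 9 r) ∧
        ∀ B : Finset ℕ, B ⊆ Finset.range (σ.reg 27 + 1) → B.card ≤ P.k →
          (∀ r < σ.reg 27 + 1, hank (σ.reg 41)
            (fun j => (σ.arr 11 (j + 1) : ZMod (modulus ℓ)) - r * σ.arr 11 j) = 0 ↔ r ∈ B) →
          (∀ e < τ.reg 45, τ.arr 18 e ∈ B) ∧ ∀ r ∈ B, ∃ e < τ.reg 45, τ.arr 18 e = r) := by
  obtain ⟨hqp, hq1, hq2⟩ := modulus_spec ℓ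
  have k_le := S.k_le
  set R := σ.reg 27 + 1 with hR
  have lin : ∀ v, v ≤ 16 * 2 ^ ℓ → v < 2 ^ b := fun v hv => S.lt_of_lin hv
  refine .of_bdd fun hbd => ?_
  refine .cons_assign 0 (by simp) (lin _ (by omega)) ?_
  refine .cons_for R ((2 * P.k - 1) * (1 + 2) + P.k + 14) (fun J τ => τ.reg 45 ≤ P.k ∧
        (∀ e < τ.reg 45, τ.arr 18 e < J) ∧ (∀ r < J, τ.arr 19 r = σ.arr 9 r) ∧
        ∀ B : Finset ℕ, B ⊆ Finset.range R → B.card ≤ P.k →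
          (∀ r < R, hank (σ.reg 41)
            (fun j => (σ.arr 11 (j + 1) : ZMod (modulus ℓ)) - r * σ.arr 11 j) = 0 ↔ r ∈ B) →
          τ.reg 45 = (B.filter (· < J)).card ∧
          (∀ e < τ.reg 45, τ.arr 18 e ∈ B) ∧ ∀ r ∈ B, r < J → ∃ e < τ.reg 45, τ.arr 18 e = r)
    (by simp) (lin _ (by omega)) (fun τ hf => by simp [hf.reg 27, hR]) (by simp) ?_ ?_ (by omega)
  · rintro J τ hJ hr hf ⟨i1, i2, i3, i4⟩
    have f9 : τ.arr 9 = σ.arr 9 := by simp [hf.arr 9]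
    refine .cons_store J (σ.arr 9 J) (by simp [hr]) (by simp [hr, f9]) (hbd.2 9 J) ?_
    refine .cons_for (2 * P.k - 1) 1 (fun j' τ' => ∀ j < j', τ'.arr 12 j < modulus ℓ ∧
        (τ'.arr 12 j : ZMod (modulus ℓ)) = (σ.arr 11 (j + 1) : ZMod (modulus ℓ)) - J * σ.arr 11 j)
      (by simp) (lin _ (by omega)) (fun τ hf => by simp) (by simp) ?_ ?_ (by omega)
    · intro j τ' hj hr' hf' i
      set v := (σ.arr 11 (j + 1) + (modulus ℓ - J) * σ.arr 11 j) % modulus ℓ with hv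
      have hvlt : v < modulus ℓ := Nat.mod_lt _ hqp.pos
      refine .store j v (by simp [hr']) ?_ (lin _ (by omega)) fun j1 hj1 => ?_
      · simp [hf'.reg 5, hf'.reg 46, hf'.arr 11, hf.reg 5, hf.arr 11, hr, hr', h5, hv]
      · by_cases h : j1 = j
        · subst h
          simp only [State.setReg_arr, State.setArr_arr_self, Function.update_self]
          refine ⟨hvlt, ?_⟩
          rw [hv, ZMod.natCast_mod, Nat.cast_add, Nat.cast_mul, Nat.cast_sub (by omega)]
          simp; ring
        · simpa [h] using i j1 (by omega)
    intro τ1 f1 e1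
    have g41 : τ1.reg 41 = σ.reg 41 := by simp [f1.reg 41, hf.reg 41]
    refine .cons (c₁ := P.k + 1) (.detP (ℓ := ℓ) P.k (by simp [f1.reg 5, hf.reg 5, h5])
      (fun j hj => (e1 j (by omega)).1) (by omega)) ?_ (by omega)
    intro τ2 f2 e2
    rw [g41, hank_congr (T := fun j => (σ.arr 11 (j + 1) : ZMod (modulus ℓ)) - J * σ.arr 11 j)
      fun j hj => (e1 j (by omega)).2] at e2
    have k45 : τ2.reg 45 = τ.reg 45 := by simp [f2.reg 45, f1.reg 45]
    have k46 : τ2.reg 46 = J := by simp [f2.reg 46, f1.reg 46, hr]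
    have k18 : τ2.arr 18 = τ.arr 18 := by simp [f2.arr 18, f1.arr 18]
    have k19 : τ2.arr 19 = Function.update (τ.arr 19) J (σ.arr 9 J) := by
      simp [f2.arr 19, f1.arr 19]
    have h19 : ∀ r < J + 1, τ2.arr 19 r = σ.arr 9 r := fun r hr => by
      rw [k19]
      by_cases h : r = J
      · subst h; simp
      · rw [Function.update_of_ne h, i3 r (by omega)]
    have hfil : ∀ B : Finset ℕ, (B.filter (· < J + 1)).card =
        (B.filter (· < J)).card + if J ∈ B then 1 else 0 := fun B => by
      split_ifs with h
      · have : B.filter (· < J + 1) = insert J (B.filter (· < J)) := by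
          ext r; simp only [Finset.mem_filter, Finset.mem_insert]
          constructor
          · rintro ⟨h1, h2⟩; by_cases h3 : r = J
            · exact .inl h3
            · exact .inr ⟨h1, by omega⟩
          · rintro (rfl | ⟨h1, h2⟩)
            · exact ⟨h, by omega⟩
            · exact ⟨h1, by omega⟩
        rw [this, Finset.card_insert_of_notMem (by simp)]
      · have : B.filter (· < J + 1) = B.filter (· < J) := by
          ext r; simp only [Finset.mem_filter]
          constructor
          · rintro ⟨h1, h2⟩
            have : r ≠ J := by rintro rfl; exact h h1
            exact ⟨h1, by omega⟩
          · rintro ⟨h1, h2⟩; exact ⟨h1, by omega⟩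
        rw [this]; rfl
    refine .cons (c₁ := 6) (.ite' (fun he => ?_) (fun he => ?_) (by omega))
      (fun τ _ h => .nil h (by omega)) (by omega)
    · rw [Expr.eval_eq_ne_zero] at he
      have h0 := e2.1 (by simpa using he)
      refine .ite' (fun hlt => ?_) (fun hlt => ?_) (by omega)
      · rw [Expr.eval_lt_ne_zero] at hlt
        have hlt' : τ.reg 45 < P.k := by simpa [k45] using hlt
        refine .cons_store (τ.reg 45) J (by simp [k45]) (by simp [k46]) (lin _ (by omega)) ?_
        refine .cons_assign (τ.reg 45 + 1) (by simp [k45]) (lin _ (by omega)) (.nil ?_)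
        simp only [State.setReg_arr, State.setArr_arr_self,
          State.setReg_reg_ne _ _ (show 45 ≠ 46 by norm_num), State.setReg_reg_self,
          State.setArr_arr_ne _ _ _ (show 19 ≠ 18 by norm_num), k18]
        refine ⟨hlt', fun e he => ?_, h19, fun B hB1 hB2 hB3 => ?_⟩
        · by_cases h : e = τ.reg 45
          · subst h; simp
          · rw [Function.update_of_ne h]; have := i2 e (by omega); omega
        · obtain ⟨b1, b2, b3⟩ := i4 B hB1 hB2 hB3
          have hJB := (hB3 J hJ).1 h0
          refine ⟨by rw [hfil, if_pos hJB, b1], fun e he => ?_, fun r hrB hrJ => ?_⟩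
          · by_cases h : e = τ.reg 45
            · subst h; simpa using hJB
            · rw [Function.update_of_ne h]; exact b2 e (by omega)
          · by_cases h : r = J
            · exact ⟨τ.reg 45, by omega, by simp [h]⟩
            · obtain ⟨e, he1, he2⟩ := b3 r hrB (by omega)
              exact ⟨e, by omega, by rw [Function.update_of_ne (by omega)]; exact he2⟩
      · have hge : ¬ τ.reg 45 < P.k := fun h =>
          Expr.eval_lt_ne_zero.2 (by simpa [k45] using h) hlt
        refine (Runs.nop ?_).mono (by omega)
        simp only [State.setReg_arr, State.setReg_reg_ne _ _ (show 45 ≠ 46 by norm_num), k18, k45]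
        refine ⟨i1, fun e he => (i2 e he).trans (by omega), h19, fun B hB1 hB2 hB3 => ?_⟩
        -- A rejected error would be at least the `(k + 1)`-st member of `B`.
        obtain ⟨b1, b2, b3⟩ := i4 B hB1 hB2 hB3
        have hJB := (hB3 J hJ).1 h0
        have h1 := hfil B
        rw [if_pos hJB] at h1
        have := Finset.card_filter_le B (· < J + 1)
        omega
    · have h0 : ¬ _ := fun h => Expr.eval_eq_ne_zero.2 (by simpa using e2.2 h) he
      refine (Runs.nop ?_).mono (by omega)
      simp only [State.setReg_arr, State.setReg_reg_ne _ _ (show 45 ≠ 46 by norm_num), k18, k45]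
      refine ⟨i1, fun e he => (i2 e he).trans (by omega), h19, fun B hB1 hB2 hB3 => ?_⟩
      obtain ⟨b1, b2, b3⟩ := i4 B hB1 hB2 hB3
      have hJB : J ∉ B := fun h => h0 ((hB3 J hJ).2 h)
      refine ⟨by rw [hfil, if_neg hJB, b1, Nat.add_zero], b2, fun r hrB hrJ => ?_⟩
      refine b3 r hrB ?_
      have : r ≠ J := by rintro rfl; exact hJB hrB
      omega
  · rintro τ hf ⟨i1, i2, i3, i4⟩
    refine .nil ⟨i1, i2, i3, fun B hB1 hB2 hB3 => ?_⟩ (by omega)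
    obtain ⟨b1, b2, b3⟩ := i4 B hB1 hB2 hB3
    exact ⟨b2, fun r hr => b3 r hr (Finset.mem_range.1 (hB1 hr))⟩

/-- Find the correct values at the positions in array `18` by exhaustive search and put them into
array `19`. -/
def searchP (P : Par) : Prog :=
  forP 46 (.reg 45) (block [
    .assign 47 (.get 18 (.reg 46)),
    forP 49 (.reg 5) (block [
      .assign 43 ((.reg 49 + .reg 5 - .get 9 (.reg 47)) % .reg 5),
      .assign 44 1,
      forP 40 (.lit (2 * P.k)) (block [
        .store 12 (.reg 40) ((.get 11 (.reg 40) + (.reg 5 - .reg 43) * .reg 44) % .reg 5),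
        .assign 44 ((.reg 44 * .reg 47) % .reg 5)]),
      detP P.k,
      .ite ((Expr.reg 42).eq 0) (.store 19 (.reg 47) (.reg 49)) .nop])])

@[simp] theorem searchP_wr (P : Par) (i : ℕ) : (searchP P).wr i =
    (i == 40 || i == 42 || i == 43 || i == 44 || i == 46 || i == 47 || i == 49) := by
  simp only [searchP, block, Prog.wr, forP_wr, detP_wr]; grind
@[simp] theorem searchP_wa (P : Par) (i : ℕ) : (searchP P).wa i = (i == 12 || i == 19) := by
  simp only [searchP, block, Prog.wa, forP_wa, detP_wa]; grind

/-- Trying all residues at each of at most `k` positions costs `O(q) = O(n)` determinants of bounded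
order, which replaces solving for the error values. -/
theorem Runs.searchP {P : Par} {ℓ n b : ℕ} {σ : State} (S : Sizes P ℓ n b)
    (h5 : σ.reg 5 = modulus ℓ) (h41 : σ.reg 41 ≤ P.k) :
    Runs b (searchP P) σ
      (σ.reg 45 * ((modulus ℓ * (2 * P.k * (3 + 2) + P.k + 12 + 2) + 4) + 2) + 2) (fun τ =>
        ∀ a : ℕ → ℕ, (∀ e < σ.reg 45, σ.arr 9 (σ.arr 18 e) < modulus ℓ ∧
            a (σ.arr 18 e) < modulus ℓ ∧ ∀ c < modulus ℓ,
            (hank (σ.reg 41) (fun j => (σ.arr 11 j : ZMod (modulus ℓ)) -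
              ((c : ZMod (modulus ℓ)) - (σ.arr 9 (σ.arr 18 e) : ZMod (modulus ℓ))) *
                (σ.arr 18 e : ZMod (modulus ℓ)) ^ j) = 0 ↔
              c = a (σ.arr 18 e))) →
          (∀ e < σ.reg 45, τ.arr 19 (σ.arr 18 e) = a (σ.arr 18 e)) ∧
          ∀ r, (∀ e < σ.reg 45, σ.arr 18 e ≠ r) → τ.arr 19 r = σ.arr 19 r) := by
  obtain ⟨hqp, hq1, hq2⟩ := modulus_spec ℓ
  have hq0 := hqp.one_lt
  have k_le := S.k_le
  set V := σ.arr 9 with hV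
  have lin : ∀ v, v ≤ 16 * 2 ^ ℓ → v < 2 ^ b := fun v hv => S.lt_of_lin hv
  refine .of_bdd fun hbd => ?_
  refine .for_const (σ.reg 45) (modulus ℓ * (2 * P.k * (3 + 2) + P.k + 12 + 2) + 4) (fun E τ =>
      ∀ a : ℕ → ℕ, (∀ e < σ.reg 45, V (σ.arr 18 e) < modulus ℓ ∧
          a (σ.arr 18 e) < modulus ℓ ∧ ∀ c < modulus ℓ,
          (hank (σ.reg 41) (fun j => (σ.arr 11 j : ZMod (modulus ℓ)) -
            ((c : ZMod (modulus ℓ)) - V (σ.arr 18 e)) * (σ.arr 18 e : ZMod (modulus ℓ)) ^ j) = 0 ↔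
            c = a (σ.arr 18 e))) →
        (∀ e < E, τ.arr 19 (σ.arr 18 e) = a (σ.arr 18 e)) ∧
        ∀ r, (∀ e < E, σ.arr 18 e ≠ r) → τ.arr 19 r = σ.arr 19 r)
    (by simp) (hbd.1 45) (fun τ hf => by simp [hf.reg 45]) (by simp) ?_ (fun τ _ _ h => h)
  intro E τ hE hr hf inv
  set r := σ.arr 18 E with hrdef
  refine .cons_assign r (by simp [hr, hf.arr 18, hrdef]) (hbd.2 _ _) ?_
  -- Only the correct candidate passes the test, so its value is written once and is not overwritten
  -- later.
  refine .cons_for (modulus ℓ) (2 * P.k * (3 + 2) + P.k + 12) (fun c τ' =>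
      ∀ a : ℕ → ℕ, V r < modulus ℓ → a r < modulus ℓ → (∀ c < modulus ℓ,
          (hank (σ.reg 41) (fun j => (σ.arr 11 j : ZMod (modulus ℓ)) -
            ((c : ZMod (modulus ℓ)) - V r) * (r : ZMod (modulus ℓ)) ^ j) = 0 ↔ c = a r)) →
        (a r < c → τ'.arr 19 r = a r) ∧ ∀ r' ≠ r, τ'.arr 19 r' = τ.arr 19 r')
    (by simp) (lin _ (by omega)) (fun τ' hf' => by simp [hf'.reg 5, hf.reg 5, h5])
    (by simp) ?_ ?_
  · intro c τ' hc hr' hf' inv'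
    have k47 : τ'.reg 47 = r := by simp [hf'.reg 47]
    have k5 : τ'.reg 5 = modulus ℓ := by simp [hf'.reg 5, hf.reg 5, h5]
    have k9 : τ'.arr 9 = V := by simp [hf'.arr 9, hf.arr 9, hV]
    have k41 : τ'.reg 41 = σ.reg 41 := by simp [hf'.reg 41, hf.reg 41]
    have k11 : τ'.arr 11 = σ.arr 11 := by simp [hf'.arr 11, hf.arr 11]
    set f := (c + modulus ℓ - V r) % modulus ℓ with hfdef
    have hflt : f < modulus ℓ := Nat.mod_lt _ hqp.pos
    refine .cons_assign f (by simp [hr', k5, k9, k47, hfdef]) (lin _ (by omega)) ?_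
    refine .cons_assign 1 (by simp) (lin _ (by omega)) ?_
    refine .cons_for (2 * P.k) 3 (fun J υ => υ.reg 44 = r ^ J % modulus ℓ ∧
        ∀ j < J, υ.arr 12 j < modulus ℓ ∧ (υ.arr 12 j : ZMod (modulus ℓ)) =
          (σ.arr 11 j : ZMod (modulus ℓ)) - f * (r : ZMod (modulus ℓ)) ^ j)
      (by simp) (lin _ (by omega)) (fun υ hf => by simp) (by simp [Nat.mod_eq_of_lt hq0]) ?_ ?_
    · rintro J υ hJ hrJ hfJ ⟨i1, i2⟩
      set v := (σ.arr 11 J + (modulus ℓ - f) * (r ^ J % modulus ℓ)) % modulus ℓ with hv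
      have hvlt : v < modulus ℓ := Nat.mod_lt _ hqp.pos
      have m5 : υ.reg 5 = modulus ℓ := by simp [hfJ.reg 5, k5]
      have m43 : υ.reg 43 = f := by simp [hfJ.reg 43]
      have m47 : υ.reg 47 = r := by simp [hfJ.reg 47, k47]
      have m11 : υ.arr 11 = σ.arr 11 := by simp [hfJ.arr 11, k11]
      refine .cons_store J v (by simp [hrJ]) (by simp [m5, m43, m11, hrJ, i1, hv])
        (lin _ (by omega)) ?_
      have := Nat.mod_lt (r ^ (J + 1)) hqp.pos
      refine .cons_assign (r ^ (J + 1) % modulus ℓ) (by simp [i1, m47, m5, pow_succ, Nat.mul_mod])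
        (lin _ (by omega)) (.nil ⟨by simp, fun j hj => ?_⟩)
      by_cases h : j = J
      · subst h
        simp only [State.setReg_arr, State.setArr_arr_self, Function.update_self]
        refine ⟨hvlt, ?_⟩
        rw [hv, ZMod.natCast_mod, Nat.cast_add, Nat.cast_mul, Nat.cast_sub (by omega),
          ZMod.natCast_mod]
        simp; ring
      · simpa [h] using i2 j (by omega)
    rintro τ1 f1 ⟨-, e1⟩
    refine .cons (c₁ := P.k + 1) (.detP (ℓ := ℓ) P.k (by simp [f1.reg 5, k5])
      (fun j hj => (e1 j (by omega)).1) (by simpa [f1.reg 41, k41] using h41)) ?_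
    intro τ2 f2 e2
    have g41 : τ1.reg 41 = σ.reg 41 := by simp [f1.reg 41, k41]
    rw [g41, hank_congr (T := fun j => (σ.arr 11 j : ZMod (modulus ℓ)) - f * (r : ZMod (modulus ℓ)) ^ j)
      fun j hj => (e1 j (by omega)).2] at e2
    have m47 : τ2.reg 47 = r := by simp [f2.reg 47, f1.reg 47, k47]
    have m49 : τ2.reg 49 = c := by simp [f2.reg 49, f1.reg 49, hr']
    have m19 : τ2.arr 19 = τ'.arr 19 := by simp [f2.arr 19, f1.arr 19]
    have key : ∀ a : ℕ → ℕ, V r < modulus ℓ → (∀ c < modulus ℓ,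
          (hank (σ.reg 41) (fun j => (σ.arr 11 j : ZMod (modulus ℓ)) -
            ((c : ZMod (modulus ℓ)) - V r) * (r : ZMod (modulus ℓ)) ^ j) = 0 ↔ c = a r)) → (τ2.reg 42 = 0 ↔ c = a r) :=
      fun a h1 h2 => by
        have : (f : ZMod (modulus ℓ)) = (c : ZMod (modulus ℓ)) - V r := by
          rw [hfdef, ZMod.natCast_mod, Nat.cast_sub (by omega)]; simp
        rw [e2, this, h2 c hc]
    refine .cons (c₁ := 2) (.ite' (fun he => ?_) (fun he => ?_))
      (fun τ _ h => .nil h)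
    · rw [Expr.eval_eq_ne_zero] at he
      refine .store r c (by simp [m47]) (by simp [m49]) (lin _ (by omega)) ?_
      simp only [State.setReg_arr, State.setArr_arr_self, m19]
      refine fun a h1 h2 h3 => ⟨fun hac => ?_, fun r' hr' => ?_⟩
      · have := (key a h1 h3).1 (by simpa using he)
        simp [this]
      · rw [Function.update_of_ne hr']; exact (inv' a h1 h2 h3).2 r' hr'
    · refine .nop ?_
      simp only [State.setReg_arr, m19]
      refine fun a h1 h2 h3 => ⟨fun hac => ?_, (inv' a h1 h2 h3).2⟩
      have : c ≠ a r := fun h => Expr.eval_eq_ne_zero.2 (by simpa using (key a h1 h3).2 h) he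
      exact (inv' a h1 h2 h3).1 (by omega)
  · intro τ' hf' inv'
    refine .nil fun a ha => ?_
    obtain ⟨h1, h2, h3⟩ := ha E hE
    obtain ⟨u1, u2⟩ := inv' a h1 h2 h3
    obtain ⟨v1, v2⟩ := inv a ha
    simp only [State.setReg_arr]
    refine ⟨fun e he => ?_, fun r' hr' => ?_⟩
    -- Earlier entries of the list may name the same position; they expect the same value.
    · by_cases h : σ.arr 18 e = r
      · rw [h]; exact u1 h2
      · rw [u2 _ h]
        refine v1 e ?_
        have : e ≠ E := by rintro rfl; exact h rfl
        omega
    · rw [u2 r' (hr' E (by omega)).symm]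
      exact v2 r' fun e he => hr' e (by omega)

/-! ### Rebuilding the string from one pattern -/

/-- Rebuild the string from the hash values in array `19` and the received pieces; the result is
written to array `13`. -/
def rebuildP (P : Par) : Prog := block [
  .assign 50 0,
  forP 51 (.reg 27 + 1) (block [
    .assign 52 (.get 19 (.reg 51) / .reg 8),
    forP 53 (.reg 9) (block [
      .assign 10 (.get 8 (.reg 51) + .reg 53 * .lit P.L),
      .assign 11 (.get 8 (.reg 51 + 1)),
      .assign 12 (.lit (P.L - P.k)),
      readWin 0,
      .assign 20 (.reg 50 + .reg 53 * .lit P.L),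
      .assign 21 (.lit P.L),
      .assign 22 (.get 17 (.reg 13 * .lit P.c + .reg 52 % .lit P.c)),
      writeBits 13,
      .assign 52 (.reg 52 / .lit P.c)]),
    .assign 50 (.reg 50 + .get 19 (.reg 51) % .reg 8)])]

@[simp] theorem rebuildP_wr (P : Par) (i : ℕ) : (rebuildP P).wr i =
    (i == 10 || i == 11 || i == 12 || i == 13 || i == 14 || i == 15 || i == 20 || i == 21 ||
      i == 22 || i == 23 || i == 50 || i == 51 || i == 52 || i == 53) := by
  simp only [rebuildP, block, Prog.wr, forP_wr, readWin_wr, writeBits_wr]; grind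
@[simp] theorem rebuildP_wa (P : Par) (i : ℕ) : (rebuildP P).wa i = (i == 13) := by
  simp only [rebuildP, block, Prog.wa, forP_wa, readWin_wa, writeBits_wa]; grind

/-- Blocks are always written with full width `L`, so a piece may spill over its end; the next piece
starts at the true boundary and overwrites the surplus. Hence the invariants speak only of bits
before the end of the current piece. -/
theorem Runs.rebuildP {P : Par} {ℓ n b p : ℕ} {σ : State} (S : Sizes P ℓ n b) (hc : Ctx P ℓ n σ)
    (h0 : ∀ i, σ.arr 0 i ≤ 1) (h13 : ∀ i, σ.arr 13 i ≤ 1)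
    (h17 : ∀ z < 2 ^ (P.L - P.k), ∀ u < P.c, σ.arr 17 (z * P.c + u) = P.decA (z * P.c + u))
    (h27 : σ.reg 27 = cnt P (σ.arr 0) (n - P.k) p)
    (h8 : ∀ r ≤ cnt P (σ.arr 0) (n - P.k) p + 1, σ.arr 8 r = bd P (σ.arr 0) (n - P.k) p r) :
    Runs b (rebuildP P) σ
      ((n + 1) * (P.nb ℓ * (8 * P.L + 16 + 2) + 6 + 2) + 4) (fun τ =>
        (∀ i, τ.arr 13 i ≤ 1) ∧ ∀ x S a, (∀ i, x i ≤ 1) → Good P ℓ n p (σ.arr 0) x S a →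
          (∀ r < cnt P (σ.arr 0) (n - P.k) p + 1, σ.arr 19 r = a r) →
          ∀ i < n, τ.arr 13 i = x i) := by
  set w := σ.arr 0 with hw
  set C := cnt P w (n - P.k) p with hC
  have hCn : C ≤ n := (Nat.count_le _).trans (Nat.sub_le _ _)
  have hn := S.n_lt
  have lin : ∀ v, v ≤ 16 * 2 ^ ℓ → v < 2 ^ b := fun v hv => S.lt_of_lin hv
  have hLpos := P.L_pos
  have hL := S.L_le
  have hb := S.le_b
  have hlb : ℓ < 2 ^ ℓ := Nat.lt_two_pow_self
  have hD := S.D_le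
  have hbdlt : ∀ r, bd P w (n - P.k) p r < 2 ^ ℓ := fun r =>
    (st_le_len r).trans_lt (by omega)
  have hnbL := S.nb_le
  have hnb : P.nb ℓ ≤ 2 ^ ℓ := (Nat.le_mul_of_pos_right _ hLpos).trans hnbL
  have hDpos : 0 < P.D ℓ := by have := S.d_pos; simp only [Par.D]; omega
  refine .of_bdd fun hbd => ?_
  refine .cons_assign 0 (by simp) (lin _ (by omega)) ?_
  have hcost := Nat.mul_le_mul_right (P.nb ℓ * (8 * P.L + 16 + 2) + 6 + 2) (Nat.succ_le_succ hCn)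
  refine .cons_for (C + 1) (P.nb ℓ * (8 * P.L + 16 + 2) + 6) (fun R τ =>
      -- The bounds on the write position and on the cells hold for spoilt patterns too; no value
      -- may exceed `b` bits there either.
      τ.reg 50 ≤ R * P.D ℓ ∧ (∀ i, τ.arr 13 i ≤ 1) ∧ ∀ x S a, (∀ i, x i ≤ 1) → Good P ℓ n p w x S a →
          (∀ r < C + 1, σ.arr 19 r = a r) → τ.reg 50 = S R ∧ ∀ i < S R, τ.arr 13 i = x i)
    (by simp) (lin _ (by omega)) (fun τ hf => by simp [hf.reg 27, h27]) ?_ ?_ ?_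
    (by simp only [Nat.succ_eq_add_one] at hcost; omega)
  · refine ⟨by simp, h13, fun x S a hx hG h19 => ⟨by simp [hG.S_zero], by simp [hG.S_zero]⟩⟩
  · rintro R τ hR hr hf ⟨i1, i2, i3⟩
    have hcτ : Ctx P ℓ n τ := by
      have := hc.frame (p := .assign 50 0) (τ := σ.setReg 50 0)
        ⟨fun i hi => by simp at hi; simp [hi], fun i _ => rfl⟩ (by simp [Prog.keeps])
      exact this.frame hf (by simp [Prog.keeps])
    have f8 : τ.arr 8 = σ.arr 8 := by simp [hf.arr 8]
    have f19 : τ.arr 19 = σ.arr 19 := by simp [hf.arr 19]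
    have hRD : R * P.D ℓ ≤ 2 ^ ℓ * 2 ^ ℓ := Nat.mul_le_mul (by omega) hD
    have h50 : τ.reg 50 + 2 * 2 ^ ℓ < 2 ^ b := S.lt_of_le_mul (a := 2 ^ ℓ * 2 ^ ℓ) (c := 4)
      (by have := S.four_le; nlinarith) le_rfl (by have := S.four_le; nlinarith)
    refine .cons_assign (σ.arr 19 R / P.D ℓ) (by simp [hr, hcτ.r8, f19])
      ((Nat.div_le_self _ _).trans_lt (hbd.2 _ _)) ?_
    refine .cons_for (P.nb ℓ) (8 * P.L + 16) (fun B υ => υ.reg 52 = σ.arr 19 R / P.D ℓ / P.c ^ B ∧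
        (∀ i, υ.arr 13 i ≤ 1) ∧ ∀ x S a, (∀ i, x i ≤ 1) → Good P ℓ n p w x S a → (∀ r < C + 1, σ.arr 19 r = a r) →
          (∀ i < S R, υ.arr 13 i = x i) ∧
          ∀ i, S R ≤ i → i < S R + B * P.L → i < S (R + 1) → υ.arr 13 i = x i)
      (by simp) (lin _ (by omega)) (fun υ hfυ => by simp [hfυ.reg 9, hcτ.r9]) ?_ ?_ ?_
    · refine ⟨by simp, i2, fun x S a hx hG h19 => ⟨(i3 x S a hx hG h19).2, fun i _ _ _ => by omega⟩⟩
    · rintro B υ hB hBr hfυ ⟨j1, j2, j3⟩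
      have g51 : υ.reg 51 = R := by simp [hfυ.reg 51, hr]
      have g50 : υ.reg 50 = τ.reg 50 := by simp [hfυ.reg 50]
      have g8 : υ.arr 8 = σ.arr 8 := by simp [hfυ.arr 8, f8]
      have g0 : υ.arr 0 = w := by simp [hfυ.arr 0, hf.arr 0, hw]
      have g17 : υ.arr 17 = σ.arr 17 := by simp [hfυ.arr 17, hf.arr 17]
      have hBL : B * P.L + P.L ≤ 2 ^ ℓ := by
        rw [← Nat.succ_mul]; exact (Nat.mul_le_mul_right _ hB).trans hnbL
      have q1 := hbdlt R
      have q2 := hbdlt (R + 1)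
      refine .of_bdd fun hbdυ => ?_
      refine .cons_assign (bd P w (n - P.k) p R + B * P.L)
        (by simp [g51, g8, hBr, h8 R (by omega)]) (lin _ (by omega)) ?_
      refine .cons_assign (bd P w (n - P.k) p (R + 1)) (by simp [g51, g8, h8 (R + 1) (by omega)])
        (lin _ (by omega)) ?_
      refine .cons_assign (P.L - P.k) (by simp) (lin _ (by omega)) ?_
      refine .cons (c₁ := 3 * (P.L - P.k) + 5) ((Runs.readWin 0 (by simpa [g0] using h0)
        (by simp; omega)).mono (by simp)) ?_
      intro υ1 f1 e1
      simp only [State.setReg_reg_self, State.setReg_arr, g0,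
        State.setReg_reg_ne _ _ (show 11 ≠ 12 by norm_num),
        State.setReg_reg_ne _ _ (show 10 ≠ 12 by norm_num),
        State.setReg_reg_ne _ _ (show 10 ≠ 11 by norm_num)] at e1
      set z := win w (bd P w (n - P.k) p (R + 1)) (bd P w (n - P.k) p R + B * P.L) (P.L - P.k)
        with hz
      have hzlt : z < 2 ^ (P.L - P.k) := win_lt h0 _ _ _
      have hc0 := P.c_pos
      set u := σ.arr 19 R / P.D ℓ / P.c ^ B % P.c with hu
      have hult : u < P.c := Nat.mod_lt _ hc0
      refine .cons_assign (τ.reg 50 + B * P.L) (by simp [f1.reg 50, f1.reg 53, g50, hBr])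
        (by omega) ?_
      refine .cons_assign P.L (by simp) (lin _ (by omega)) ?_
      have hval : σ.arr 17 (z * P.c + u) = P.decA (z * P.c + u) := h17 z hzlt u hult
      refine .cons_assign (P.decA (z * P.c + u))
        (by simpa [e1, f1.arr 17, g17, f1.reg 52, j1, hu] using hval) (hval ▸ hbd.2 _ _) ?_
      refine .cons (c₁ := 5 * P.L + 2) ((Runs.writeBits 13 (by omega)).mono (by simp)) ?_
      intro υ2 f2 e2
      have k13 : υ1.arr 13 = υ.arr 13 := by simp [f1.arr 13]
      simp only [State.setReg_reg_self, State.setReg_arr, k13,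
        State.setReg_reg_ne _ _ (show 21 ≠ 22 by norm_num),
        State.setReg_reg_ne _ _ (show 20 ≠ 22 by norm_num),
        State.setReg_reg_ne _ _ (show 20 ≠ 21 by norm_num)] at e2
      have g52 : υ2.reg 52 = σ.arr 19 R / P.D ℓ / P.c ^ B := by
        simp [f2.reg 52, f1.reg 52, j1]
      refine .cons_assign (σ.arr 19 R / P.D ℓ / P.c ^ (B + 1))
        (by simp [g52, Nat.div_div_eq_div_mul, pow_succ, Nat.mul_assoc]) ?_ (.nil ?_)
      · exact (Nat.div_le_self _ _).trans_lt ((Nat.div_le_self _ _).trans_lt (hbd.2 _ _))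
      · simp only [State.setReg_arr, State.setReg_reg_self, e2,
          State.setReg_reg_ne _ _ (show 52 ≠ 53 by norm_num), true_and]
        refine ⟨putBits_le j2 _ _ _, fun x S' a hx hG h19 => ?_⟩
        obtain ⟨l1, l2⟩ := j3 x S' a hx hG h19
        have h50' := (i3 x S' a hx hG h19).1
        have hblk : P.decA (z * P.c + u) = win x (S' (R + 1)) (S' R + B * P.L) P.L := by
          rw [← hG.block R hR B hB, hu, h19 R hR]
        rw [h50', hblk]
        simp only [putBits]
        refine ⟨fun i hi => ?_, fun i hi1 hi2 hi3 => ?_⟩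
        · rw [if_neg (by omega)]; exact l1 i hi
        · by_cases h : S' R + B * P.L ≤ i
          · rw [Nat.add_mul, Nat.one_mul] at hi2
            rw [if_pos ⟨h, by omega⟩, win, dig_div_mod _ (by omega),
              show S' R + B * P.L + (i - (S' R + B * P.L)) = i by omega, if_pos hi3]
            intro i' hi'
            have := hx (S' R + B * P.L + i')
            split <;> omega
          · rw [if_neg (by omega)]; exact l2 i hi1 (by omega) hi3
    · rintro υ hfυ ⟨-, j2, j3⟩
      have g51 : υ.reg 51 = R := by simp [hfυ.reg 51, hr]
      have g50 : υ.reg 50 = τ.reg 50 := by simp [hfυ.reg 50]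
      have g19 : υ.arr 19 = σ.arr 19 := by simp [hfυ.arr 19, f19]
      have g8 : υ.reg 8 = P.D ℓ := by simp [hfυ.reg 8, hcτ.r8]
      have hmod := Nat.mod_lt (σ.arr 19 R) hDpos
      refine .cons_assign (τ.reg 50 + σ.arr 19 R % P.D ℓ) (by simp [g51, g50, g19, g8])
        (by omega) (.nil ?_)
      simp only [State.setReg_arr, State.setReg_reg_self,
        State.setReg_reg_ne _ _ (show 50 ≠ 51 by norm_num)]
      refine ⟨by rw [Nat.add_mul]; omega, j2, fun x S' a hx hG h19 => ?_⟩
      obtain ⟨l1, l2⟩ := j3 x S' a hx hG h19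
      have h50' := (i3 x S' a hx hG h19).1
      have hle := hG.S_le R hR
      have hnbS := hG.S_le_nb R hR
      have := hG.a_mod R hR
      rw [h19 R hR, this, h50']
      refine ⟨by omega, fun i hi => ?_⟩
      by_cases h : i < S' R
      · exact l1 i h
      · exact l2 i (by omega) (by omega) hi
  · rintro τ hf ⟨-, i2, i3⟩
    refine .nil ⟨i2, fun x S' a hx hG h19 i hi => ?_⟩ (by simp only [Nat.succ_eq_add_one] at hcost; omega)
    refine (i3 x S' a hx hG h19).2 i ?_
    rw [hG.S_last]; exact hi

/-- Decode by means of the pattern `reg 25`; the result is written to array `13`. -/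
def decodeP (P : Par) : Prog :=
  block [sketchP P 0 10, deltaP P, orderP P, locateP P, searchP P, rebuildP P]

@[simp] theorem decodeP_wr (P : Par) (i : ℕ) : (decodeP P).wr i =
    ((10 ≤ i && i ≤ 15) || (20 ≤ i && i ≤ 23) || i == 27 || i == 28 || i == 29 ||
      (31 ≤ i && i ≤ 35) || (40 ≤ i && i ≤ 47) || (49 ≤ i && i ≤ 53)) := by
  simp only [decodeP, block, Prog.wr, sketchP_wr, deltaP_wr, orderP_wr, locateP_wr, searchP_wr,
    rebuildP_wr]
  rw [Bool.eq_iff_iff]; simp; omega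
@[simp] theorem decodeP_wa (P : Par) (i : ℕ) : (decodeP P).wa i =
    ((8 ≤ i && i ≤ 13) || i == 18 || i == 19) := by
  simp only [decodeP, block, Prog.wa, sketchP_wa, deltaP_wa, orderP_wa, locateP_wa, searchP_wa,
    rebuildP_wa]
  rw [Bool.eq_iff_iff]; simp; omega

/-- A bound for the number of steps of `decodeP`. -/
def decodeCost (P : Par) (ℓ n : ℕ) : ℕ :=
  sketchCost P ℓ n + (2 * P.k * (3 + 2) + 2) + (P.k * (P.k + 4 + 2) + 4) +
    ((n + 1) * ((2 * P.k - 1) * (1 + 2) + P.k + 14 + 2) + 4) +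
    (P.k * ((modulus ℓ * (2 * P.k * (3 + 2) + P.k + 12 + 2) + 4) + 2) + 2) +
    ((n + 1) * (P.nb ℓ * (8 * P.L + 16 + 2) + 6 + 2) + 4) + 1

theorem sketchCost_mono (P : Par) (ℓ : ℕ) {len len' : ℕ} (h : len ≤ len') :
    sketchCost P ℓ len ≤ sketchCost P ℓ len' := by
  unfold sketchCost; gcongr

theorem Runs.decodeP {P : Par} {ℓ n b p : ℕ} {σ : State} (S : Sizes P ℓ n b) (hc : Ctx P ℓ n σ)
    (h0 : ∀ i, σ.arr 0 i ≤ 1) (h13 : ∀ i, σ.arr 13 i ≤ 1) (h3 : ∀ i < 2 ^ P.L, σ.arr 3 i = P.h i)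
    (h17 : ∀ z < 2 ^ (P.L - P.k), ∀ u < P.c, σ.arr 17 (z * P.c + u) = P.decA (z * P.c + u))
    (h24 : σ.reg 24 = n - P.k) (h25 : σ.reg 25 = p)
    (h10 : ∀ j < 2 * P.k, σ.arr 10 (σ.reg 26 + j) = 0) :
    Runs b (decodeP P) σ (decodeCost P ℓ n) (fun τ =>
      (∀ i, τ.arr 13 i ≤ 1) ∧ (∀ y, σ.reg 26 + 2 * P.k ≤ y → τ.arr 10 y = σ.arr 10 y) ∧
      ∀ x S a, (∀ i, x i ≤ 1) → Good P ℓ n p (σ.arr 0) x S a →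
        (∀ j < 2 * P.k, σ.arr 5 (σ.reg 26 + j) = synd P ℓ x n p j) →
        ∀ i < n, τ.arr 13 i = x i) := by
  have hn := S.n_lt
  obtain ⟨hqp, hq1, hq2⟩ := modulus_spec ℓ
  set w := σ.arr 0 with hw
  set C := cnt P w (n - P.k) p with hC
  have hCn : C ≤ n - P.k := Nat.count_le _
  have c1 := sketchCost_mono P ℓ (Nat.sub_le n P.k)
  refine .cons (c₁ := sketchCost P ℓ (n - P.k)) ((Runs.sketchP (a := 0) (o := 10) S hc h0 h3
    (by norm_num) (by norm_num) (by norm_num) (by norm_num) (by norm_num) (by norm_num)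
    (by omega) h10).mono (by rw [h24])) ?_ (by unfold decodeCost; omega)
  rintro τ1 f1 ⟨a1, a2, a3, a4⟩
  rw [h24, h25, ← hw] at a1 a2 a3 a4
  rw [← hC] at a1 a2 a3
  have hc1 := hc.frame f1 (by simp [Prog.keeps])
  have t26 : τ1.reg 26 = σ.reg 26 := f1.reg 26 (by simp)
  have t10 : ∀ j < 2 * P.k, τ1.arr 10 (σ.reg 26 + j) = synd P ℓ w (n - P.k) p j := fun j hj => by
    rw [a4]; simp [hj]
  refine .cons (c₁ := 2 * P.k * (3 + 2) + 2) (.deltaP S hc1.r5 fun j hj => ?_) ?_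
    (by unfold decodeCost; omega)
  · rw [t26, t10 j hj]; exact Nat.mod_lt _ hqp.pos
  rintro τ2 f2 ⟨b1, b2⟩
  have hc2 := hc1.frame f2 (by simp [Prog.keeps])
  refine .cons (c₁ := P.k * (P.k + 4 + 2) + 4) (.orderP S hc2.r5 fun j hj => ?_) ?_
    (by unfold decodeCost; omega)
  · rw [(b1 j hj).2]; exact (b1 j hj).1
  rintro τ3 f3 ⟨d1, d2⟩
  have hc3 := hc2.frame f3 (by simp [Prog.keeps])
  have k27 : τ3.reg 27 = C := by simp [f3.reg 27, f2.reg 27, a1]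
  have hcost := Nat.mul_le_mul_right ((2 * P.k - 1) * (1 + 2) + P.k + 14 + 2)
    (show C + 1 ≤ n + 1 by omega)
  refine .cons (c₁ := (n + 1) * ((2 * P.k - 1) * (1 + 2) + P.k + 14 + 2) + 4)
    ((Runs.locateP S hc3.r5 d1 (by omega)).mono (by rw [k27]; omega)) ?_
    (by unfold decodeCost; omega)
  rintro τ4 f4 ⟨e1, e2, e3, e4⟩
  rw [k27] at e2 e3 e4
  have hc4 := hc3.frame f4 (by simp [Prog.keeps])
  have k41 : τ4.reg 41 = τ3.reg 41 := f4.reg 41 (by simp)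
  have hcost' := Nat.mul_le_mul_right ((modulus ℓ * (2 * P.k * (3 + 2) + P.k + 12 + 2) + 4) + 2) e1
  refine .cons (c₁ := P.k * ((modulus ℓ * (2 * P.k * (3 + 2) + P.k + 12 + 2) + 4) + 2) + 2)
    ((Runs.searchP S hc4.r5 (by omega)).mono (by omega)) ?_ (by unfold decodeCost; omega)
  rintro τ5 f5 g1
  have hc5 := hc4.frame f5 (by simp [Prog.keeps])
  have n0 : τ5.arr 0 = w := by
    simp [f5.arr 0, f4.arr 0, f3.arr 0, f2.arr 0, f1.arr 0, hw]
  have n13 : τ5.arr 13 = σ.arr 13 := by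
    simp [f5.arr 13, f4.arr 13, f3.arr 13, f2.arr 13, f1.arr 13]
  have n17 : τ5.arr 17 = σ.arr 17 := by
    simp [f5.arr 17, f4.arr 17, f3.arr 17, f2.arr 17, f1.arr 17]
  have n27 : τ5.reg 27 = C := by simp [f5.reg 27, f4.reg 27, k27]
  have n8 : τ5.arr 8 = τ1.arr 8 := by simp [f5.arr 8, f4.arr 8, f3.arr 8, f2.arr 8]
  refine .cons (c₁ := (n + 1) * (P.nb ℓ * (8 * P.L + 16 + 2) + 6 + 2) + 4)
    (.rebuildP (p := p) S hc5 (by rw [n0]; exact h0) (by rw [n13]; exact h13)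
      (by rw [n17]; exact h17) (by rw [n27, n0]) (by rw [n0, n8]; exact a2)) ?_
    (by unfold decodeCost; omega)
  rintro τ6 f6 ⟨p1, p2⟩
  refine .nil ⟨p1, fun y hy => ?_, fun x s a hx hG hsyn => ?_⟩ (by unfold decodeCost; omega)
  · simp only [f6.arr 10 (by simp), f5.arr 10 (by simp), f4.arr 10 (by simp), f3.arr 10 (by simp),
      f2.arr 10 (by simp), a4]
    rw [if_neg (by omega)]
  · rw [n0] at p2
    have m9 : τ4.arr 9 = τ1.arr 9 := by simp [f4.arr 9, f3.arr 9, f2.arr 9]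
    have m9' : τ3.arr 9 = τ1.arr 9 := by simp [f3.arr 9, f2.arr 9]
    have m11 : τ4.arr 11 = τ2.arr 11 := by simp [f4.arr 11, f3.arr 11]
    have m11' : τ3.arr 11 = τ2.arr 11 := by simp [f3.arr 11]
    have t5 : τ1.arr 5 = σ.arr 5 := f1.arr 5 (by simp)
    -- The difference of transmitted and recomputed syndromes consists of the power sums of the
    -- errors in the hash sequence.
    have hΔ : ∀ j < 2 * P.k, (τ2.arr 11 j : ZMod (modulus ℓ)) =
        ∑ r ∈ Finset.range (C + 1), ((a r : ZMod (modulus ℓ)) - pieceV P ℓ w (n - P.k) p r) *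
          (r : ZMod (modulus ℓ)) ^ j := fun j hj => by
      rw [b2 j hj, t26, t10 j hj, t5, hsyn j hj, hG.syn j hj, ← hC]
      simp only [sub_mul, Finset.sum_sub_distrib, synd, ZMod.natCast_mod]
      push_cast
      rfl
    have hR := hG.cnt_lt
    have ha := hG.a_lt
    have hb := hG.b_lt
    have hcard := hG.card_le
    -- The positions of the errors. Their number is the order found, they are the positions located,
    -- and the search corrects just their values.
    set B := (Finset.range (C + 1)).filter fun r => a r ≠ pieceV P ℓ w (n - P.k) p r with hB
    have hnu : τ3.reg 41 = B.card := by
      refine d2 _ hcard ?_ fun μ hμ1 hμ2 => ?_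
      · rw [hank_congr (T := fun j => (τ2.arr 11 j : ZMod (modulus ℓ)))
          fun j hj => by rw [(b1 j (by omega)).2]]
        exact hank_order_ne_zero (N := 2 * P.k) hR ha hb hΔ (Nat.mul_le_mul_left 2 hcard)
      · rw [hank_congr (T := fun j => (τ2.arr 11 j : ZMod (modulus ℓ)))
          fun j hj => by rw [(b1 j (by omega)).2]]
        exact hank_order_eq_zero (N := 2 * P.k) ha hb hΔ (by omega) hμ2
    obtain ⟨l1, l2⟩ := e4 B (Finset.filter_subset _ _) hcard fun r hr => by
      rw [hnu, m11', hank_locate (N := 2 * P.k) hR ha hb hΔ rfl (Nat.mul_le_mul_left 2 hcard) hr, hB,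
        Finset.mem_filter, Finset.mem_range]
      exact ⟨fun h => ⟨hr, h⟩, fun h => h.2⟩
    obtain ⟨v1, v2⟩ := g1 a fun e he => by
      obtain ⟨hr, hne⟩ := Finset.mem_filter.1 (l1 e he)
      have hr' := Finset.mem_range.1 hr
      rw [m9, m11, k41, hnu, a3 _ hr']
      exact ⟨hb _ hr', ha _ hr', fun c hc =>
        hank_value (N := 2 * P.k) hR ha hb hΔ rfl (Nat.mul_le_mul_left 2 hcard) hr' hne hc⟩
    refine p2 x s a hx hG fun r hr => ?_
    by_cases h : r ∈ B
    · obtain ⟨e, he, rfl⟩ := l2 r h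
      exact v1 e he
    · rw [v2 r fun e he hre => h (hre ▸ l1 e he), e3 r hr, m9', a3 r hr]
      by_contra hne
      exact h (Finset.mem_filter.2 ⟨Finset.mem_range.2 hr, fun h => hne h.symm⟩)

/-! ### Applying and removing a periodic mask -/

/-- Read `reg 12` binary digits of array `a` from `reg 10` on into register `13`. -/
def readDig (a : ℕ) : Prog := block [.assign 11 (.reg 10 + .reg 12), readWin a]

@[simp] theorem readDig_wr (a i : ℕ) :
    (readDig a).wr i = (i == 11 || i == 13 || i == 14 || i == 15) := by
  simp only [readDig, block, Prog.wr, readWin_wr]; grind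
@[simp] theorem readDig_wa (a i : ℕ) : (readDig a).wa i = false := by simp [readDig]

theorem Runs.readDig {b : ℕ} {σ : State} (a : ℕ) (hX : ∀ i, σ.arr a i ≤ 1) (hw : σ.reg 12 ≤ b)
    (h : σ.reg 10 + σ.reg 12 < 2 ^ b) :
    Runs b (readDig a) σ (3 * σ.reg 12 + 7)
      (fun τ => τ.reg 13 = dig 2 (σ.arr a) (σ.reg 10) (σ.reg 12)) := by
  refine .cons_assign (σ.reg 10 + σ.reg 12) (by simp) h ?_
  refine .cons (c₁ := 3 * σ.reg 12 + 5) ((Runs.readWin a (by simpa using hX)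
    (by simpa using hw)).mono (by simp)) fun τ _ h => .nil ?_
  rw [h, win_of_le (by simp)]
  simp

theorem dig_putBits_of_disjoint (X : ℕ → ℕ) {off w v off' w' : ℕ}
    (h : off' + w' ≤ off ∨ off + w ≤ off') :
    dig 2 (putBits X off w v) off' w' = dig 2 X off' w' :=
  dig_congr fun i hi => by rw [putBits, if_neg (by omega)]

/-- Shift the segments of array `a` by array `mk` periodically; the result is put into
array `o`. -/
def maskP (P : Par) (a o mk : ℕ) : Prog := block [
  forP 54 (.reg 2) (.store o (.reg 54) (.get a (.reg 54))),
  forP 54 (.reg 16) (block [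
    .assign 10 (.reg 54 * .lit P.m),
    .assign 12 (.lit P.m),
    readDig a,
    .assign 20 (.reg 10),
    .assign 21 (.lit P.m),
    .assign 22 ((.reg 13 + .get mk (.reg 54 % .reg 6)) % .lit P.M),
    writeBits o])]

@[simp] theorem maskP_wr (P : Par) (a o mk i : ℕ) : (maskP P a o mk).wr i =
    ((10 ≤ i && i ≤ 15) || (20 ≤ i && i ≤ 23) || i == 54) := by
  simp only [maskP, block, Prog.wr, forP_wr, readDig_wr, writeBits_wr]
  rw [Bool.eq_iff_iff]; simp; omega
@[simp] theorem maskP_wa (P : Par) (a o mk i : ℕ) : (maskP P a o mk).wa i = (i == o) := by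
  simp [maskP]

theorem Par.d_mul (P : Par) (ℓ N : ℕ) : N * P.d ℓ = N * P.J ℓ * P.m := by
  rw [Par.d, Nat.mul_comm P.m, Nat.mul_assoc]

theorem Runs.maskP {P : Par} {ℓ n b a o mk : ℕ} {σ : State} (S : Sizes P ℓ n b)
    (hc : Ctx P ℓ n σ) (ha : ∀ i, σ.arr a i ≤ 1) (ho : ∀ i, σ.arr o i ≤ 1) (hao : a ≠ o)
    (hmk : mk ≠ o) :
    Runs b (maskP P a o mk) σ ((n * (1 + 2) + 2) + ((n + 1) * (8 * P.m + 16 + 2) + 2) + 1)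
      (fun τ => (∀ i, τ.arr o i ≤ 1) ∧ Shifted P ℓ n (σ.arr a) (σ.arr mk) (τ.arr o)) := by
  have hn := S.n_lt
  have hJ := S.J_pos
  have hm := S.m_le
  have hb := S.le_b
  have lin : ∀ v, v ≤ 16 * 2 ^ ℓ → v < 2 ^ b := fun v hv => S.lt_of_lin hv
  have hlb : ℓ < 2 ^ ℓ := Nat.lt_two_pow_self
  set N := n / P.d ℓ with hN
  have hNd : N * P.d ℓ ≤ n := Nat.div_mul_le_self _ _
  have hNd' := P.d_mul ℓ N
  have hNJ : N * P.J ℓ ≤ n := (Nat.le_mul_of_pos_right _ P.one_le_m).trans (hNd' ▸ hNd)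
  have hcost := Nat.mul_le_mul_right (8 * P.m + 16 + 2) (hNJ.trans (Nat.le_succ n))
  simp only [Nat.succ_eq_add_one] at hcost
  refine .cons_for n 1 (fun j τ => (∀ i, τ.arr o i ≤ 1) ∧ ∀ i < j, τ.arr o i = σ.arr a i)
    (by simp) (lin _ (by omega)) (fun τ hf => by simp [hf.reg 2, hc.r2]) (by simpa using ho) ?_ ?_
  · rintro j τ hj hr hf ⟨i1, i2⟩
    have fa : τ.arr a = σ.arr a := hf.arr a (by simp [hao])
    have haj := ha j
    refine .store j (σ.arr a j) (by simp [hr]) (by simp [hr, fa]) (lin _ (by omega)) ?_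
    simp only [State.setReg_arr, State.setArr_arr_self, Function.update_apply]
    refine ⟨fun i => by split <;> simp [i1, ha], fun i hi => ?_⟩
    split_ifs with h
    · rw [h]
    · exact i2 i (by omega)
  rintro τ0 f0 ⟨a1, a2⟩
  have hc0 := hc.frame f0 (by simp [Prog.keeps])
  have t0 : τ0.arr a = σ.arr a := f0.arr a (by simp [hao])
  have t1 : τ0.arr mk = σ.arr mk := f0.arr mk (by simp [hmk])
  refine .cons_for (N * P.J ℓ) (8 * P.m + 16) (fun g τ => (∀ i, τ.arr o i ≤ 1) ∧
      (∀ i, g * P.m ≤ i → i < n → τ.arr o i = σ.arr a i) ∧ ∀ g' < g, dig 2 (τ.arr o) (g' * P.m) P.m =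
        (dig 2 (σ.arr a) (g' * P.m) P.m + σ.arr mk (g' % P.J ℓ)) % P.M)
    (by simp) (lin _ (by omega)) (fun τ hf => by simp [hf.reg 16, hc0.r16, hN]) ?_ ?_ ?_
  · simpa using ⟨a1, a2⟩
  · rintro g τ hg hr hf ⟨i1, i2, i3⟩
    have hcτ := hc0.frame hf (by simp [Prog.keeps])
    have fa : τ.arr a = σ.arr a := by rw [hf.arr a (by simp [hao]), t0]
    have fm : τ.arr mk = σ.arr mk := by rw [hf.arr mk (by simp [hmk]), t1]
    have hgm : g * P.m + P.m ≤ n := by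
      rw [← Nat.succ_mul]; exact (Nat.mul_le_mul_right _ hg).trans (hNd' ▸ hNd)
    refine .cons_assign (g * P.m) (by simp [hr]) (lin _ (by omega)) ?_
    refine .cons_assign P.m (by simp) (lin _ (by omega)) ?_
    refine .cons (c₁ := 3 * P.m + 7) ((Runs.readDig a (by simpa [fa] using ha) (by simp; omega)
      (lin _ (by simp; omega))).mono (by simp)) ?_
    intro τ1 f1 e1
    simp only [State.setReg_reg_self, State.setReg_arr, fa,
      State.setReg_reg_ne _ _ (show 10 ≠ 12 by norm_num)] at e1
    refine .cons_assign (g * P.m) (by simp [f1.reg 10]) (lin _ (by omega)) ?_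
    refine .cons_assign P.m (by simp) (lin _ (by omega)) ?_
    set v := (dig 2 (σ.arr a) (g * P.m) P.m + σ.arr mk (g % P.J ℓ)) % P.M with hv
    have hvlt : v < P.M := Nat.mod_lt _ (by positivity)
    have hM := S.M_le
    refine .cons_assign v (by simp [e1, f1.arr mk, f1.reg 54, f1.reg 6, hr, hcτ.r6, fm, hv])
      (lin _ (by omega)) ?_
    refine .cons (c₁ := 5 * P.m + 2) ((Runs.writeBits o (by omega)).mono (by simp)) ?_
    intro τ2 f2 e2
    have k : τ1.arr o = τ.arr o := by simp [f1.arr o]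
    simp only [State.setReg_reg_self, State.setReg_arr, k,
      State.setReg_reg_ne _ _ (show 21 ≠ 22 by norm_num),
      State.setReg_reg_ne _ _ (show 20 ≠ 22 by norm_num),
      State.setReg_reg_ne _ _ (show 20 ≠ 21 by norm_num)] at e2
    refine .nil ?_
    simp only [State.setReg_arr, e2]
    refine ⟨putBits_le i1 _ _ _, fun i hi1 hi2 => ?_, fun g' hg' => ?_⟩
    · rw [Nat.add_mul, Nat.one_mul] at hi1
      rw [putBits, if_neg (by omega)]; exact i2 i (by omega) hi2
    · by_cases h : g' = g
      · subst h; exact dig_putBits _ hvlt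
      · have h1 : (g' + 1) * P.m ≤ g * P.m := Nat.mul_le_mul_right _ (by omega)
        rw [Nat.add_mul, Nat.one_mul] at h1
        rw [dig_putBits_of_disjoint _ (.inl h1)]
        exact i3 g' (by omega)
  · rintro τ hf ⟨i1, i2, i3⟩
    refine .nil ⟨i1, fun g hg => i3 g hg, fun i h1 h2 => i2 i ?_ h1⟩
    rw [← hNd']; exact h2

/-- Shifting back. -/
theorem Shifted.inverse {P : Par} {ℓ n : ℕ} {s t x u z : ℕ → ℕ} (h : Shifted P ℓ n s t x)
    (h' : Shifted P ℓ n x u z) (hs : ∀ i, s i ≤ 1) (hz : ∀ i, z i ≤ 1)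
    (hJ : 0 < P.J ℓ) (ht : ∀ j < P.J ℓ, t j < P.M) (hu : ∀ j < P.J ℓ, u j = P.M - t j) :
    ∀ i < n, z i = s i := by
  intro i hi
  by_cases hd : n / P.d ℓ * P.d ℓ ≤ i
  · rw [h'.tail i hi hd, h.tail i hi hd]
  · rw [P.d_mul] at hd
    have hm := P.one_le_m
    have hg : i / P.m < n / P.d ℓ * P.J ℓ := by rw [Nat.div_lt_iff_lt_mul hm]; omega
    have hseg := h'.seg _ hg
    have hj := Nat.mod_lt (i / P.m) hJ
    have hlt : dig 2 s (i / P.m * P.m) P.m < P.M := dig_lt fun _ _ => Nat.lt_succ_iff.2 (hs _)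
    have ht' := ht _ hj
    -- The two shifts add up to `M`, which vanishes modulo `M`.
    rw [h.seg _ hg, hu _ hj, Nat.mod_add_mod, Nat.add_assoc, Nat.add_sub_cancel' ht'.le,
      Nat.add_mod_right, Nat.mod_eq_of_lt hlt] at hseg
    have := (dig_eq_iff (fun _ _ => Nat.lt_succ_iff.2 (hz _))
      (fun _ _ => Nat.lt_succ_iff.2 (hs _))).1 hseg (i % P.m) (Nat.mod_lt _ hm)
    rwa [Nat.mul_comm, Nat.div_add_mod] at this

/-! ### A greedy mask that brings every pattern into every block -/

/-- The pairs of a block and a pattern that are not marked. -/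
def unmarked (M N : ℕ) (U : ℕ → ℕ) : Finset (ℕ × ℕ) :=
  (Finset.range N ×ˢ Finset.range M).filter fun z => U (z.1 * M + z.2) = 0

/-- The number of pairs that are marked by the shift `y`. -/
def gain (M N : ℕ) (U s : ℕ → ℕ) (y : ℕ) : ℕ :=
  ((Finset.range N).filter fun i => U (i * M + (s i + y) % M) = 0).card

theorem gain_succ (M N : ℕ) (U s : ℕ → ℕ) (y : ℕ) : gain M (N + 1) U s y =
    gain M N U s y + if U (N * M + (s N + y) % M) = 0 then 1 else 0 := by
  rw [gain, gain, Finset.card_filter, Finset.card_filter, Finset.sum_range_succ]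

theorem gain_le (M N : ℕ) (U s : ℕ → ℕ) (y : ℕ) : gain M N U s y ≤ N :=
  (Finset.card_filter_le _ _).trans (Finset.card_range N).le

/-- Adding `s` modulo `M` permutes the residues. -/
theorem sum_shift {M : ℕ} (hM : 0 < M) (s : ℕ) (f : ℕ → ℕ) :
    ∑ y ∈ Finset.range M, f ((s + y) % M) = ∑ p ∈ Finset.range M, f p := by
  have hinj : Set.InjOn (fun y => (s + y) % M) (Finset.range M : Finset ℕ) := by
    intro y hy z hz h
    simp only [Finset.coe_range, Set.mem_Iio] at hy hz
    have : y ≡ z [MOD M] := Nat.ModEq.add_left_cancel' s h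
    rwa [Nat.ModEq, Nat.mod_eq_of_lt hy, Nat.mod_eq_of_lt hz] at this
  have him : (Finset.range M).image (fun y => (s + y) % M) = Finset.range M := by
    refine Finset.eq_of_subset_of_card_le (fun p hp => ?_) ?_
    · obtain ⟨y, -, rfl⟩ := Finset.mem_image.1 hp
      exact Finset.mem_range.2 (Nat.mod_lt _ hM)
    · rw [Finset.card_image_of_injOn hinj]
  conv_rhs => rw [← him]
  rw [Finset.sum_image hinj]

/-- Double counting: for each unmarked pair exactly one shift turns the segment of the block into
the pattern. -/
theorem sum_gain {M : ℕ} (hM : 0 < M) (N : ℕ) (U s : ℕ → ℕ) :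
    ∑ y ∈ Finset.range M, gain M N U s y = (unmarked M N U).card := by
  simp only [gain, unmarked, Finset.card_filter, Finset.sum_product]
  rw [Finset.sum_comm]
  exact Finset.sum_congr rfl fun i _ =>
    sum_shift hM (s i) fun p => if U (i * M + p) = 0 then 1 else 0

/-- The best of `M` shifts is at least as good as the average, so it marks at least the fraction `1
/ M` of the unmarked pairs. -/
theorem unmarked_step {M N y : ℕ} {U U' s : ℕ → ℕ} (hM : 0 < M)
    (hbest : ∀ z < M, gain M N U s z ≤ gain M N U s y)
    (hU : ∀ i < N, ∀ p < M, U' (i * M + p) = 0 → U (i * M + p) = 0 ∧ (s i + y) % M ≠ p) :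
    M * (unmarked M N U').card ≤ (M - 1) * (unmarked M N U).card := by
  have h1 : (unmarked M N U).card ≤ M * gain M N U s y := by
    rw [← sum_gain hM N U s]
    refine (Finset.sum_le_card_nsmul _ _ _ fun z hz => hbest z (Finset.mem_range.1 hz)).trans ?_
    simp
  have h2 : (unmarked M N U').card + gain M N U s y ≤ (unmarked M N U).card := by
    have hinj : Set.InjOn (fun i => (i, (s i + y) % M))
        ((Finset.range N).filter fun i => U (i * M + (s i + y) % M) = 0 : Finset ℕ) :=
      fun i _ j _ h => (Prod.mk.inj h).1
    rw [gain, ← Finset.card_image_of_injOn hinj, ← Finset.card_union_of_disjoint]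
    · refine Finset.card_le_card fun z hz => ?_
      rcases Finset.mem_union.1 hz with hz | hz
      · obtain ⟨h, h0⟩ := Finset.mem_filter.1 hz
        obtain ⟨ha, hb⟩ := Finset.mem_product.1 h
        exact Finset.mem_filter.2 ⟨h, (hU _ (Finset.mem_range.1 ha) _ (Finset.mem_range.1 hb) h0).1⟩
      · obtain ⟨i, hi, rfl⟩ := Finset.mem_image.1 hz
        obtain ⟨h, h0⟩ := Finset.mem_filter.1 hi
        exact Finset.mem_filter.2 ⟨Finset.mem_product.2
          ⟨h, Finset.mem_range.2 (Nat.mod_lt _ hM)⟩, h0⟩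
    · rw [Finset.disjoint_left]
      intro z hz hz'
      obtain ⟨h, h0⟩ := Finset.mem_filter.1 hz
      obtain ⟨i, hi, rfl⟩ := Finset.mem_image.1 hz'
      obtain ⟨ha, hb⟩ := Finset.mem_product.1 h
      exact (hU _ (Finset.mem_range.1 ha) _ (Finset.mem_range.1 hb) h0).2 rfl
  obtain ⟨M, rfl⟩ : ∃ M', M = M' + 1 := ⟨M - 1, by omega⟩
  simp only [Nat.add_sub_cancel]
  nlinarith

/-- Bernoulli's inequality: the first two terms of `((M - 1) + 1) ^ M` already exceed the left side.
-/
theorem two_mul_pow_le {M : ℕ} (hM : 2 ≤ M) : 2 * (M - 1) ^ M ≤ M ^ M := by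
  obtain ⟨a, rfl⟩ : ∃ a, M = a + 1 := ⟨M - 1, by omega⟩
  simp only [Nat.add_sub_cancel]
  have h := pow_add_mul_le_add_pow (R := ℕ) (a := a) (b := 1) (Nat.zero_le _) (by omega) (a + 1)
  simp only [Nat.add_sub_cancel, Nat.cast_id] at h
  have : a ^ (a + 1) = a ^ a * a := pow_succ _ _
  nlinarith [Nat.zero_le (a ^ a)]

/-- Every `M` rounds halve the number of pairs. After `2 * M * ℓ` rounds fewer than `2 ^ ℓ` pairs
have shrunk by the factor `2 ^ (2 * ℓ)`, so none is left. -/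
theorem unmarked_eq_zero {M ℓ u v : ℕ} (hM : 2 ≤ M) (hv : v < 2 ^ ℓ)
    (h : M ^ (2 * M * ℓ) * u ≤ (M - 1) ^ (2 * M * ℓ) * v) : u = 0 := by
  by_contra hu
  have h1 : 2 ^ (2 * ℓ) * (M - 1) ^ (2 * M * ℓ) ≤ M ^ (2 * M * ℓ) := by
    rw [show 2 * M * ℓ = M * (2 * ℓ) by ring, pow_mul (M - 1), pow_mul M, ← mul_pow]
    exact Nat.pow_le_pow_left (two_mul_pow_le hM) _
  have h2 : 2 ^ (2 * ℓ) * (M - 1) ^ (2 * M * ℓ) ≤ v * (M - 1) ^ (2 * M * ℓ) := by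
    rw [Nat.mul_comm v]
    exact (h1.trans (Nat.le_mul_of_pos_right _ (Nat.pos_of_ne_zero hu))).trans h
  have h3 := Nat.le_of_mul_le_mul_right h2 (Nat.pow_pos (by omega))
  have h4 : 2 ^ ℓ ≤ 2 ^ (2 * ℓ) := Nat.pow_le_pow_right (by norm_num) (by omega)
  omega

/-- Put the segment `reg 54` of block `reg 59` of array `0` into register `13`. -/
def segmentP (P : Par) : Prog := block [
  .assign 10 (.reg 59 * .reg 7 + .reg 54 * .lit P.m),
  .assign 12 (.lit P.m),
  readDig 0]

@[simp] theorem segmentP_wr (P : Par) (i : ℕ) : (segmentP P).wr i = (10 ≤ i && i ≤ 15) := by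
  simp only [segmentP, block, Prog.wr, readDig_wr]
  rw [Bool.eq_iff_iff]; simp; omega
@[simp] theorem segmentP_wa (P : Par) (i : ℕ) : (segmentP P).wa i = false := by
  simp [segmentP]

/-- Segment `j` of block `i`. -/
def segment (P : Par) (ℓ : ℕ) (s : ℕ → ℕ) (j i : ℕ) : ℕ := dig 2 s (i * P.d ℓ + j * P.m) P.m

theorem segment_le {P : Par} {ℓ n i j : ℕ} (hi : i < n / P.d ℓ) (hj : j < P.J ℓ) :
    i * P.d ℓ + j * P.m + P.m ≤ n := by
  have h1 := (Nat.mul_le_mul_right (P.d ℓ) hi).trans (Nat.div_mul_le_self _ _)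
  have h2 := Nat.mul_le_mul_right P.m hj
  rw [Nat.succ_mul] at h1 h2
  have : P.d ℓ = P.J ℓ * P.m := Nat.mul_comm _ _
  omega

theorem Runs.segmentP {P : Par} {ℓ n b i j : ℕ} {σ : State} (S : Sizes P ℓ n b)
    (hc : Ctx P ℓ n σ) (h0 : ∀ i, σ.arr 0 i ≤ 1) (hi : σ.reg 59 = i) (hj : σ.reg 54 = j)
    (hin : i < n / P.d ℓ) (hjJ : j < P.J ℓ) :
    Runs b (segmentP P) σ (3 * P.m + 10)
      (fun τ => τ.reg 13 = segment P ℓ (σ.arr 0) j i) := by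
  have h := segment_le hin hjJ
  have hn := S.n_lt
  have hm := S.m_le
  have hb := S.le_b
  have lin : ∀ v, v ≤ 16 * 2 ^ ℓ → v < 2 ^ b := fun v hv => S.lt_of_lin hv
  refine .cons_assign (i * P.d ℓ + j * P.m) (by simp [hi, hj, hc.r7]) (lin _ (by omega)) ?_
  refine .cons_assign P.m (by simp) (lin _ (by omega)) ?_
  refine .cons (c₁ := 3 * P.m + 7) ((Runs.readDig 0 (by simpa using h0) (by simp; omega)
      (lin _ (by simp; omega))).mono (by simp)) fun τ _ e => .nil ?_
  simpa [segment] using e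

/-- Choose the shifts for the segments of array `0` greedily and put them into array `7`. -/
def greedyP (P : Par) : Prog := forP 54 (.reg 6) (block [
  .assign 55 0,
  .assign 56 0,
  forP 57 (.lit P.M) (block [
    .assign 58 0,
    forP 59 (.reg 2 / .reg 7) (block [
      segmentP P,
      .ite (.get 16 (.reg 59 * .lit P.M + (.reg 13 + .reg 57) % .lit P.M)) .nop
        (.assign 58 (.reg 58 + 1))]),
    .ite ((Expr.reg 55).lt (.reg 58)) (block [.assign 55 (.reg 58), .assign 56 (.reg 57)]) .nop]),
  .store 7 (.reg 54) (.reg 56),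
  forP 59 (.reg 2 / .reg 7) (block [
    segmentP P,
    .store 16 (.reg 59 * .lit P.M + (.reg 13 + .reg 56) % .lit P.M) 1])])

@[simp] theorem greedyP_wr (P : Par) (i : ℕ) : (greedyP P).wr i =
    ((10 ≤ i && i ≤ 15) || (54 ≤ i && i ≤ 59)) := by
  simp only [greedyP, block, Prog.wr, forP_wr, segmentP_wr]
  rw [Bool.eq_iff_iff]; simp; omega
@[simp] theorem greedyP_wa (P : Par) (i : ℕ) : (greedyP P).wa i = (i == 7 || i == 16) := by
  simp only [greedyP, block, Prog.wa, forP_wa, segmentP_wa]; grind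

theorem index_inj {M i p j q : ℕ} (hp : p < M) (hq : q < M) (h : i * M + p = j * M + q) :
    i = j ∧ p = q := by
  have h1 : (i * M + p) / M = (j * M + q) / M := by rw [h]
  have h2 : (i * M + p) % M = (j * M + q) % M := by rw [h]
  rw [Nat.mul_comm i, Nat.mul_comm j, Nat.mul_add_div (by omega), Nat.mul_add_div (by omega),
    Nat.div_eq_of_lt hp, Nat.div_eq_of_lt hq] at h1
  rw [Nat.mul_comm i, Nat.mul_comm j, Nat.mul_add_mod, Nat.mul_add_mod, Nat.mod_eq_of_lt hp,
    Nat.mod_eq_of_lt hq] at h2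
  exact ⟨by simpa using h1, h2⟩

/-- A bound for the number of steps of `greedyP`. -/
def greedyCost (P : Par) (ℓ n : ℕ) : ℕ :=
  P.J ℓ * (P.M * (n / P.d ℓ * (3 * P.m + 13 + 2) + 8 + 2) + 2 +
    (n / P.d ℓ * (3 * P.m + 13 + 2) + 2) + 4 + 2) + 2

theorem Runs.greedyP {P : Par} {ℓ n b : ℕ} {σ : State} (S : Sizes P ℓ n b) (hc : Ctx P ℓ n σ)
    (h0 : ∀ i, σ.arr 0 i ≤ 1) (h16 : ∀ i, σ.arr 16 i = 0) :
    Runs b (greedyP P) σ (greedyCost P ℓ n) (fun τ => (∀ j < P.J ℓ, τ.arr 7 j < P.M) ∧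
      ∀ i < n / P.d ℓ, ∀ p < P.M, ∃ j < P.J ℓ,
        (segment P ℓ (σ.arr 0) j i + τ.arr 7 j) % P.M = p) := by
  have hn := S.n_lt
  have hm1 := P.one_le_m
  have hM2 : 2 ≤ P.M := by
    simpa using Nat.pow_le_pow_right (n := 2) (by norm_num) hm1
  have hM0 : 0 < P.M := by omega
  have hMle := S.M_le
  have hJle := S.J_le
  have lin : ∀ v, v ≤ 16 * 2 ^ ℓ → v < 2 ^ b := fun v hv => S.lt_of_lin hv
  set N := n / P.d ℓ with hN
  have hNn : N ≤ n := Nat.div_le_self _ _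
  -- A block has more than `M` bits, so the table of pairs has at most `n` cells.
  have hNM : N * P.M ≤ n := by
    refine le_trans (Nat.mul_le_mul_left _ ?_) (Nat.div_mul_le_self n (P.d ℓ))
    have := S.two_le
    rw [Par.d, Par.J]; nlinarith [Nat.mul_le_mul hm1 this]
  set s := σ.arr 0 with hs
  refine .for_const (P.J ℓ) (P.M * (N * (3 * P.m + 13 + 2) + 8 + 2) + 2 +
      (N * (3 * P.m + 13 + 2) + 2) + 4)
    -- Every marked pair is realised by a shift chosen so far, and the number of unmarked pairs has
    -- shrunk by the factor `1 - 1 / M` in each round.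
    (fun j τ => (∀ j' < j, τ.arr 7 j' < P.M) ∧
      (∀ i < N, ∀ p < P.M, τ.arr 16 (i * P.M + p) ≠ 0 →
        ∃ j' < j, (segment P ℓ s j' i + τ.arr 7 j') % P.M = p) ∧
      P.M ^ j * (unmarked P.M N (τ.arr 16)).card ≤ (P.M - 1) ^ j * (N * P.M))
    (by simp) (lin _ (by omega)) (fun τ hf => by simp [hf.reg 6, hc.r6]) ?_ ?_ ?_
  · refine ⟨by simp, fun i _ p _ h => absurd (h16 _) h, ?_⟩
    simpa [unmarked] using (Finset.card_filter_le _ _).trans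
      (Finset.card_product (Finset.range N) (Finset.range P.M)).le
  · rintro j τ hj hr hf ⟨i1, i2, i3⟩
    have hcτ := hc.frame hf (by simp [Prog.keeps])
    have f0 : τ.arr 0 = s := by simp [hf.arr 0, hs]
    set U := τ.arr 16 with hU
    set sg := segment P ℓ s j with hsg
    refine .cons_assign 0 (by simp) (lin _ (by omega)) ?_
    refine .cons_assign 0 (by simp) (lin _ (by omega)) ?_
    refine .cons_for P.M (N * (3 * P.m + 13 + 2) + 8) (fun y τ1 => τ1.reg 56 < P.M ∧
        τ1.reg 55 ≤ N ∧
        -- Initially the record `0` belongs to no tested shift. If shift `0` has gain `0`, the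
        -- strict comparison keeps the initial values, and these are then correct.
        (y = 0 → τ1.reg 55 = 0 ∧ τ1.reg 56 = 0) ∧
        (y ≠ 0 → τ1.reg 55 = gain P.M N U sg (τ1.reg 56)) ∧
        ∀ z < y, gain P.M N U sg z ≤ τ1.reg 55)
      (by simp) (lin _ (by omega)) (fun τ _ => by simp) (by simp) ?_ ?_
    · rintro y τ1 hy hr1 hf1 ⟨j1, j2, j3, j4, j5⟩
      have hc1 : Ctx P ℓ n τ1 := by
        have h : Ctx P ℓ n ((τ.setReg 55 0).setReg 56 0) :=
          ⟨hcτ.r2, hcτ.r3, hcτ.r4, hcτ.r5, hcτ.r6, hcτ.r7, hcτ.r8, hcτ.r9, hcτ.r16⟩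
        exact h.frame hf1 (by simp [Prog.keeps])
      have k0 : τ1.arr 0 = s := by simp [hf1.arr 0, f0]
      have k54 : τ1.reg 54 = j := by simp [hf1.reg 54, hr]
      have k16 : τ1.arr 16 = U := by simp [hf1.arr 16, hU]
      refine .cons_assign 0 (by simp) (lin _ (by omega)) ?_
      refine .cons_for N (3 * P.m + 13) (fun i τ2 => τ2.reg 58 = gain P.M i U sg y)
        (by simp) (lin _ (by omega)) (fun τ hf => by simp [hf.reg 2, hf.reg 7, hc1.r2, hc1.r7, hN])
        (by simp [gain]) ?_ ?_
      · intro i τ2 hi hr2 hf2 l1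
        have hc2 : Ctx P ℓ n τ2 := by
          have h : Ctx P ℓ n (τ1.setReg 58 0) :=
            ⟨hc1.r2, hc1.r3, hc1.r4, hc1.r5, hc1.r6, hc1.r7, hc1.r8, hc1.r9, hc1.r16⟩
          exact h.frame hf2 (by simp [Prog.keeps])
        have m0 : τ2.arr 0 = s := by simp [hf2.arr 0, k0]
        have m57 : τ2.reg 57 = y := by simp [hf2.reg 57, hr1]
        have m16 : τ2.arr 16 = U := by simp [hf2.arr 16, k16]
        have hg := gain_le P.M i U sg y
        refine .cons (c₁ := 3 * P.m + 10) (.segmentP (i := i) (j := j) S hc2 (by rw [m0]; exact h0)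
          hr2 (by simp [hf2.reg 54, k54]) hi hj) fun τ3 f3 e3 => ?_
        rw [m0] at e3
        change τ3.reg 13 = sg i at e3
        refine .cons (c₁ := 2) (.ite' (fun he => ?_) (fun he => ?_)) (fun _ _ h => .nil h)
        · refine .nop ?_
          have : U (i * P.M + (sg i + y) % P.M) ≠ 0 := by
            simpa [f3.arr 16, m16, f3.reg 59, hr2, e3, f3.reg 57, m57] using he
          simp [f3.reg 58, l1, gain_succ, this]
        · have : U (i * P.M + (sg i + y) % P.M) = 0 := by
            simpa [f3.arr 16, m16, f3.reg 59, hr2, e3, f3.reg 57, m57] using he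
          refine .assign (gain P.M i U sg y + 1) (by simp [f3.reg 58, l1]) (lin _ (by omega)) ?_
          simp [gain_succ, this]
      · intro τ2 hf2 l1
        have hg := gain_le P.M N U sg y
        have m55 : τ2.reg 55 = τ1.reg 55 := by simp [hf2.reg 55]
        have m56 : τ2.reg 56 = τ1.reg 56 := by simp [hf2.reg 56]
        have m57 : τ2.reg 57 = y := by simp [hf2.reg 57, hr1]
        refine .cons (c₁ := 4) (.ite' (fun he => ?_) (fun he => ?_)) (fun _ _ h => .nil h)
        · rw [Expr.eval_lt_ne_zero] at he
          have he' : τ1.reg 55 < gain P.M N U sg y := by simpa [m55, l1] using he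
          refine .cons_assign (gain P.M N U sg y) (by simp [l1]) (lin _ (by omega)) ?_
          refine .cons_assign y (by simp [m57]) (lin _ (by omega)) (.nil ?_)
          refine ⟨by simpa using hy, by simpa using hg, by simp, by simp, fun z hz => ?_⟩
          simp only [State.setReg_reg_ne _ _ (show 55 ≠ 57 by norm_num), State.setReg_reg_self,
            State.setReg_reg_ne _ _ (show 55 ≠ 56 by norm_num)]
          by_cases h : z = y
          · rw [h]
          · have := j5 z (by omega); omega
        · have he' : ¬ τ1.reg 55 < gain P.M N U sg y := fun h =>
            Expr.eval_lt_ne_zero.2 (by simpa [m55, l1] using h) he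
          refine (Runs.nop ?_).mono (by omega)
          simp only [State.setReg_reg_ne _ _ (show 55 ≠ 57 by norm_num),
            State.setReg_reg_ne _ _ (show 56 ≠ 57 by norm_num), m55, m56]
          refine ⟨j1, j2, by omega, fun _ => ?_, fun z hz => ?_⟩
          · by_cases h : y = 0
            · subst h
              have := j3 rfl
              rw [this.2]; omega
            · exact j4 h
          · by_cases h : z = y
            · subst h; omega
            · exact j5 z (by omega)
    · rintro τ1 f1 ⟨j1, j2, -, j4, j5⟩
      have j4 := j4 (by omega)
      set y := τ1.reg 56 with hy
      have hc1 : Ctx P ℓ n τ1 := by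
        have h : Ctx P ℓ n ((τ.setReg 55 0).setReg 56 0) :=
          ⟨hcτ.r2, hcτ.r3, hcτ.r4, hcτ.r5, hcτ.r6, hcτ.r7, hcτ.r8, hcτ.r9, hcτ.r16⟩
        exact h.frame f1 (by simp [Prog.keeps])
      have k0 : τ1.arr 0 = s := by simp [f1.arr 0, f0]
      have k54 : τ1.reg 54 = j := by simp [f1.reg 54, hr]
      have k16 : τ1.arr 16 = U := by simp [f1.arr 16, hU]
      have k7 : τ1.arr 7 = τ.arr 7 := by simp [f1.arr 7]
      refine .cons_store j y (by simp [k54]) (by simp [hy]) (lin _ (by omega)) ?_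
      refine .cons_for N (3 * P.m + 13) (fun i0 τ2 =>
          (∀ i < N, ∀ p < P.M, τ2.arr 16 (i * P.M + p) = 0 → U (i * P.M + p) = 0 ∧
            (i < i0 → (sg i + y) % P.M ≠ p)) ∧
          (∀ i < N, ∀ p < P.M, τ2.arr 16 (i * P.M + p) ≠ 0 → U (i * P.M + p) ≠ 0 ∨
            (sg i + y) % P.M = p))
        (by simp) (lin _ (by omega)) (fun τ hf => by simp [hf.reg 2, hf.reg 7, hc1.r2, hc1.r7, hN])
        (by simp only [State.setReg_arr, State.setArr_arr_ne _ _ _ (show 16 ≠ 7 by norm_num), k16]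
            exact ⟨fun _ _ _ _ h => ⟨h, by simp⟩, fun _ _ _ _ h => .inl h⟩) ?_ ?_
      · rintro i0 τ2 hi0 hr2 hf2 ⟨l1, l2⟩
        have hc2 : Ctx P ℓ n τ2 := by
          have h : Ctx P ℓ n (τ1.setArr 7 j y) :=
            ⟨hc1.r2, hc1.r3, hc1.r4, hc1.r5, hc1.r6, hc1.r7, hc1.r8, hc1.r9, hc1.r16⟩
          exact h.frame hf2 (by simp [Prog.keeps])
        have m0 : τ2.arr 0 = s := by simp [hf2.arr 0, k0]
        refine .cons (c₁ := 3 * P.m + 10) (.segmentP (i := i0) (j := j) S hc2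
          (by rw [m0]; exact h0) hr2 (by simp [hf2.reg 54, k54]) hi0 hj) fun τ3 f3 e3 => ?_
        rw [m0] at e3
        change τ3.reg 13 = sg i0 at e3
        have hq := Nat.mod_lt (sg i0 + y) hM0
        have hidx : i0 * P.M + (sg i0 + y) % P.M < n := by
          have := (Nat.mul_le_mul_right P.M hi0).trans hNM
          rw [Nat.succ_mul] at this; omega
        refine .cons_store (i0 * P.M + (sg i0 + y) % P.M) 1
          (by simp [f3.reg 59, hr2, e3, f3.reg 56, hf2.reg 56, hy]) (by simp)
          (lin _ (by omega)) (.nil ?_)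
        simp only [State.setReg_arr, State.setArr_arr_self, f3.arr 16 (by simp),
          Function.update_apply]
        refine ⟨fun i hi p hp => ?_, fun i hi p hp => ?_⟩
        · split_ifs with h
          · simp
          · intro h2
            obtain ⟨u1, u2⟩ := l1 i hi p hp h2
            refine ⟨u1, fun hlt he => ?_⟩
            by_cases hii : i = i0
            · subst hii; exact h (by rw [he])
            · exact u2 (by omega) he
        · split_ifs with h
          · obtain ⟨rfl, rfl⟩ := index_inj hp hq h
            exact fun _ => .inr rfl
          · exact l2 i hi p hp
      · rintro τ2 hf2 ⟨l1, l2⟩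
        have m7 : τ2.arr 7 = Function.update (τ.arr 7) j y := by
          simp [hf2.arr 7, k7]
        refine .nil ?_
        simp only [State.setReg_arr, m7]
        refine ⟨fun j' hj' => ?_, fun i hi p hp h => ?_, ?_⟩
        · rw [Function.update_apply]
          split_ifs with h
          · exact j1
          · exact i1 j' (by omega)
        · rcases l2 i hi p hp h with h | h
          · obtain ⟨j', hj', e⟩ := i2 i hi p hp h
            exact ⟨j', by omega, by rw [Function.update_of_ne (by omega)]; exact e⟩
          · exact ⟨j, by omega, by rw [Function.update_self]; exact h⟩
        · have hstep := unmarked_step (U' := τ2.arr 16) hM0 (fun z hz => j4 ▸ j5 z hz)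
            fun i hi p hp h => ⟨(l1 i hi p hp h).1, (l1 i hi p hp h).2 hi⟩
          calc _ = P.M ^ j * (P.M * (unmarked P.M N (τ2.arr 16)).card) := by ring
            _ ≤ P.M ^ j * ((P.M - 1) * (unmarked P.M N U).card) := Nat.mul_le_mul_left _ hstep
            _ = (P.M - 1) * (P.M ^ j * (unmarked P.M N U).card) := by ring
            _ ≤ (P.M - 1) * ((P.M - 1) ^ j * (N * P.M)) := Nat.mul_le_mul_left _ i3
            _ = _ := by ring
  · rintro τ hr hf ⟨i1, i2, i3⟩
    refine ⟨i1, fun i hi p hp => i2 i hi p hp fun h => ?_⟩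
    have := unmarked_eq_zero hM2 (hNM.trans_lt hn) i3
    rw [Finset.card_eq_zero] at this
    have hmem : (i, p) ∈ unmarked P.M N (τ.arr 16) :=
      Finset.mem_filter.2 ⟨Finset.mem_product.2 ⟨Finset.mem_range.2 hi, Finset.mem_range.2 hp⟩, h⟩
    rw [this] at hmem
    exact Finset.notMem_empty _ hmem

/-! ### Computing the binary length, the modulus and the parameters -/

/-- Increase `reg 2` by one; `reg 3` is its length in binary and `reg 4` is `2 ^ reg 3`. -/
def bumpP : Prog := block [
  .assign 2 (.reg 2 + 1),
  .ite ((Expr.reg 2).lt (.reg 4)) .nop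
    (block [.assign 3 (.reg 3 + 1), .assign 4 (2 * .reg 4)])]

@[simp] theorem bumpP_wr (i : ℕ) : bumpP.wr i = (i == 2 || i == 3 || i == 4) := by
  simp only [bumpP, block, Prog.wr]; grind
@[simp] theorem bumpP_wa (i : ℕ) : bumpP.wa i = false := by simp [bumpP]

theorem size_succ_of_lt {c : ℕ} (h : c + 1 < 2 ^ c.size) : (c + 1).size = c.size :=
  le_antisymm (Nat.size_le.2 h) (Nat.size_le_size (by omega))

theorem size_succ_of_le {c : ℕ} (h : 2 ^ c.size ≤ c + 1) : (c + 1).size = c.size + 1 := by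
  have h1 := Nat.lt_size_self c
  refine le_antisymm (Nat.size_le.2 ?_) (Nat.lt_size.2 h)
  rw [pow_succ]; omega

/-- The registers that hold a number and its length. -/
structure Counter (c : ℕ) (σ : State) : Prop where
  r2 : σ.reg 2 = c
  r3 : σ.reg 3 = c.size
  r4 : σ.reg 4 = 2 ^ c.size

/-- Counting up yields the binary length and its power of two together with the number: both change
exactly when the number reaches the power. -/
theorem Runs.bumpP {b c : ℕ} {σ : State} (h : Counter c σ) (hb : (c + 1).size < b) :
    Runs b bumpP σ 7 (Counter (c + 1)) := by
  have h1 := Nat.lt_size_self (c + 1)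
  have h2 : 2 ^ (c + 1).size < 2 ^ b := Nat.pow_lt_pow_right (by norm_num) hb
  have h3 : b < 2 ^ b := Nat.lt_two_pow_self
  refine .cons_assign (c + 1) (by simp [h.r2]) (h1.trans h2) ?_
  refine .cons (c₁ := 4) (.ite' (fun he => ?_) (fun he => ?_)) (fun _ _ h => .nil h)
  · rw [Expr.eval_lt_ne_zero] at he
    have he' : c + 1 < 2 ^ c.size := by simpa [h.r4] using he
    have := size_succ_of_lt he'
    exact (Runs.nop ⟨by simp, by simp [h.r3, this], by simp [h.r4, this]⟩).mono (by omega)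
  · have he' : ¬ c + 1 < 2 ^ c.size := fun hlt =>
      Expr.eval_lt_ne_zero.2 (by simpa [h.r4] using hlt) he
    have := size_succ_of_le (by omega : 2 ^ c.size ≤ c + 1)
    refine .cons_assign (c + 1).size (by simp [h.r3, this]) (by omega) ?_
    refine .cons_assign (2 ^ (c + 1).size) (by simp [h.r4, this, pow_succ']) h2 (.nil ?_)
    exact ⟨by simp, by simp, by simp⟩

/-- Mark the numbers up to `2 * reg 4` that are not prime in array `2` and put the largest prime
number up to `2 * reg 4` into register `5`. -/
def sieveP : Prog := block [
  .store 2 1 1,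
  forP 54 (2 * .reg 4) (block [
    .assign 55 (.reg 54 + 2),
    forP 56 ((2 * .reg 4) / .reg 55) (.store 2 ((.reg 56 + 2) * .reg 55) 1)]),
  .assign 5 0,
  forP 54 (2 * .reg 4) (.ite (.get 2 (.reg 54 + 1)) .nop (.assign 5 (.reg 54 + 1)))]

@[simp] theorem sieveP_wr (i : ℕ) : sieveP.wr i = (i == 5 || i == 54 || i == 55 || i == 56) := by
  simp only [sieveP, block, Prog.wr, forP_wr]; grind
@[simp] theorem sieveP_wa (i : ℕ) : sieveP.wa i = (i == 2) := by
  simp [sieveP]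

/-- The harmonic sum by dyadic blocks, each of which contributes at most `Q`. It bounds the number
of marks set by the sieve. -/
theorem sum_div_le (Q K : ℕ) : ∑ j ∈ Finset.range (2 ^ K), Q / (j + 2) ≤ Q * (K + 1) := by
  induction K with
  | zero => simpa using Nat.div_le_self Q 2
  | succ K ih =>
    have h : ∑ j ∈ Finset.range (2 ^ K), Q / (2 ^ K + j + 2) ≤ Q := by
      refine (Finset.sum_le_card_nsmul _ _ (Q / 2 ^ K) fun j _ =>
        Nat.div_le_div_left (by omega) (by positivity)).trans ?_
      rw [Finset.card_range, smul_eq_mul]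
      exact Nat.mul_div_le _ _
    rw [pow_succ, Nat.mul_two, Finset.sum_range_add]
    calc _ ≤ Q * (K + 1) + Q := Nat.add_le_add ih h
      _ = _ := by ring

/-- The range of `u` is generous: some of the products exceed `Q`, but they are composite as well
and do no harm. -/
theorem prime_iff_not_product {Q v : ℕ} (hv : 1 ≤ v) (hvQ : v ≤ Q) :
    v.Prime ↔ ¬ (v = 1 ∨ ∃ a < Q, ∃ u < Q / (a + 2), v = (u + 2) * (a + 2)) := by
  constructor
  · rintro hp (rfl | ⟨a, -, u, -, rfl⟩)
    · exact Nat.not_prime_one hp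
    · exact Nat.not_prime_mul (by omega) (by omega) hp
  · intro h
    push Not at h
    by_contra hp
    obtain ⟨x, hx1, hx2, hx3⟩ := Nat.exists_dvd_of_not_prime2 (by omega : 2 ≤ v) hp
    obtain ⟨y, rfl⟩ := hx1
    have hy : 2 ≤ y := by
      by_contra hy
      have : y = 0 ∨ y = 1 := by omega
      rcases this with rfl | rfl <;> omega
    obtain ⟨a, rfl⟩ : ∃ a, x = a + 2 := ⟨x - 2, by omega⟩
    obtain ⟨u, rfl⟩ : ∃ u, y = u + 2 := ⟨y - 2, by omega⟩
    refine h.2 a (by omega) u ((Nat.le_div_iff_mul_le (by omega)).2 ?_) (Nat.mul_comm _ _)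
    nlinarith

/-- A bound for the number of steps of `sieveP`. -/
def sieveCost (ℓ : ℕ) : ℕ := 2 * 2 ^ ℓ * (3 * (ℓ + 2) + 20) + 10

theorem Runs.sieveP {b ℓ : ℕ} {σ : State} (h4 : σ.reg 4 = 2 ^ ℓ)
    (hb : ∀ v, v ≤ 16 * 2 ^ ℓ → v < 2 ^ b) (h2 : ∀ i, σ.arr 2 i = 0) :
    Runs b sieveP σ (sieveCost ℓ) (fun τ => τ.reg 5 = modulus ℓ) := by
  set Q := 2 * 2 ^ ℓ with hQ
  have hpos : 0 < 2 ^ ℓ := by positivity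
  have hsum := sum_div_le Q (ℓ + 1)
  rw [pow_succ', ← hQ] at hsum
  have hT : ∑ j ∈ Finset.range Q, ((Q / (j + 2) * (1 + 2) + 2) + 2 + 2) + 2 ≤
      Q * (3 * (ℓ + 2)) + 6 * Q + 2 := by
    have : ∑ j ∈ Finset.range Q, ((Q / (j + 2) * (1 + 2) + 2) + 2 + 2) =
        3 * ∑ j ∈ Finset.range Q, Q / (j + 2) + 6 * Q := by
      simp only [Finset.sum_add_distrib, ← Finset.sum_mul, Finset.sum_const, Finset.card_range,
        smul_eq_mul]
      ring
    rw [this]; nlinarith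
  have hcost : sieveCost ℓ = Q * (3 * (ℓ + 2)) + 20 * Q + 10 := by
    rw [sieveCost, hQ]; ring
  rw [hcost]
  refine .cons_store 1 1 (by simp) (by simp) (hb _ (by omega)) ?_
  -- The rounds have different lengths, so the loop rule with varying costs is needed; a constant
  -- bound would give quadratic time.
  refine .cons (c₁ := ∑ j ∈ Finset.range Q, ((Q / (j + 2) * (1 + 2) + 2) + 2 + 2) + 2)
    (.forP Q (fun j => (Q / (j + 2) * (1 + 2) + 2) + 2) (fun j τ => ∀ v, τ.arr 2 v ≠ 0 ↔
      (v = 1 ∨ ∃ a < j, ∃ u < Q / (a + 2), v = (u + 2) * (a + 2)))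
      (by simp) (hb _ (by omega)) (fun τ hf => by simp [hf.reg 4, h4, hQ]) ?_ ?_
      (fun τ _ _ h => h)) ?_
  · intro v
    simp only [State.setReg_arr, State.setArr_arr_self, Function.update_apply]
    split_ifs with h <;> simp [h, h2]
  · intro j τ hj hr hf inv
    have k4 : τ.reg 4 = 2 ^ ℓ := by simp [hf.reg 4, h4]
    refine .cons_assign (j + 2) (by simp [hr]) (hb _ (by omega)) ?_
    refine .cons_for (Q / (j + 2)) 1 (fun u τ' => ∀ v, τ'.arr 2 v ≠ 0 ↔
        (τ.arr 2 v ≠ 0 ∨ ∃ u' < u, v = (u' + 2) * (j + 2)))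
      (by simp) (hb _ ((Nat.div_le_self _ _).trans (by omega)))
      (fun τ hf => by simp [hf.reg 4, hf.reg 55, k4, hQ]) (by simp) ?_ ?_
    · intro u τ' hu hr' hf' inv'
      have hub : (u + 2) * (j + 2) ≤ 16 * 2 ^ ℓ := by
        have h1 : (u + 1) * (j + 2) ≤ Q := (Nat.le_div_iff_mul_le (by omega)).1 hu
        nlinarith
      refine .store ((u + 2) * (j + 2)) 1 (by simp [hr', hf'.reg 55]) (by simp)
        (hb _ (by omega)) fun v => ?_
      simp only [State.setReg_arr, State.setArr_arr_self, Function.update_apply]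
      split_ifs with h
      · simp only [ne_eq, one_ne_zero, not_false_eq_true, true_iff]
        exact .inr ⟨u, by omega, h⟩
      · rw [inv' v]
        refine or_congr_right ⟨fun ⟨u', h1, h2⟩ => ⟨u', by omega, h2⟩, fun ⟨u', h1, h2⟩ => ?_⟩
        have : u' ≠ u := by rintro rfl; exact h h2
        exact ⟨u', by omega, h2⟩
    · intro τ' hf' inv'
      refine .nil fun v => ?_
      rw [State.setReg_arr, inv' v, inv v, or_assoc]
      refine or_congr_right ⟨?_, ?_⟩
      · rintro (⟨a, ha, h⟩ | h)
        · exact ⟨a, by omega, h⟩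
        · exact ⟨j, by omega, h⟩
      · rintro ⟨a, ha, h⟩
        by_cases haj : a = j
        · subst haj; exact .inr h
        · exact .inl ⟨a, by omega, h⟩
  · intro τ hf inv
    have k4 : τ.reg 4 = 2 ^ ℓ := by simp [hf.reg 4, h4]
    refine .cons_assign 0 (by simp) (hb _ (by omega)) ?_
    refine .cons_for Q 2 (fun j τ' => τ'.reg 5 = Nat.findGreatest Nat.Prime j)
      (by simp) (hb _ (by omega)) (fun τ hf => by simp [hf.reg 4, k4, hQ]) (by simp) ?_
      (fun τ _ h => .nil h)
    · intro j τ' hj hr hf' inv'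
      have h := prime_iff_not_product (Q := Q) (v := j + 1) (by omega) (by omega)
      rw [← inv, not_not] at h
      rw [Nat.findGreatest_succ]
      have he : ((Expr.reg 54 + 1 : Expr).eval τ') = j + 1 := by simp [hr]
      refine .ite' (fun h0 => ?_) (fun h0 => ?_)
      · have h0' : τ.arr 2 (j + 1) ≠ 0 := by simpa [hr, hf'.arr 2] using h0
        rw [if_neg (fun hp => h0' (h.1 hp))]
        exact .nop (by simpa using inv')
      · have h0' : τ.arr 2 (j + 1) = 0 := by simpa [hr, hf'.arr 2] using h0
        rw [if_pos (h.2 h0')]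
        exact .assign (j + 1) (by simp [hr]) (hb _ (by omega)) (by simp)

/-- Compute the parameters of the code from `Counter`. -/
def paramsP (P : Par) : Prog := block [
  .assign 6 (.lit (2 * P.M) * .reg 3),
  .assign 7 (.lit P.m * .reg 6),
  .assign 8 (4 * .reg 7),
  .assign 9 (.reg 8 / .lit P.L + 1),
  .assign 16 (.reg 2 / .reg 7 * .reg 6),
  sieveP]

@[simp] theorem paramsP_wa (P : Par) (i : ℕ) : (paramsP P).wa i = (i == 2) := by
  simp [paramsP]

theorem Runs.paramsP {P : Par} {n b : ℕ} {σ : State} (S : Sizes P n.size n b) (h : Counter n σ)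
    (h2 : ∀ i, σ.arr 2 i = 0) :
    Runs b (paramsP P) σ (sieveCost n.size + 6) (Ctx P n.size n) := by
  have hJ := S.J_le
  have hd := S.d_le
  have hD := S.D_le
  have hn := S.n_lt
  have lin : ∀ v, v ≤ 16 * 2 ^ n.size → v < 2 ^ b := fun v hv => S.lt_of_lin hv
  have hnb : P.nb n.size ≤ 2 ^ n.size := (Nat.le_mul_of_pos_right _ P.L_pos).trans S.nb_le
  have hNJ : n / P.d n.size * P.J n.size ≤ n := by
    refine le_trans (Nat.mul_le_mul_left _ ?_) (Nat.div_mul_le_self n (P.d n.size))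
    exact Nat.le_mul_of_pos_left _ P.one_le_m
  refine .cons_assign (P.J n.size) (by simp [h.r3, Par.J]) (lin _ (by omega)) ?_
  refine .cons_assign (P.d n.size) (by simp [Par.d]) (lin _ (by omega)) ?_
  refine .cons_assign (P.D n.size) (by simp [Par.D]) (lin _ (by omega)) ?_
  refine .cons_assign (P.nb n.size) (by simp [Par.nb]) (lin _ (by omega)) ?_
  refine .cons_assign (n / P.d n.size * P.J n.size) (by simp [h.r2]) (lin _ (by omega)) ?_
  refine .cons (c₁ := sieveCost n.size) (.sieveP (ℓ := n.size) (by simp [h.r4]) lin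
    (by simpa using h2)) fun τ hf h5 => .nil ⟨?_, ?_, ?_, h5, ?_, ?_, ?_, ?_, ?_⟩
  · simp [hf.reg 2, h.r2]
  · simp [hf.reg 3, h.r3]
  · simp [hf.reg 4, h.r4]
  · simp [hf.reg 6]
  · simp [hf.reg 7]
  · simp [hf.reg 8]
  · simp [hf.reg 9]
  · simp [hf.reg 16]

section congr
variable {P : Par} {ℓ : ℕ} {X Y : ℕ → ℕ} {len : ℕ}

theorem win_congr (h : ∀ i < len, X i = Y i) {e : ℕ} (he : e ≤ len) (off w : ℕ) :
    win X e off w = win Y e off w :=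
  dig_congr fun i _ => by
    split_ifs with h'
    · exact h _ (by omega)
    · rfl

/-- The encoder computes the syndromes before it appends the redundancy; they depend on the first
`len` bits only and thus remain valid. -/
theorem synd_congr (h : ∀ i < len, X i = Y i) (p j : ℕ) :
    synd P ℓ X len p j = synd P ℓ Y len p j := by
  have hm : mark X len P.m p = mark Y len P.m p := by
    funext i
    simp only [mark, win_congr h le_rfl]
  have hb : bd P X len p = bd P Y len p := by
    funext r
    simp only [bd, hm]
  have hc : cnt P X len p = cnt P Y len p := by
    unfold cnt; congr 1
  simp only [synd, hc, pieceV, hb, hashV]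
  congr 1
  refine Finset.sum_congr rfl fun r _ => ?_
  congr 3
  refine dig_congr fun i _ => ?_
  rw [win_congr h (show bd P Y len p (r + 1) ≤ len from st_le_len _)]

theorem Shifted.congr {n : ℕ} {s t x y : ℕ → ℕ} (h : Shifted P ℓ n s t x)
    (hxy : ∀ i < n, y i = x i) : Shifted P ℓ n s t y := by
  refine ⟨fun g hg => ?_, fun i hi hd => (hxy i hi).trans (h.tail i hi hd)⟩
  rw [← h.seg g hg]
  refine dig_congr fun i hi => hxy _ ?_
  have h1 := Nat.mul_le_mul_right P.m hg
  rw [← P.d_mul, Nat.succ_mul] at h1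
  have := Nat.div_mul_le_self n (P.d ℓ)
  omega

/-- The occurrences supplied by the greedy choice are whole segments, hence they lie inside their
blocks. -/
theorem Shifted.mixed {n : ℕ} {s t x : ℕ → ℕ} (h : Shifted P ℓ n s t x)
    (hg : ∀ i < n / P.d ℓ, ∀ p < P.M, ∃ j < P.J ℓ, (segment P ℓ s j i + t j) % P.M = p) :
    Mixed P ℓ x n := by
  intro i hi p hp
  obtain ⟨j, hj, rfl⟩ := hg i hi p hp
  have h1 := Nat.mul_le_mul_right P.m hj
  rw [Nat.succ_mul, show P.J ℓ * P.m = P.d ℓ from Nat.mul_comm _ _] at h1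
  have h2 : (i * P.J ℓ + j) * P.m = i * P.d ℓ + j * P.m := by
    rw [Nat.add_mul, ← P.d_mul]
  have h3 : i * P.J ℓ + j < n / P.d ℓ * P.J ℓ := by
    have := Nat.mul_le_mul_right (P.J ℓ) hi
    rw [Nat.succ_mul] at this; omega
  refine ⟨i * P.d ℓ + j * P.m, by omega, by rw [Nat.add_mul]; omega, ?_⟩
  have := h.seg _ h3
  rw [h2, Nat.mul_comm i (P.J ℓ), Nat.mul_add_mod, Nat.mod_eq_of_lt hj] at this
  exact this

end congr

/-! ### The encoder -/

/-- Write the mask in array `7` and the syndromes in array `5` to array `6` in binary. -/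
def redundancyP (P : Par) : Prog := block [
  forP 54 (.reg 6) (block [
    .assign 20 (.reg 54 * .lit P.m),
    .assign 21 (.lit P.m),
    .assign 22 (.get 7 (.reg 54)),
    writeBits 6]),
  forP 54 (.lit (2 * P.k * P.M)) (block [
    .assign 20 (.reg 7 + .reg 54 * (.reg 3 + 1)),
    .assign 21 (.reg 3 + 1),
    .assign 22 (.get 5 (.reg 54)),
    writeBits 6])]

@[simp] theorem redundancyP_wr (P : Par) (i : ℕ) : (redundancyP P).wr i =
    ((20 ≤ i && i ≤ 23) || i == 54) := by
  simp only [redundancyP, block, Prog.wr, forP_wr, writeBits_wr]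
  rw [Bool.eq_iff_iff]; simp; omega
@[simp] theorem redundancyP_wa (P : Par) (i : ℕ) : (redundancyP P).wa i = (i == 6) := by
  simp [redundancyP]

theorem Par.rho_lt_of_sizes {P : Par} {ℓ n b : ℕ} (S : Sizes P ℓ n b) : P.rho ℓ ≤ 2 ^ ℓ := by
  have h1 := P.rho_le ℓ
  have h2 := S.code_le
  nlinarith [Nat.zero_le (P.nB ℓ * P.L)]

theorem Runs.redundancyP {P : Par} {ℓ n b : ℕ} {σ : State} (S : Sizes P ℓ n b) (hc : Ctx P ℓ n σ)
    (h6 : ∀ i, σ.arr 6 i ≤ 1) (h7 : ∀ j < P.J ℓ, σ.arr 7 j < P.M)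
    (h5 : ∀ e < 2 * P.k * P.M, σ.arr 5 e < modulus ℓ) :
    Runs b (redundancyP P) σ ((P.J ℓ * (5 * P.m + 6 + 2) + 2) +
      (2 * P.k * P.M * (5 * (ℓ + 1) + 6 + 2) + 2) + 1) (fun τ => (∀ i, τ.arr 6 i ≤ 1) ∧
        (∀ j < P.J ℓ, dig 2 (τ.arr 6) (j * P.m) P.m = σ.arr 7 j) ∧
        ∀ e < 2 * P.k * P.M, dig 2 (τ.arr 6) (P.d ℓ + e * (ℓ + 1)) (ℓ + 1) = σ.arr 5 e) := by
  obtain ⟨hqp, hq1, hq2⟩ := modulus_spec ℓ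
  have lin : ∀ v, v ≤ 16 * 2 ^ ℓ → v < 2 ^ b := fun v hv => S.lt_of_lin hv
  have hrho := P.rho_lt_of_sizes S
  rw [Par.rho] at hrho
  have hJ := S.J_le
  have hb := S.le_b
  have hm := S.m_le
  have hM := S.M_le
  have hk := S.synd_le
  have hlb : ℓ < 2 ^ ℓ := Nat.lt_two_pow_self
  have hd : P.J ℓ * P.m = P.d ℓ := Nat.mul_comm _ _
  refine .cons_for (P.J ℓ) (5 * P.m + 6) (fun j τ => (∀ i, τ.arr 6 i ≤ 1) ∧
      ∀ j' < j, dig 2 (τ.arr 6) (j' * P.m) P.m = σ.arr 7 j')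
    (by simp) (lin _ (by omega)) (fun τ hf => by simp [hf.reg 6, hc.r6]) (by simpa using h6) ?_ ?_
  · rintro j τ hj hr hf ⟨i1, i2⟩
    have hjm := Nat.mul_le_mul_right P.m hj
    rw [Nat.succ_mul] at hjm
    have h7j := h7 j hj
    refine .cons_assign (j * P.m) (by simp [hr]) (lin _ (by omega)) ?_
    refine .cons_assign P.m (by simp) (lin _ (by omega)) ?_
    refine .cons_assign (σ.arr 7 j) (by simp [hr, hf.arr 7]) (lin _ (by omega)) ?_
    refine .cons (c₁ := 5 * P.m + 2) ((Runs.writeBits 6 (by omega)).mono (by simp)) ?_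
    intro τ1 f1 e1
    simp only [State.setReg_reg_self, State.setReg_arr,
      State.setReg_reg_ne _ _ (show 21 ≠ 22 by norm_num),
      State.setReg_reg_ne _ _ (show 20 ≠ 22 by norm_num),
      State.setReg_reg_ne _ _ (show 20 ≠ 21 by norm_num)] at e1
    refine .nil ?_
    simp only [State.setReg_arr, e1]
    refine ⟨putBits_le i1 _ _ _, fun j' hj' => ?_⟩
    by_cases h : j' = j
    · subst h; exact dig_putBits _ h7j
    · have h1 : (j' + 1) * P.m ≤ j * P.m := Nat.mul_le_mul_right _ (by omega)
      rw [Nat.add_mul, Nat.one_mul] at h1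
      rw [dig_putBits_of_disjoint _ (.inl h1)]
      exact i2 j' (by omega)
  rintro τ0 f0 ⟨a1, a2⟩
  have hc0 := hc.frame f0 (by simp [Prog.keeps])
  refine .cons_for (2 * P.k * P.M) (5 * (ℓ + 1) + 6) (fun e τ => (∀ i, τ.arr 6 i ≤ 1) ∧
      (∀ j < P.J ℓ, dig 2 (τ.arr 6) (j * P.m) P.m = σ.arr 7 j) ∧
      ∀ e' < e, dig 2 (τ.arr 6) (P.d ℓ + e' * (ℓ + 1)) (ℓ + 1) = σ.arr 5 e')
    (by simp) (lin _ (by omega)) (fun τ hf => by simp) (by simpa using ⟨a1, a2⟩) ?_ ?_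
  · rintro e τ he hr hf ⟨i1, i2, i3⟩
    have hcτ := hc0.frame hf (by simp [Prog.keeps])
    have h5e := h5 e he
    have hel := Nat.mul_le_mul_right (ℓ + 1) he
    rw [Nat.succ_mul] at hel
    refine .cons_assign (P.d ℓ + e * (ℓ + 1)) (by simp [hr, hcτ.r7, hcτ.r3]) (lin _ (by omega)) ?_
    refine .cons_assign (ℓ + 1) (by simp [hcτ.r3]) (lin _ (by omega)) ?_
    refine .cons_assign (σ.arr 5 e) (by simp [hr, hf.arr 5, f0.arr 5]) (lin _ (by omega)) ?_
    refine .cons (c₁ := 5 * (ℓ + 1) + 2) ((Runs.writeBits 6 (by omega)).mono (by simp)) ?_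
    intro τ1 f1 e1
    simp only [State.setReg_reg_self, State.setReg_arr,
      State.setReg_reg_ne _ _ (show 21 ≠ 22 by norm_num),
      State.setReg_reg_ne _ _ (show 20 ≠ 22 by norm_num),
      State.setReg_reg_ne _ _ (show 20 ≠ 21 by norm_num)] at e1
    refine .nil ?_
    simp only [State.setReg_arr, e1]
    refine ⟨putBits_le i1 _ _ _, fun j hj => ?_, fun e' he' => ?_⟩
    · have hjm := Nat.mul_le_mul_right P.m hj
      rw [Nat.succ_mul] at hjm
      rw [dig_putBits_of_disjoint _ (.inl (by omega))]
      exact i2 j hj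
    · by_cases h : e' = e
      · subst h
        -- A residue has at most `ℓ + 1` bits, because the modulus is at most `2 ^ (ℓ + 1)`.
        exact dig_putBits _ (by rw [pow_succ]; omega)
      · have h1 : (e' + 1) * (ℓ + 1) ≤ e * (ℓ + 1) := Nat.mul_le_mul_right _ (by omega)
        rw [Nat.succ_mul] at h1
        rw [dig_putBits_of_disjoint _ (.inl (by omega))]
        exact i3 e' (by omega)
  · rintro τ hf ⟨i1, i2, i3⟩
    exact .nil ⟨i1, i2, i3⟩

/-- The number of code blocks. -/
def blocksE (P : Par) : Expr :=
  (.lit (P.m * (2 * P.M)) * .reg 3 + .lit (2 * P.k * P.M) * (.reg 3 + 1)) / .lit P.L + 1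

-- Only register `3` enters, so the decoder can evaluate the code length for trial values of `n`
-- before the other parameters are known.
@[simp] theorem blocksE_eval (P : Par) (σ : State) : (blocksE P).eval σ = P.nB (σ.reg 3) := by
  simp [blocksE, Par.nB, Par.rho, Par.d, Par.J, Nat.mul_assoc]

/-- Encode the blocks of array `6` and write the result to array `1` from `reg 2` on. -/
def blocksP (P : Par) : Prog := forP 54 (blocksE P) (block [
  .assign 10 (.reg 54 * .lit P.L),
  .assign 12 (.lit P.L),
  readDig 6,
  .assign 20 (.reg 2 + .reg 54 * .lit (2 * P.L)),
  .assign 21 (.lit (2 * P.L)),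
  .assign 22 (.get 4 (.reg 13)),
  writeBits 1])

@[simp] theorem blocksP_wr (P : Par) (i : ℕ) : (blocksP P).wr i =
    ((10 ≤ i && i ≤ 15) || (20 ≤ i && i ≤ 23) || i == 54) := by
  simp only [blocksP, block, Prog.wr, forP_wr, readDig_wr, writeBits_wr]
  rw [Bool.eq_iff_iff]; simp; omega

theorem Runs.blocksP {P : Par} {ℓ n b : ℕ} {σ : State} (S : Sizes P ℓ n b) (hc : Ctx P ℓ n σ)
    (h6 : ∀ i, σ.arr 6 i ≤ 1) (h1 : ∀ i, σ.arr 1 i ≤ 1)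
    (h4 : ∀ u < 2 ^ P.L, σ.arr 4 u = P.encT u) :
    Runs b (blocksP P) σ (P.nB ℓ * (13 * P.L + 16 + 2) + 2) (fun τ => (∀ i, τ.arr 1 i ≤ 1) ∧
        (∀ i < n, τ.arr 1 i = σ.arr 1 i) ∧
        ∀ B < P.nB ℓ, dig 2 (τ.arr 1) (n + B * (2 * P.L)) (2 * P.L) =
          P.encT (dig 2 (σ.arr 6) (B * P.L) P.L)) := by
  have lin : ∀ v, v ≤ 16 * 2 ^ ℓ → v < 2 ^ b := fun v hv => S.lt_of_lin hv
  have hn := S.n_lt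
  have hL := S.L_le
  have hb := S.le_b
  have hcode := S.code_le
  have hlb : ℓ < 2 ^ ℓ := Nat.lt_two_pow_self
  have hLpos := P.L_pos
  have hnB : P.nB ℓ ≤ 2 ^ ℓ := (Nat.le_mul_of_pos_left _ (by omega)).trans hcode
  refine .for_const (P.nB ℓ) (13 * P.L + 16) (fun B τ => (∀ i, τ.arr 1 i ≤ 1) ∧
        (∀ i < n, τ.arr 1 i = σ.arr 1 i) ∧
        ∀ B' < B, dig 2 (τ.arr 1) (n + B' * (2 * P.L)) (2 * P.L) =
          P.encT (dig 2 (σ.arr 6) (B' * P.L) P.L))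
    (by simp) (lin _ (by omega)) (fun τ hf => by simp [hf.reg 3, hc.r3]) (by simpa using h1) ?_
    (fun _ _ _ h => h)
  rintro B τ hB hr hf ⟨i1, i2, i3⟩
  have hcτ := hc.frame hf (by simp [Prog.keeps])
  have k6 : τ.arr 6 = σ.arr 6 := by simp [hf.arr 6]
  have hBL := Nat.mul_le_mul_right (2 * P.L) hB
  rw [Nat.succ_mul, Nat.mul_comm (P.nB ℓ)] at hBL
  have hBL' : B * (2 * P.L) = 2 * (B * P.L) := by ring
  refine .cons_assign (B * P.L) (by simp [hr]) (lin _ (by omega)) ?_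
  refine .cons_assign P.L (by simp) (lin _ (by omega)) ?_
  refine .cons (c₁ := 3 * P.L + 7) ((Runs.readDig 6 (by simpa [k6] using h6) (by simp; omega)
    (lin _ (by simp; omega))).mono (by simp)) ?_
  intro τ1 f1 e1
  simp only [State.setReg_reg_self, State.setReg_arr, k6,
    State.setReg_reg_ne _ _ (show 10 ≠ 12 by norm_num)] at e1
  set u := dig 2 (σ.arr 6) (B * P.L) P.L with hu
  have hult : u < 2 ^ P.L := dig_lt fun _ _ => Nat.lt_succ_iff.2 (h6 _)
  have henc := P.encT_lt u hult
  have hpow := S.pow_L_le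
  refine .cons_assign (n + B * (2 * P.L)) (by simp [f1.reg 2, f1.reg 54, hcτ.r2, hr])
    (lin _ (by omega)) ?_
  refine .cons_assign (2 * P.L) (by simp) (lin _ (by omega)) ?_
  refine .cons_assign (P.encT u) (by simp [f1.arr 4, hf.arr 4, e1, h4 u hult])
    (lin _ (by omega)) ?_
  refine .cons (c₁ := 5 * (2 * P.L) + 2) ((Runs.writeBits 1 (by omega)).mono (by simp)) ?_
  intro τ2 f2 e2
  have k1 : τ1.arr 1 = τ.arr 1 := by simp [f1.arr 1]
  simp only [State.setReg_reg_self, State.setReg_arr, k1,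
    State.setReg_reg_ne _ _ (show 21 ≠ 22 by norm_num),
    State.setReg_reg_ne _ _ (show 20 ≠ 22 by norm_num),
    State.setReg_reg_ne _ _ (show 20 ≠ 21 by norm_num)] at e2
  refine .nil ?_
  simp only [State.setReg_arr, e2]
  refine ⟨putBits_le i1 _ _ _, fun i hi => ?_, fun B' hB' => ?_⟩
  · rw [putBits, if_neg (by omega)]; exact i2 i hi
  · by_cases h : B' = B
    · subst h; exact dig_putBits _ henc
    · have h1 : (B' + 1) * (2 * P.L) ≤ B * (2 * P.L) := Nat.mul_le_mul_right _ (by omega)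
      rw [Nat.succ_mul] at h1
      rw [dig_putBits_of_disjoint _ (.inl (by omega))]
      exact i3 B' (by omega)

/-- The initial memory for a binary string. -/
structure Fresh (σ : State) : Prop where
  reg : ∀ i ≠ 0, σ.reg i = 0
  arr : ∀ a ≠ 0, ∀ i, σ.arr a i = 0
  bits : ∀ i, σ.arr 0 i ≤ 1

/-- Put the syndromes of the first `reg 24` bits of array `1` with respect to all patterns into
array `5`. -/
def syndromesP (P : Par) : Prog := forP 25 (.lit P.M) (block [
  .assign 26 (.reg 25 * .lit (2 * P.k)),
  sketchP P 1 5])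

@[simp] theorem syndromesP_wr (P : Par) (i : ℕ) : (syndromesP P).wr i =
    ((10 ≤ i && i ≤ 15) || (25 ≤ i && i ≤ 29) || (31 ≤ i && i ≤ 35)) := by
  simp only [syndromesP, block, Prog.wr, forP_wr, sketchP_wr]
  rw [Bool.eq_iff_iff]; simp; omega
@[simp] theorem syndromesP_wa (P : Par) (i : ℕ) :
    (syndromesP P).wa i = (i == 5 || i == 8 || i == 9) := by
  simp only [syndromesP, block, Prog.wa, forP_wa, sketchP_wa]; grind

theorem Runs.syndromesP {P : Par} {ℓ n b : ℕ} {σ : State} (S : Sizes P ℓ n b) (hc : Ctx P ℓ n σ)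
    (h1 : ∀ i, σ.arr 1 i ≤ 1) (h3 : ∀ i < 2 ^ P.L, σ.arr 3 i = P.h i) (h24 : σ.reg 24 = n)
    (h5 : ∀ i, σ.arr 5 i = 0) :
    Runs b (syndromesP P) σ (P.M * (sketchCost P ℓ n + 2 + 2) + 2) (fun τ =>
      ∀ p < P.M, ∀ j < 2 * P.k, τ.arr 5 (p * (2 * P.k) + j) = synd P ℓ (σ.arr 1) n p j) := by
  have lin : ∀ v, v ≤ 16 * 2 ^ ℓ → v < 2 ^ b := fun v hv => S.lt_of_lin hv
  have hn := S.n_lt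
  have hM := S.M_le
  have hk := S.synd_le
  set X := σ.arr 1 with hX
  refine .for_const P.M (sketchCost P ℓ n + 2) (fun p τ =>
      (∀ p' < p, ∀ j < 2 * P.k, τ.arr 5 (p' * (2 * P.k) + j) = synd P ℓ X n p' j) ∧
      -- Syndromes are accumulated, so the cells ahead must still be zero.
      ∀ e, p * (2 * P.k) ≤ e → τ.arr 5 e = 0)
    (by simp) (lin _ (by omega)) (fun τ hf => by simp) (by simpa using h5) ?_
    (fun _ _ _ h => h.1)
  rintro p τ hp hr hf ⟨i1, i2⟩
  have hcτ := hc.frame hf (by simp [Prog.keeps])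
  have hpk := Nat.mul_le_mul_right (2 * P.k) hp
  rw [Nat.succ_mul, Nat.mul_comm P.M] at hpk
  refine .cons_assign (p * (2 * P.k)) (by simp [hr]) (lin _ (by omega)) ?_
  have hc' : Ctx P ℓ n (τ.setReg 26 (p * (2 * P.k))) :=
    ⟨hcτ.r2, hcτ.r3, hcτ.r4, hcτ.r5, hcτ.r6, hcτ.r7, hcτ.r8, hcτ.r9, hcτ.r16⟩
  have k24 : τ.reg 24 = n := by simp [hf.reg 24, h24]
  have k1 : τ.arr 1 = X := by simp [hf.arr 1, hX]
  refine .cons (c₁ := sketchCost P ℓ n) ((Runs.sketchP (a := 1) (o := 5) S hc'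
    (by simpa [k1] using h1) (by simpa [hf.arr 3] using h3) (by norm_num) (by norm_num)
    (by norm_num) (by norm_num) (by norm_num) (by norm_num) (by simpa [k24] using hn)
    (fun j _ => by simpa using i2 _ (by simp))).mono (by simp [k24])) ?_
  rintro τ1 f1 ⟨-, -, -, e1⟩
  simp only [State.setReg_reg_self, State.setReg_arr, k1, hr, k24,
    State.setReg_reg_ne _ _ (show 24 ≠ 26 by norm_num),
    State.setReg_reg_ne _ _ (show 25 ≠ 26 by norm_num)] at e1
  refine .nil ?_
  simp only [State.setReg_arr, e1]
  refine ⟨fun p' hp' j hj => ?_, fun e he => ?_⟩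
  · by_cases h : p' = p
    · subst h
      rw [if_pos (by omega), Nat.add_sub_cancel_left]
    · have h1 : (p' + 1) * (2 * P.k) ≤ p * (2 * P.k) := Nat.mul_le_mul_right _ (by omega)
      rw [Nat.succ_mul] at h1
      rw [if_neg (by omega)]
      exact i1 p' (by omega) j hj
  · rw [Nat.add_mul, Nat.one_mul] at he
    rw [if_neg (by omega)]
    exact i2 e (by omega)

/-- The encoder. -/
def encodeP (P : Par) : Prog := block [
  table 3 P.h (2 ^ P.L),
  table 4 P.encT (2 ^ P.L),
  .assign 4 1,
  forP 54 (.reg 0) bumpP,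
  paramsP P,
  greedyP P,
  maskP P 0 1 7,
  .assign 24 (.reg 2),
  syndromesP P,
  redundancyP P,
  blocksP P,
  .assign 1 (.reg 2 + .lit (2 * P.L) * blocksE P),
  .assign 0 1]

/-- A bound for the number of steps of `encodeP`. -/
def encodeCost (P : Par) (ℓ n : ℕ) : ℕ :=
  2 * (2 ^ P.L + 1) + (n * (7 + 2) + 2) + (sieveCost ℓ + 6) + greedyCost P ℓ n +
    ((n * (1 + 2) + 2) + ((n + 1) * (8 * P.m + 16 + 2) + 2) + 1) +
    (P.M * (sketchCost P ℓ n + 2 + 2) + 2) +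
    ((P.J ℓ * (5 * P.m + 6 + 2) + 2) + (2 * P.k * P.M * (5 * (ℓ + 1) + 6 + 2) + 2) + 1) +
    (P.nB ℓ * (13 * P.L + 16 + 2) + 2) + 5

theorem Runs.encodeP {P : Par} {n b : ℕ} {σ : State} (S : Sizes P n.size n b) (hF : Fresh σ)
    (h0 : σ.reg 0 = n) :
    Runs b (encodeP P) σ (encodeCost P n.size n) (fun τ => τ.reg 0 = 1 ∧
      τ.reg 1 = n + 2 * P.L * P.nB n.size ∧
      ∃ t R, IsCodeword P n.size n (σ.arr 0) t R (τ.arr 1)) := by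
  have lin : ∀ v, v ≤ 16 * 2 ^ n.size → v < 2 ^ b := fun v hv => S.lt_of_lin hv
  have hn := S.n_lt
  have hb := S.le_b
  have hcode := S.code_le
  have hpow := S.pow_L_le
  refine .cons (c₁ := 2 ^ P.L + 1) (.table 3 P.h _ fun i _ => lin _ (by have := S.h_lt i; omega))
    ?_ (by unfold encodeCost; omega)
  intro τ1 f1 e1
  refine .cons (c₁ := 2 ^ P.L + 1) (.table 4 P.encT _ fun i hi =>
    lin _ (by have := P.encT_lt i hi; omega)) ?_ (by unfold encodeCost; omega)
  intro τ2 f2 e2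
  refine .cons_assign 1 (by simp) (lin _ (by omega)) ?_ (by unfold encodeCost; omega)
  refine .cons_for n 7 (fun j τ => Counter j τ) (by simp) (lin _ (by omega))
    (fun τ hf => by simp [hf.reg 0, f2.reg 0, f1.reg 0, h0]) ?_ ?_ ?_ (by unfold encodeCost; omega)
  · exact ⟨by simp [f2.reg 2, f1.reg 2, hF.reg 2], by simp [f2.reg 3, f1.reg 3, hF.reg 3],
      by simp⟩
  · intro j τ hj hr hf inv
    refine (Runs.bumpP inv ?_).conseq fun τ' _ _ h => ⟨by simpa using h.r2, by simpa using h.r3,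
      by simpa using h.r4⟩
    have := Nat.size_le_size (show j + 1 ≤ n by omega)
    omega
  intro τ3 f3 e3
  refine .cons (c₁ := sieveCost n.size + 6) (.paramsP S e3 ?_) ?_ (by unfold encodeCost; omega)
  · simpa [f3.arr 2, f2.arr 2, f1.arr 2] using hF.arr 2 (by norm_num)
  intro τ4 f4 c4
  have k0 : τ4.arr 0 = σ.arr 0 := by
    simp [f4.arr 0, f3.arr 0, f2.arr 0, f1.arr 0]
  refine .cons (c₁ := greedyCost P n.size n) (.greedyP S c4 (by rw [k0]; exact hF.bits) ?_) ?_
    (by unfold encodeCost; omega)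
  · simpa [f4.arr 16, f3.arr 16, f2.arr 16, f1.arr 16] using hF.arr 16 (by norm_num)
  rintro τ5 f5 ⟨g1, g2⟩
  rw [k0] at g2
  have c5 := c4.frame f5 (by simp [Prog.keeps])
  have l0 : τ5.arr 0 = σ.arr 0 := by simp [f5.arr 0, k0]
  refine .cons (c₁ := (n * (1 + 2) + 2) + ((n + 1) * (8 * P.m + 16 + 2) + 2) + 1)
    (.maskP (a := 0) (o := 1) (mk := 7) S c5 (by rw [l0]; exact hF.bits) ?_ (by norm_num)
      (by norm_num)) ?_ (by unfold encodeCost; omega)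
  · have : ∀ i, σ.arr 1 i ≤ 1 := fun i => by simp [hF.arr 1 (by norm_num) i]
    simpa [f5.arr 1, f4.arr 1, f3.arr 1, f2.arr 1, f1.arr 1] using this
  rintro τ6 f6 ⟨m1, m2⟩
  rw [l0] at m2
  have c6 := c5.frame f6 (by simp [Prog.keeps])
  refine .cons_assign n (by simp [c6.r2]) (lin _ (by omega)) ?_ (by unfold encodeCost; omega)
  have c6' : Ctx P n.size n (τ6.setReg 24 n) :=
    ⟨c6.r2, c6.r3, c6.r4, c6.r5, c6.r6, c6.r7, c6.r8, c6.r9, c6.r16⟩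
  refine .cons (c₁ := P.M * (sketchCost P n.size n + 2 + 2) + 2)
    (.syndromesP S c6' (by simpa using m1) ?_ (by simp) ?_) ?_ (by unfold encodeCost; omega)
  · simpa [f6.arr 3, f5.arr 3, f4.arr 3, f3.arr 3, f2.arr 3] using e1
  · simpa [f6.arr 5, f5.arr 5, f4.arr 5, f3.arr 5, f2.arr 5, f1.arr 5] using hF.arr 5 (by norm_num)
  intro τ7 f7 s7
  rw [State.setReg_arr] at s7
  have c7 := c6'.frame f7 (by simp [Prog.keeps])
  have l7 : τ7.arr 7 = τ5.arr 7 := by simp [f7.arr 7, f6.arr 7]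
  have l1 : τ7.arr 1 = τ6.arr 1 := by simp [f7.arr 1]
  refine .cons (c₁ := (P.J n.size * (5 * P.m + 6 + 2) + 2) +
      (2 * P.k * P.M * (5 * (n.size + 1) + 6 + 2) + 2) + 1)
    (.redundancyP S c7 ?_ (by rw [l7]; exact g1) ?_) ?_ (by unfold encodeCost; omega)
  · have : ∀ i, σ.arr 6 i ≤ 1 := fun i => by simp [hF.arr 6 (by norm_num) i]
    simpa [f7.arr 6, f6.arr 6, f5.arr 6, f4.arr 6, f3.arr 6, f2.arr 6, f1.arr 6] using this
  · intro e he
    have hk : 0 < 2 * P.k := by have := P.two_le_k; omega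
    have h := s7 (e / (2 * P.k)) (Nat.div_lt_of_lt_mul he) (e % (2 * P.k)) (Nat.mod_lt _ hk)
    rw [Nat.mul_comm (e / _), Nat.div_add_mod] at h
    rw [h]
    exact Nat.mod_lt _ (modulus_spec _).1.pos
  rintro τ8 f8 ⟨r1, r2, r3⟩
  have c8 := c7.frame f8 (by simp [Prog.keeps])
  refine .cons (c₁ := P.nB n.size * (13 * P.L + 16 + 2) + 2) (.blocksP S c8 r1 ?_ ?_) ?_
    (by unfold encodeCost; omega)
  · simpa [f8.arr 1, l1] using m1
  · simpa [f8.arr 4, f7.arr 4, f6.arr 4, f5.arr 4, f4.arr 4, f3.arr 4] using e2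
  rintro τ9 f9 ⟨q1, q2, q3⟩
  have c9 := c8.frame f9 (by simp [Prog.keeps])
  -- The code blocks are written from position `n` on and leave the masked string intact.
  have hq2 : ∀ i < n, τ9.arr 1 i = τ6.arr 1 i := fun i hi => by
    rw [q2 i hi, f8.arr 1 (by simp), l1]
  refine .cons_assign (n + 2 * P.L * P.nB n.size) (by simp [c9.r2, c9.r3]) (lin _ (by omega)) ?_
    (by unfold encodeCost; omega)
  refine .cons_assign 1 (by simp) (lin _ (by omega)) (.nil ⟨by simp, by simp, τ5.arr 7, τ8.arr 6,
    ?_⟩ (by unfold encodeCost; omega)) (by unfold encodeCost; omega)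
  simp only [State.setReg_arr]
  have hsh := m2.congr hq2
  refine ⟨q1, r1, g1, hsh, hsh.mixed g2, q3, fun j hj => by rw [r2 j hj, l7], fun p hp j hj => ?_⟩
  · have h1 : p * (2 * P.k) + j < 2 * P.k * P.M := by
      have := Nat.mul_le_mul_right (2 * P.k) hp
      rw [Nat.succ_mul, Nat.mul_comm P.M] at this; omega
    rw [r3 _ h1, s7 p hp j hj]
    exact synd_congr (fun i hi => (hq2 i hi).symm) p j

theorem Shifted.congr_left {P : Par} {ℓ n : ℕ} {s s' t x : ℕ → ℕ} (h : Shifted P ℓ n s t x)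
    (hs : ∀ i < n, s i = s' i) : Shifted P ℓ n s' t x := by
  refine ⟨fun g hg => ?_, fun i hi hd => (h.tail i hi hd).trans (hs i hi)⟩
  rw [h.seg g hg]
  congr 2
  refine dig_congr fun i hi => hs _ ?_
  have h1 := Nat.mul_le_mul_right P.m hg
  rw [← P.d_mul, Nat.succ_mul] at h1
  have := Nat.div_mul_le_self n (P.d ℓ)
  omega

/-! ### Recovering the parameters and the redundancy in the decoder -/

/-- The length of the code. -/
def Par.length (P : Par) (n : ℕ) : ℕ := n + 2 * P.L * P.nB n.size

/-- The decoder is given only the received word; by monotonicity its length determines `n`. -/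
theorem Par.length_strictMono (P : Par) : StrictMono P.length := by
  intro a b h
  have hs : a.size ≤ b.size := Nat.size_le_size h.le
  refine Nat.add_lt_add_of_lt_of_le h (Nat.mul_le_mul_left _ ?_)
  unfold Par.nB Par.rho Par.d Par.J
  gcongr

/-- Find `n`, given the length of the received word. -/
def findP (P : Par) : Prog := block [
  .assign 4 1,
  forP 54 (.reg 0 + .lit P.k) (.ite ((.reg 2 + .lit (2 * P.L) * blocksE P : Expr).lt
    (.reg 0 + .lit P.k)) bumpP .nop)]

@[simp] theorem findP_wa (P : Par) (i : ℕ) : (findP P).wa i = false := by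
  simp [findP]

/-- The trial value grows until its code length reaches the true one and then stays put, hence the
`min` in the invariant. The number of rounds is the code length, which is at least `n`. -/
theorem Runs.findP {P : Par} {n b : ℕ} {σ : State} (S : Sizes P n.size n b)
    (h0 : σ.reg 0 + P.k = P.length n) (h2 : σ.reg 2 = 0) (h3 : σ.reg 3 = 0) :
    Runs b (findP P) σ (P.length n * (8 + 2) + 4) (Counter n) := by
  have lin : ∀ v, v ≤ 16 * 2 ^ n.size → v < 2 ^ b := fun v hv => S.lt_of_lin hv
  have hn := S.n_lt
  have hcode := S.code_le
  have hb := S.le_b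
  have hN : P.length n = n + 2 * P.L * P.nB n.size := rfl
  refine .cons_assign 1 (by simp) (lin _ (by omega)) ?_
  refine .cons_for (P.length n) 8 (fun j τ => Counter (min j n) τ) (by simp) (lin _ (by omega))
    (fun τ hf => by simp [hf.reg 0, h0]) ?_ ?_ (fun τ _ h => .nil ?_)
  · exact ⟨by simp [h2], by simp [h3], by simp⟩
  · intro j τ hj hr hf inv
    have k0 : τ.reg 0 = σ.reg 0 := by simp [hf.reg 0]
    have key : (.reg 2 + .lit (2 * P.L) * blocksE P : Expr).eval τ = P.length (min j n) := by
      simp [inv.r2, inv.r3, Par.length]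
    have key' : (.reg 0 + .lit P.k : Expr).eval τ = P.length n := by simp [k0, h0]
    refine .ite' (fun he => ?_) (fun he => ?_)
    · rw [Expr.eval_lt_ne_zero, key, key', P.length_strictMono.lt_iff_lt] at he
      rw [show min (j + 1) n = min j n + 1 by omega]
      refine (Runs.bumpP inv ?_).conseq fun τ' _ _ h => ⟨by simpa using h.r2, by simpa using h.r3,
        by simpa using h.r4⟩
      have := Nat.size_le_size (show min j n + 1 ≤ n by omega)
      omega
    · have : ¬ min j n < n := fun h =>
        Expr.eval_lt_ne_zero.2 (by rw [key, key']; exact P.length_strictMono h) he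
      rw [show min (j + 1) n = min j n by omega]
      exact (Runs.nop ⟨by simpa using inv.r2, by simpa using inv.r3, by simpa using inv.r4⟩).mono
        (by omega)
  · rwa [min_eq_right (by omega)] at h

/-- Decode the blocks of array `0` and write the result to array `6`. -/
def unblockP (P : Par) : Prog := forP 54 (blocksE P) (block [
  .assign 10 (.reg 2 + .reg 54 * .lit (2 * P.L)),
  .assign 12 (.lit (2 * P.L - P.k)),
  readDig 0,
  .assign 20 (.reg 54 * .lit P.L),
  .assign 21 (.lit P.L),
  .assign 22 (.get 4 (.reg 13)),
  writeBits 6])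

@[simp] theorem unblockP_wr (P : Par) (i : ℕ) : (unblockP P).wr i =
    ((10 ≤ i && i ≤ 15) || (20 ≤ i && i ≤ 23) || i == 54) := by
  simp only [unblockP, block, Prog.wr, forP_wr, readDig_wr, writeBits_wr]
  rw [Bool.eq_iff_iff]; simp; omega
@[simp] theorem unblockP_wa (P : Par) (i : ℕ) : (unblockP P).wa i = (i == 6) := by
  simp [unblockP]

theorem Runs.unblockP {P : Par} {ℓ n b : ℕ} {σ : State} (S : Sizes P ℓ n b) (hc : Ctx P ℓ n σ)
    (h0 : ∀ i, σ.arr 0 i ≤ 1) (h6 : ∀ i, σ.arr 6 i ≤ 1)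
    (h4 : ∀ u < 2 ^ (2 * P.L - P.k), σ.arr 4 u = P.decT u) :
    Runs b (unblockP P) σ (P.nB ℓ * (11 * P.L + 16 + 2) + 2) (fun τ => (∀ i, τ.arr 6 i ≤ 1) ∧
        ∀ B < P.nB ℓ, dig 2 (τ.arr 6) (B * P.L) P.L =
          P.decT (dig 2 (σ.arr 0) (n + B * (2 * P.L)) (2 * P.L - P.k))) := by
  have lin : ∀ v, v ≤ 16 * 2 ^ ℓ → v < 2 ^ b := fun v hv => S.lt_of_lin hv
  have hn := S.n_lt
  have hL := S.L_le
  have hb := S.le_b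
  have hcode := S.code_le
  have hlb : ℓ < 2 ^ ℓ := Nat.lt_two_pow_self
  have hLpos := P.L_pos
  have hnB : P.nB ℓ ≤ 2 ^ ℓ := (Nat.le_mul_of_pos_left _ (by omega)).trans hcode
  refine .for_const (P.nB ℓ) (11 * P.L + 16) (fun B τ => (∀ i, τ.arr 6 i ≤ 1) ∧
        ∀ B' < B, dig 2 (τ.arr 6) (B' * P.L) P.L =
          P.decT (dig 2 (σ.arr 0) (n + B' * (2 * P.L)) (2 * P.L - P.k)))
    (by simp) (lin _ (by omega)) (fun τ hf => by simp [hf.reg 3, hc.r3]) (by simpa using h6) ?_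
    (fun _ _ _ h => h)
  rintro B τ hB hr hf ⟨i1, i3⟩
  have hcτ := hc.frame hf (by simp [Prog.keeps])
  have k0 : τ.arr 0 = σ.arr 0 := by simp [hf.arr 0]
  have hBL := Nat.mul_le_mul_right (2 * P.L) hB
  rw [Nat.succ_mul, Nat.mul_comm (P.nB ℓ)] at hBL
  have hBL' : B * (2 * P.L) = 2 * (B * P.L) := by ring
  refine .cons_assign (n + B * (2 * P.L)) (by simp [hr, hcτ.r2]) (lin _ (by omega)) ?_
  refine .cons_assign (2 * P.L - P.k) (by simp) (lin _ (by omega)) ?_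
  refine .cons (c₁ := 3 * (2 * P.L - P.k) + 7) ((Runs.readDig 0 (by simpa [k0] using h0)
    (by simp; omega) (lin _ (by simp; omega))).mono (by simp)) ?_
  intro τ1 f1 e1
  simp only [State.setReg_reg_self, State.setReg_arr, k0,
    State.setReg_reg_ne _ _ (show 10 ≠ 12 by norm_num)] at e1
  set u := dig 2 (σ.arr 0) (n + B * (2 * P.L)) (2 * P.L - P.k) with hu
  have hult : u < 2 ^ (2 * P.L - P.k) := dig_lt fun _ _ => Nat.lt_succ_iff.2 (h0 _)
  have hdec := P.decT_lt u
  have hpow := S.pow_L_le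
  have hpow' : 2 ^ P.L ≤ 2 ^ (2 * P.L) := Nat.pow_le_pow_right (by norm_num) (by omega)
  refine .cons_assign (B * P.L) (by simp [f1.reg 54, hr]) (lin _ (by omega)) ?_
  refine .cons_assign P.L (by simp) (lin _ (by omega)) ?_
  refine .cons_assign (P.decT u) (by simp [f1.arr 4, hf.arr 4, e1, h4 u hult])
    (lin _ (by omega)) ?_
  refine .cons (c₁ := 5 * P.L + 2) ((Runs.writeBits 6 (by omega)).mono (by simp)) ?_
  intro τ2 f2 e2
  have k6 : τ1.arr 6 = τ.arr 6 := by simp [f1.arr 6]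
  simp only [State.setReg_reg_self, State.setReg_arr, k6,
    State.setReg_reg_ne _ _ (show 21 ≠ 22 by norm_num),
    State.setReg_reg_ne _ _ (show 20 ≠ 22 by norm_num),
    State.setReg_reg_ne _ _ (show 20 ≠ 21 by norm_num)] at e2
  refine .nil ?_
  simp only [State.setReg_arr, e2]
  refine ⟨putBits_le i1 _ _ _, fun B' hB' => ?_⟩
  by_cases h : B' = B
  · subst h; exact dig_putBits _ hdec
  · have h1 : (B' + 1) * P.L ≤ B * P.L := Nat.mul_le_mul_right _ (by omega)
    rw [Nat.succ_mul] at h1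
    rw [dig_putBits_of_disjoint _ (.inl (by omega))]
    exact i3 B' (by omega)

/-- Read the inverse mask and the syndromes from array `6` into the arrays `7` and `5`. -/
def unpackP (P : Par) : Prog := block [
  forP 54 (.reg 6) (block [
    .assign 10 (.reg 54 * .lit P.m),
    .assign 12 (.lit P.m),
    readDig 6,
    .store 7 (.reg 54) (.lit P.M - .reg 13)]),
  forP 54 (.lit (2 * P.k * P.M)) (block [
    .assign 10 (.reg 7 + .reg 54 * (.reg 3 + 1)),
    .assign 12 (.reg 3 + 1),
    readDig 6,
    .store 5 (.reg 54) (.reg 13)])]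

@[simp] theorem unpackP_wr (P : Par) (i : ℕ) : (unpackP P).wr i =
    ((10 ≤ i && i ≤ 15) || i == 54) := by
  simp only [unpackP, block, Prog.wr, forP_wr, readDig_wr]
  rw [Bool.eq_iff_iff]; simp; omega
@[simp] theorem unpackP_wa (P : Par) (i : ℕ) : (unpackP P).wa i = (i == 7 || i == 5) := by
  simp [unpackP]

theorem Runs.unpackP {P : Par} {ℓ n b : ℕ} {σ : State} (S : Sizes P ℓ n b) (hc : Ctx P ℓ n σ)
    (h6 : ∀ i, σ.arr 6 i ≤ 1) :
    Runs b (unpackP P) σ ((P.J ℓ * (3 * P.m + 11 + 2) + 2) +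
      (2 * P.k * P.M * (3 * (ℓ + 1) + 11 + 2) + 2) + 1) (fun τ =>
        (∀ j < P.J ℓ, τ.arr 7 j = P.M - dig 2 (σ.arr 6) (j * P.m) P.m) ∧
        ∀ e < 2 * P.k * P.M, τ.arr 5 e = dig 2 (σ.arr 6) (P.d ℓ + e * (ℓ + 1)) (ℓ + 1)) := by
  have lin : ∀ v, v ≤ 16 * 2 ^ ℓ → v < 2 ^ b := fun v hv => S.lt_of_lin hv
  have hrho := P.rho_lt_of_sizes S
  rw [Par.rho] at hrho
  have hJ := S.J_le
  have hb := S.le_b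
  have hm := S.m_le
  have hM := S.M_le
  have hk := S.synd_le
  have hlb : ℓ < 2 ^ ℓ := Nat.lt_two_pow_self
  have hd : P.J ℓ * P.m = P.d ℓ := Nat.mul_comm _ _
  refine .cons_for (P.J ℓ) (3 * P.m + 11) (fun j τ =>
      ∀ j' < j, τ.arr 7 j' = P.M - dig 2 (σ.arr 6) (j' * P.m) P.m)
    (by simp) (lin _ (by omega)) (fun τ hf => by simp [hf.reg 6, hc.r6]) (by simp) ?_ ?_
  · rintro j τ hj hr hf i2
    have hjm := Nat.mul_le_mul_right P.m hj
    rw [Nat.succ_mul] at hjm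
    have k6 : τ.arr 6 = σ.arr 6 := by simp [hf.arr 6]
    refine .cons_assign (j * P.m) (by simp [hr]) (lin _ (by omega)) ?_
    refine .cons_assign P.m (by simp) (lin _ (by omega)) ?_
    refine .cons (c₁ := 3 * P.m + 7) ((Runs.readDig 6 (by simpa [k6] using h6)
      (by simp; omega) (lin _ (by simp; omega))).mono (by simp)) ?_
    intro τ1 f1 e1
    simp only [State.setReg_reg_self, State.setReg_arr, k6,
      State.setReg_reg_ne _ _ (show 10 ≠ 12 by norm_num)] at e1
    refine .cons_store j (P.M - dig 2 (σ.arr 6) (j * P.m) P.m) (by simp [f1.reg 54, hr])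
      (by simp [e1]) (lin _ (by omega)) (.nil fun j' hj' => ?_)
    simp only [State.setReg_arr, State.setArr_arr_self, Function.update_apply]
    split_ifs with h
    · rw [h]
    · simpa [f1.arr 7] using i2 j' (by omega)
  rintro τ0 f0 a2
  have hc0 := hc.frame f0 (by simp [Prog.keeps])
  refine .cons_for (2 * P.k * P.M) (3 * (ℓ + 1) + 11) (fun e τ =>
      ∀ e' < e, τ.arr 5 e' = dig 2 (σ.arr 6) (P.d ℓ + e' * (ℓ + 1)) (ℓ + 1))
    (by simp) (lin _ (by omega)) (fun τ hf => by simp) (by simp) ?_ ?_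
  · rintro e τ he hr hf i2
    have hcτ := hc0.frame hf (by simp [Prog.keeps])
    have hel := Nat.mul_le_mul_right (ℓ + 1) he
    rw [Nat.succ_mul] at hel
    have k6 : τ.arr 6 = σ.arr 6 := by simp [hf.arr 6, f0.arr 6]
    refine .cons_assign (P.d ℓ + e * (ℓ + 1)) (by simp [hr, hcτ.r7, hcτ.r3]) (lin _ (by omega)) ?_
    refine .cons_assign (ℓ + 1) (by simp [hcτ.r3]) (lin _ (by omega)) ?_
    refine .cons (c₁ := 3 * (ℓ + 1) + 7) ((Runs.readDig 6 (by simpa [k6] using h6)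
      (by simp; omega) (lin _ (by simp; omega))).mono (by simp)) ?_
    intro τ1 f1 e1
    simp only [State.setReg_reg_self, State.setReg_arr, k6,
      State.setReg_reg_ne _ _ (show 10 ≠ 12 by norm_num)] at e1
    have hlt : dig 2 (σ.arr 6) (P.d ℓ + e * (ℓ + 1)) (ℓ + 1) < 2 ^ (ℓ + 1) :=
      dig_lt fun _ _ => Nat.lt_succ_iff.2 (h6 _)
    rw [pow_succ] at hlt
    refine .cons_store e _ (by simp [f1.reg 54, hr]) (by simpa using e1)
      (lin _ (by omega)) (.nil fun j' hj' => ?_)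
    simp only [State.setReg_arr, State.setArr_arr_self, Function.update_apply]
    split_ifs with h
    · rw [h]
    · simpa [f1.arr 5] using i2 j' (by omega)
  · rintro τ hf i2
    refine .nil ⟨fun j hj => ?_, i2⟩
    rw [hf.arr 7 (by simp)]; exact a2 j hj

/-! ### The vote over all patterns and the decoder -/

/-- Decode by means of all patterns and count in array `14` how often every bit is one. -/
def voteP (P : Par) : Prog := forP 25 (.lit P.M) (block [
  .assign 26 (.reg 25 * .lit (2 * P.k)),
  decodeP P,
  forP 54 (.reg 2) (.store 14 (.reg 54) (.get 14 (.reg 54) + .get 13 (.reg 54)))])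

@[simp] theorem voteP_wr (P : Par) (i : ℕ) : (voteP P).wr i =
    ((10 ≤ i && i ≤ 15) || (20 ≤ i && i ≤ 23) || (25 ≤ i && i ≤ 29) ||
      (31 ≤ i && i ≤ 35) || (40 ≤ i && i ≤ 47) || (49 ≤ i && i ≤ 54)) := by
  simp only [voteP, block, Prog.wr, forP_wr, decodeP_wr]
  rw [Bool.eq_iff_iff]; simp; omega
@[simp] theorem voteP_wa (P : Par) (i : ℕ) : (voteP P).wa i =
    ((8 ≤ i && i ≤ 14) || i == 18 || i == 19) := by
  simp only [voteP, block, Prog.wa, forP_wa, decodeP_wa]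
  rw [Bool.eq_iff_iff]; simp; omega

theorem card_filter_succ (G : Finset ℕ) (p : ℕ) : (G.filter (· < p + 1)).card =
    (G.filter (· < p)).card + if p ∈ G then 1 else 0 := by
  have : G.filter (· < p + 1) = G.filter (· < p) ∪ if p ∈ G then {p} else ∅ := by
    ext r
    split_ifs with h
    · simp only [Finset.mem_filter, Finset.mem_union, Finset.mem_singleton]
      constructor
      · rintro ⟨h1, h2⟩
        by_cases hr : r = p
        · exact .inr hr
        · exact .inl ⟨h1, by omega⟩
      · rintro (⟨h1, h2⟩ | rfl)
        · exact ⟨h1, by omega⟩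
        · exact ⟨h, by omega⟩
    · simp only [Finset.mem_filter, Finset.union_empty]
      refine and_congr_right fun hr => ?_
      have : r ≠ p := by rintro rfl; exact h hr
      omega
  rw [this, Finset.card_union_of_disjoint]
  · split_ifs <;> simp
  · split_ifs <;> simp

/-- A good pattern votes for the true bit; any other adds at most one vote. The set `G` of good
patterns appears only in the conclusion, since the program does not know it. -/
theorem Runs.voteP {P : Par} {ℓ n b : ℕ} {σ : State} (S : Sizes P ℓ n b) (hc : Ctx P ℓ n σ)
    (h0 : ∀ i, σ.arr 0 i ≤ 1) (h13 : ∀ i, σ.arr 13 i ≤ 1) (h3 : ∀ i < 2 ^ P.L, σ.arr 3 i = P.h i)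
    (h17 : ∀ z < 2 ^ (P.L - P.k), ∀ u < P.c, σ.arr 17 (z * P.c + u) = P.decA (z * P.c + u))
    (h24 : σ.reg 24 = n - P.k) (h10 : ∀ i, σ.arr 10 i = 0) (h14 : ∀ i, σ.arr 14 i = 0) :
    Runs b (voteP P) σ (P.M * (decodeCost P ℓ n + (n * (1 + 2) + 2) + 2 + 2) + 2) (fun τ =>
      (∀ i, τ.arr 14 i ≤ P.M) ∧ ∀ x G, (∀ i, x i ≤ 1) → G ⊆ Finset.range P.M →
        (∀ p ∈ G, (∃ S a, Good P ℓ n p (σ.arr 0) x S a) ∧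
          ∀ j < 2 * P.k, σ.arr 5 (p * (2 * P.k) + j) = synd P ℓ x n p j) →
        ∀ i < n, (x i = 1 → G.card ≤ τ.arr 14 i) ∧ (x i = 0 → τ.arr 14 i + G.card ≤ P.M)) := by
  have lin : ∀ v, v ≤ 16 * 2 ^ ℓ → v < 2 ^ b := fun v hv => S.lt_of_lin hv
  have hn := S.n_lt
  have hM := S.M_le
  have hk := S.synd_le
  set w := σ.arr 0 with hw
  refine .for_const P.M (decodeCost P ℓ n + (n * (1 + 2) + 2) + 2) (fun p τ =>
      (∀ i, τ.arr 13 i ≤ 1) ∧ (∀ y, p * (2 * P.k) ≤ y → τ.arr 10 y = 0) ∧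
      (∀ i, τ.arr 14 i ≤ p) ∧ ∀ x G, (∀ i, x i ≤ 1) → G ⊆ Finset.range P.M →
        (∀ p ∈ G, (∃ S a, Good P ℓ n p w x S a) ∧
          ∀ j < 2 * P.k, σ.arr 5 (p * (2 * P.k) + j) = synd P ℓ x n p j) →
        ∀ i < n, (x i = 1 → (G.filter (· < p)).card ≤ τ.arr 14 i) ∧
          (x i = 0 → τ.arr 14 i + (G.filter (· < p)).card ≤ p))
    (by simp) (lin _ (by omega)) (fun τ hf => by simp) ?_ ?_ ?_
  · exact ⟨h13, by simpa using h10, by simpa using h14, by simp [h14]⟩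
  · rintro p τ hp hr hf ⟨i1, i2, i3, i4⟩
    have hcτ := hc.frame hf (by simp [Prog.keeps])
    have hpk := Nat.mul_le_mul_right (2 * P.k) hp
    rw [Nat.succ_mul, Nat.mul_comm P.M] at hpk
    refine .cons_assign (p * (2 * P.k)) (by simp [hr]) (lin _ (by omega)) ?_
    have hc' : Ctx P ℓ n (τ.setReg 26 (p * (2 * P.k))) :=
      ⟨hcτ.r2, hcτ.r3, hcτ.r4, hcτ.r5, hcτ.r6, hcτ.r7, hcτ.r8, hcτ.r9, hcτ.r16⟩
    have k0 : τ.arr 0 = w := by simp [hf.arr 0, hw]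
    have k5 : τ.arr 5 = σ.arr 5 := by simp [hf.arr 5]
    refine .cons (c₁ := decodeCost P ℓ n) (.decodeP (p := p) S hc' (by simpa [k0] using h0)
      (by simpa using i1) (by simpa [hf.arr 3] using h3) (by simpa [hf.arr 17] using h17)
      (by simp [hf.reg 24, h24]) (by simp [hr])
      (fun j _ => by simpa using i2 _ (by simp))) ?_
    rintro τ1 f1 ⟨e1, e2, e3⟩
    simp only [State.setReg_reg_self, State.setReg_arr, k0, k5] at e2 e3
    have hc1 := hc'.frame f1 (by simp [Prog.keeps])
    have k14 : τ1.arr 14 = τ.arr 14 := by simp [f1.arr 14]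
    refine .cons_for n 1 (fun j τ' => (∀ i < j, τ'.arr 14 i = τ.arr 14 i + τ1.arr 13 i) ∧
        ∀ i, j ≤ i → τ'.arr 14 i = τ.arr 14 i)
      (by simp) (lin _ (by omega)) (fun τ hf => by simp [hf.reg 2, hc1.r2]) (by simp [k14]) ?_ ?_
    · rintro j τ' hj hr' hf' ⟨j1, j2⟩
      have := i3 j
      have := e1 j
      refine .store j (τ.arr 14 j + τ1.arr 13 j) (by simp [hr'])
        (by simp [hr', j2 j le_rfl, hf'.arr 13]) (lin _ (by omega)) ?_
      simp only [State.setReg_arr, State.setArr_arr_self, Function.update_apply]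
      refine ⟨fun i hi => ?_, fun i hi => ?_⟩
      · split_ifs with h
        · rw [h]
        · exact j1 i (by omega)
      · rw [if_neg (by omega)]; exact j2 i (by omega)
    · rintro τ' hf' ⟨j1, j2⟩
      refine .nil ⟨?_, fun y hy => ?_, fun i => ?_, fun x G hx hG hGood i hi => ?_⟩
      · simpa [hf'.arr 13] using e1
      · rw [Nat.add_mul, Nat.one_mul] at hy
        rw [State.setReg_arr, hf'.arr 10 (by simp), e2 y (by omega)]
        exact i2 y (by omega)
      · rw [State.setReg_arr]
        have := i3 i
        have := e1 i
        by_cases h : i < n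
        · rw [j1 i h]; omega
        · rw [j2 i (by omega)]; omega
      · rw [State.setReg_arr, j1 i hi, card_filter_succ]
        obtain ⟨l1, l2⟩ := i4 x G hx hG hGood i hi
        have := e1 i
        split_ifs with h
        · obtain ⟨⟨s, a, hg⟩, hs⟩ := hGood p h
          have := e3 x s a hx hg hs i hi
          rw [this]
          exact ⟨fun h => by have := l1 h; omega, fun h => by have := l2 h; omega⟩
        · exact ⟨fun h => by have := l1 h; omega, fun h => by have := l2 h; omega⟩
  · rintro τ - - ⟨-, -, i3, i4⟩
    refine ⟨i3, fun x G hx hG hGood i hi => ?_⟩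
    have : G.filter (· < P.M) = G :=
      Finset.filter_true_of_mem fun p hp => Finset.mem_range.1 (hG hp)
    simpa [this] using i4 x G hx hG hGood i hi

/-- The decoder. -/
def decoderP (P : Par) : Prog := block [
  table 3 P.h (2 ^ P.L),
  table 17 P.decA (2 ^ (P.L - P.k) * P.c),
  table 4 P.decT (2 ^ (2 * P.L - P.k)),
  findP P,
  paramsP P,
  unblockP P,
  unpackP P,
  .assign 24 (.reg 2 - .lit P.k),
  voteP P,
  forP 54 (.reg 2) (.ite ((Expr.lit P.M).lt (2 * .get 14 (.reg 54)))
    (.store 15 (.reg 54) 1) (.store 15 (.reg 54) 0)),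
  maskP P 15 1 7,
  .assign 1 (.reg 2),
  .assign 0 1]

/-- A bound for the number of steps of `decoderP`. -/
def decoderCost (P : Par) (ℓ n : ℕ) : ℕ :=
  (2 ^ P.L + 1) + (2 ^ (P.L - P.k) * P.c + 1) + (2 ^ (2 * P.L - P.k) + 1) +
    ((n + 2 * P.L * P.nB ℓ) * (8 + 2) + 4) + (sieveCost ℓ + 6) +
    (P.nB ℓ * (11 * P.L + 16 + 2) + 2) +
    ((P.J ℓ * (3 * P.m + 11 + 2) + 2) + (2 * P.k * P.M * (3 * (ℓ + 1) + 11 + 2) + 2) + 1) +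
    (P.M * (decodeCost P ℓ n + (n * (1 + 2) + 2) + 2 + 2) + 2) + (n * (2 + 2) + 2) +
    ((n * (1 + 2) + 2) + ((n + 1) * (8 * P.m + 16 + 2) + 2) + 1) + 4

theorem IsCodeword.redundancy_eq {P : Par} {ℓ n : ℕ} {s t R y w f X : ℕ → ℕ}
    (h : IsCodeword P ℓ n s t R y) (hw : ∀ i, w i ≤ 1) (hX : ∀ i, X i ≤ 1)
    (E : Emb P.k (n + 2 * P.L * P.nB ℓ) y w f)
    (hd : ∀ B < P.nB ℓ, dig 2 X (B * P.L) P.L =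
      P.decT (dig 2 w (n + B * (2 * P.L)) (2 * P.L - P.k))) :
    ∀ i < P.rho ℓ, X i = R i := by
  intro i hi
  have hL := P.L_pos
  have hB : i / P.L < P.nB ℓ := by
    rw [Nat.div_lt_iff_lt_mul hL]; exact hi.trans_le (P.rho_le ℓ)
  have h1 := hd _ hB
  rw [h.decT_eq hw E hB] at h1
  have := (dig_eq_iff (fun _ _ => Nat.lt_succ_iff.2 (hX _))
    (fun _ _ => Nat.lt_succ_iff.2 (h.R_le _))).1 h1 (i % P.L) (Nat.mod_lt _ hL)
  rwa [Nat.mul_comm, Nat.div_add_mod] at this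

/-- Termination and the form of the output are unconditional; the codeword is quantified only in the
last clause, because the program must halt in time on every word of the right length. -/
theorem Runs.decoderP {P : Par} {n b : ℕ} {σ : State} (S : Sizes P n.size n b) (hF : Fresh σ)
    (h0 : σ.reg 0 + P.k = P.length n) (hkn : P.k ≤ n) :
    Runs b (decoderP P) σ (decoderCost P n.size n) (fun τ => τ.reg 0 = 1 ∧ τ.reg 1 = n ∧
      (∀ i, τ.arr 1 i ≤ 1) ∧ ∀ s t R y f, (∀ i, s i ≤ 1) → IsCodeword P n.size n s t R y →
        Emb P.k (P.length n) y (σ.arr 0) f → ∀ i < n, τ.arr 1 i = s i) := by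
  have lin : ∀ v, v ≤ 16 * 2 ^ n.size → v < 2 ^ b := fun v hv => S.lt_of_lin hv
  have hn := S.n_lt
  have hb := S.le_b
  have hcode := S.code_le
  have hpow := S.pow_L_le
  have hpow' : 2 ^ P.L ≤ 2 ^ (2 * P.L) := Nat.pow_le_pow_right (by norm_num) (by omega)
  have hM := S.M_le
  have hMn : n.size < 2 ^ n.size := Nat.lt_two_pow_self
  have hpos : 1 ≤ 2 ^ (2 * P.L - P.k) := Nat.one_le_two_pow
  have hlen : P.length n = n + 2 * P.L * P.nB n.size := rfl
  refine .cons (c₁ := 2 ^ P.L + 1) (.table 3 P.h _ fun i _ => lin _ (by have := S.h_lt i; omega))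
    ?_ (by unfold decoderCost; omega)
  intro τ1 f1 e1
  refine .cons (c₁ := 2 ^ (P.L - P.k) * P.c + 1) (.table 17 P.decA _ fun i _ =>
    lin _ (by have := P.decA_lt i; omega)) ?_ (by unfold decoderCost; omega)
  intro τ2 f2 e2
  refine .cons (c₁ := 2 ^ (2 * P.L - P.k) + 1) (.table 4 P.decT _ fun i _ =>
    lin _ (by have := P.decT_lt i; omega)) ?_ (by unfold decoderCost; omega)
  intro τ3 f3 e3
  refine .cons (c₁ := P.length n * (8 + 2) + 4) (.findP S ?_ ?_ ?_) ?_
    (by rw [hlen]; unfold decoderCost; omega)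
  · simpa [f3.reg 0, f2.reg 0, f1.reg 0] using h0
  · simp [f3.reg 2, f2.reg 2, f1.reg 2, hF.reg 2]
  · simp [f3.reg 3, f2.reg 3, f1.reg 3, hF.reg 3]
  rw [hlen]
  intro τ4 f4 e4
  refine .cons (c₁ := sieveCost n.size + 6) (.paramsP S e4 ?_) ?_ (by unfold decoderCost; omega)
  · simpa [f4.arr 2, f3.arr 2, f2.arr 2, f1.arr 2] using hF.arr 2 (by norm_num)
  intro τ5 f5 c5
  have k0 : τ5.arr 0 = σ.arr 0 := by
    simp [f5.arr 0, f4.arr 0, f3.arr 0, f2.arr 0, f1.arr 0]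
  refine .cons (c₁ := P.nB n.size * (11 * P.L + 16 + 2) + 2) (.unblockP S c5
    (by rw [k0]; exact hF.bits) ?_ ?_) ?_ (by unfold decoderCost; omega)
  · have : ∀ i, σ.arr 6 i ≤ 1 := fun i => by simp [hF.arr 6 (by norm_num) i]
    simpa [f5.arr 6, f4.arr 6, f3.arr 6, f2.arr 6, f1.arr 6] using this
  · simpa [f5.arr 4, f4.arr 4] using e3
  rintro τ6 f6 ⟨r1, r2⟩
  rw [k0] at r2
  have c6 := c5.frame f6 (by simp [Prog.keeps])
  refine .cons (c₁ := (P.J n.size * (3 * P.m + 11 + 2) + 2) +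
      (2 * P.k * P.M * (3 * (n.size + 1) + 11 + 2) + 2) + 1) (.unpackP S c6 r1) ?_
    (by unfold decoderCost; omega)
  rintro τ7 f7 ⟨u1, u2⟩
  have c7 := c6.frame f7 (by simp [Prog.keeps])
  refine .cons_assign (n - P.k) (by simp [c7.r2]) (lin _ (by omega)) ?_
    (by unfold decoderCost; omega)
  have c7' : Ctx P n.size n (τ7.setReg 24 (n - P.k)) :=
    ⟨c7.r2, c7.r3, c7.r4, c7.r5, c7.r6, c7.r7, c7.r8, c7.r9, c7.r16⟩
  have l0 : τ7.arr 0 = σ.arr 0 := by simp [f7.arr 0, f6.arr 0, k0]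
  refine .cons (c₁ := P.M * (decodeCost P n.size n + (n * (1 + 2) + 2) + 2 + 2) + 2)
    (.voteP S c7' (by simpa [l0] using hF.bits) ?_ ?_ ?_ (by simp) ?_ ?_) ?_
    (by unfold decoderCost; omega)
  · have : ∀ i, σ.arr 13 i ≤ 1 := fun i => by simp [hF.arr 13 (by norm_num) i]
    simpa [f7.arr 13, f6.arr 13, f5.arr 13, f4.arr 13, f3.arr 13, f2.arr 13, f1.arr 13] using this
  · simpa [f7.arr 3, f6.arr 3, f5.arr 3, f4.arr 3, f3.arr 3, f2.arr 3] using e1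
  · intro z hz u hu
    have : z * P.c + u < 2 ^ (P.L - P.k) * P.c := by
      have := Nat.mul_le_mul_right P.c hz
      rw [Nat.succ_mul] at this; omega
    simpa [f7.arr 17, f6.arr 17, f5.arr 17, f4.arr 17, f3.arr 17] using e2 _ this
  · simpa [f7.arr 10, f6.arr 10, f5.arr 10, f4.arr 10, f3.arr 10, f2.arr 10, f1.arr 10]
      using hF.arr 10 (by norm_num)
  · simpa [f7.arr 14, f6.arr 14, f5.arr 14, f4.arr 14, f3.arr 14, f2.arr 14, f1.arr 14]
      using hF.arr 14 (by norm_num)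
  rintro τ8 f8 ⟨v1, v2⟩
  simp only [State.setReg_arr, l0] at v2
  have c8 := c7'.frame f8 (by simp [Prog.keeps])
  have l15 : ∀ i, τ8.arr 15 i ≤ 1 := by
    have : ∀ i, σ.arr 15 i ≤ 1 := fun i => by simp [hF.arr 15 (by norm_num) i]
    simpa [f8.arr 15, f7.arr 15, f6.arr 15, f5.arr 15, f4.arr 15, f3.arr 15, f2.arr 15, f1.arr 15]
      using this
  refine .cons_for n 2 (fun j τ => (∀ i, τ.arr 15 i ≤ 1) ∧
      ∀ i < j, τ.arr 15 i = if P.M < 2 * τ8.arr 14 i then 1 else 0)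
    (by simp) (lin _ (by omega)) (fun τ hf => by simp [hf.reg 2, c8.r2]) (by simpa using l15)
    ?_ ?_ (by unfold decoderCost; omega)
  · rintro j τ hj hr hf ⟨i1, i2⟩
    have he : ((Expr.lit P.M).lt (2 * .get 14 (.reg 54))).eval τ ≠ 0 ↔ P.M < 2 * τ8.arr 14 j := by
      rw [Expr.eval_lt_ne_zero]; simp [hf.arr 14, hr]
    refine .ite' (fun h => ?_) (fun h => ?_)
    · rw [he] at h
      refine .store j 1 (by simp [hr]) (by simp) (lin _ (by omega)) ?_
      simp only [State.setReg_arr, State.setArr_arr_self, Function.update_apply]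
      refine ⟨fun i => by split <;> simp [i1], fun i hi => ?_⟩
      by_cases hij : i = j
      · subst hij; simp [h]
      · rw [if_neg hij]; exact i2 i (by omega)
    · have h : ¬ P.M < 2 * τ8.arr 14 j := fun h' => he.2 h' h
      refine .store j 0 (by simp [hr]) (by simp) (lin _ (by omega)) ?_
      simp only [State.setReg_arr, State.setArr_arr_self, Function.update_apply]
      refine ⟨fun i => by split <;> simp [i1], fun i hi => ?_⟩
      by_cases hij : i = j
      · subst hij; simp [h]
      · rw [if_neg hij]; exact i2 i (by omega)
  rintro τ9 f9 ⟨w1, w2⟩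
  have c9 := c8.frame f9 (by simp [Prog.keeps])
  refine .cons (c₁ := (n * (1 + 2) + 2) + ((n + 1) * (8 * P.m + 16 + 2) + 2) + 1)
    (.maskP (a := 15) (o := 1) (mk := 7) S c9 w1 ?_ (by norm_num) (by norm_num)) ?_
    (by unfold decoderCost; omega)
  · have : ∀ i, σ.arr 1 i ≤ 1 := fun i => by simp [hF.arr 1 (by norm_num) i]
    simpa [f9.arr 1, f8.arr 1, f7.arr 1, f6.arr 1, f5.arr 1, f4.arr 1, f3.arr 1, f2.arr 1, f1.arr 1]
      using this
  rintro τ10 f10 ⟨x1, x2⟩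
  have c10 := c9.frame f10 (by simp [Prog.keeps])
  refine .cons_assign n (by simp [c10.r2]) (lin _ (by omega)) ?_ (by unfold decoderCost; omega)
  refine .cons_assign 1 (by simp) (lin _ (by omega)) (.nil ⟨by simp, by simp, by simpa using x1,
    ?_⟩ (by unfold decoderCost; omega)) (by unfold decoderCost; omega)
  intro s t R y f hs hy E
  simp only [State.setReg_arr]
  have hR := hy.redundancy_eq hF.bits r1 E r2
  rw [Par.rho] at hR
  have l7 : τ9.arr 7 = τ7.arr 7 := by simp [f9.arr 7, f8.arr 7]
  -- The masked string is the prefix of length `n`, and it suffers at most `k` deletions by itself.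
  have E' := E.prefix (Nat.le_add_right n _) hkn
  have hsyn : ∀ p < P.M, ∀ j < 2 * P.k,
      τ7.arr 5 (p * (2 * P.k) + j) = synd P n.size y n p j := fun p hp j hj => by
    have h1 : p * (2 * P.k) + j < 2 * P.k * P.M := by
      have := Nat.mul_le_mul_right (2 * P.k) hp
      rw [Nat.succ_mul, Nat.mul_comm P.M] at this; omega
    have h2 := Nat.mul_le_mul_right (n.size + 1) h1
    rw [Nat.succ_mul] at h2
    rw [u2 _ h1, ← hy.R_s p hp j hj]
    exact dig_congr fun i hi => hR _ (by omega)
  have ht : ∀ j < P.J n.size, τ9.arr 7 j = P.M - t j := fun j hj => by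
    have h2 := Nat.mul_le_mul_right P.m hj
    rw [Nat.succ_mul, show P.J n.size * P.m = P.d n.size from Nat.mul_comm _ _] at h2
    rw [l7, u1 j hj, ← hy.R_t j hj]
    congr 1
    exact dig_congr fun i hi => hR _ (by omega)
  classical
  have hgood := card_good E'
  set G := (Finset.range P.M).filter fun p =>
      Aligned P.k n _ (mark y n P.m p) (mark (σ.arr 0) (n - P.k) P.m p) with hG
  have hvote := v2 y G hy.y_le (Finset.filter_subset _ _) fun p hp => by
    obtain ⟨hp, A⟩ := Finset.mem_filter.1 hp
    have hp := Finset.mem_range.1 hp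
    exact ⟨⟨_, _, good_of_aligned hy.y_le hF.bits hn S.D_mul_le (by have := S.two_le; omega) hp E'
      hy.mixed A⟩, hsyn p hp⟩
  -- More than half of the patterns are good, so the majority is right at every bit.
  have hx : ∀ i < n, τ9.arr 15 i = y i := fun i hi => by
    obtain ⟨o1, o2⟩ := hvote i hi
    rw [w2 i hi]
    have := hy.y_le i
    split_ifs with h
    · by_contra hne
      have := o2 (by omega)
      omega
    · by_contra hne
      have := o1 (by omega)
      omega
  exact hy.shifted.inverse (x2.congr_left hx) hs x1 S.J_pos hy.t_lt ht
-- Size conditions for large `n`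
open Filter

/-- For fixed constants the quantities are linear in `ℓ` and thus below `2 ^ ℓ` for large `ℓ`; only
the bound on the hash values needs the choice of `L`. -/
theorem eventually_sizes (P : Par) : ∀ᶠ n : ℕ in atTop, Sizes P n.size n (8 * n.size) := by
  have hsize : Tendsto Nat.size atTop atTop :=
    tendsto_atTop_atTop_of_monotone (fun _ _ => Nat.size_le_size) fun ℓ =>
      ⟨2 ^ ℓ, (Nat.lt_size.2 le_rfl).le⟩
  suffices h : ∀ᶠ ℓ : ℕ in atTop, ∀ n < 2 ^ ℓ, Sizes P ℓ n (8 * ℓ) from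
    (hsize.eventually h).mono fun n hn => hn n (Nat.lt_size_self n)
  set E := 8 * P.m * P.M with hE
  have hm := P.one_le_m
  have hM : 1 ≤ P.M := Nat.one_le_two_pow
  have hE8 : 8 ≤ E := by rw [hE]; nlinarith
  have hEt : Tendsto (fun ℓ : ℕ => E * ℓ) atTop atTop :=
    tendsto_id.const_mul_atTop' (by omega)
  filter_upwards [eventually_pow_le 2, hEt.eventually (eventually_pow_le (8 * E)),
    eventually_ge_atTop (2 * P.L + P.m + 2 + (E + P.L) + (E + 8 * P.k * P.M + 2 * P.L) +
      2 ^ (2 * P.L) * P.c + 2 * P.k * P.M)] with ℓ h2 hE' hℓ n hn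
  have hL := P.L_pos
  have hpos : 1 ≤ 2 ^ (2 * P.L) * P.c := Nat.mul_pos (by positivity) P.c_pos
  have hℓℓ : ℓ ≤ 2 ^ ℓ := Nat.lt_two_pow_self.le
  have hlin : ∀ v a, v ≤ a * ℓ → a ≤ ℓ → v ≤ 2 ^ ℓ := fun v a h h' =>
    (h.trans (Nat.mul_le_mul_right _ h')).trans (by rw [← pow_two]; exact h2)
  have hD : P.D ℓ = E * ℓ := by rw [Par.D, Par.d, Par.J, hE]; ring
  have hnb : P.nb ℓ * P.L ≤ E * ℓ + P.L := by
    rw [Par.nb, Nat.add_mul, Nat.one_mul, hD]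
    exact Nat.add_le_add_right (Nat.div_mul_le_self _ _) _
  have hnB : P.nB ℓ * P.L ≤ P.rho ℓ + P.L := by
    rw [Par.nB, Nat.add_mul, Nat.one_mul]
    exact Nat.add_le_add_right (Nat.div_mul_le_self _ _) _
  have hℓ1 : 1 ≤ ℓ := by omega
  refine ⟨hn, ?_, ?_, ?_, by omega, by omega, by omega, ?_, by omega, by omega, by omega⟩
  · rw [← pow_mul]; exact Nat.pow_le_pow_right (by norm_num) (by omega)
  -- Raised to the power `8 * E = 64 * m * M`, the factor `D = E * ℓ` is at most `2 ^ (E * ℓ)` for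
  -- large `ℓ`, and by `c_pow_le` the colours contribute at most `2 ^ (E * ℓ + L)`. The target is `2
  -- ^ (8 * E * ℓ)`.
  · have h8E : 8 * E ≠ 0 := by omega
    rw [← Nat.pow_le_pow_iff_left h8E, mul_pow, hD]
    have h3 : (P.c ^ P.nb ℓ) ^ (8 * E) ≤ 2 ^ (E * ℓ + P.L) := by
      have hc := P.c_pow_le
      rw [show 64 * P.m * 2 ^ P.m = 8 * E by rw [hE]; ring] at hc
      rw [← pow_mul, Nat.mul_comm, pow_mul]
      refine (Nat.pow_le_pow_left hc _).trans ?_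
      rw [← pow_mul, Nat.mul_comm]
      exact Nat.pow_le_pow_right (by norm_num) hnb
    refine (Nat.mul_le_mul hE' h3).trans ?_
    rw [← pow_add, ← pow_mul]
    refine Nat.pow_le_pow_right (by norm_num) ?_
    have : P.L ≤ ℓ := by omega
    nlinarith
  · refine hlin _ (E + P.L) (hnb.trans ?_) (by omega)
    nlinarith
  · refine hlin _ (E + 8 * P.k * P.M + 2 * P.L) ?_ (by omega)
    have : P.rho ℓ ≤ (2 * P.m * P.M + 4 * P.k * P.M) * ℓ := by
      rw [Par.rho, Par.d, Par.J]
      have := Nat.mul_le_mul_left (2 * P.k * P.M) (show ℓ + 1 ≤ 2 * ℓ by omega)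
      calc _ ≤ P.m * (2 * P.M * ℓ) + 2 * P.k * P.M * (2 * ℓ) := Nat.add_le_add_left this _
        _ = _ := by ring
    calc 2 * P.L * P.nB ℓ = 2 * (P.nB ℓ * P.L) := by ring
      _ ≤ 2 * ((2 * P.m * P.M + 4 * P.k * P.M) * ℓ + P.L) := by omega
      _ ≤ 2 * ((2 * P.m * P.M + 4 * P.k * P.M) * ℓ + P.L * ℓ) := by
        have := Nat.le_mul_of_pos_right P.L hℓ1
        omega
      _ = (4 * P.m * P.M + 8 * P.k * P.M + 2 * P.L) * ℓ := by ring
      _ ≤ _ := by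
        refine Nat.mul_le_mul_right _ ?_
        have : 4 * P.m * P.M ≤ E := by rw [hE]; gcongr; norm_num
        omega

/-! ### The number of steps is `O(n log n)` -/

/-- `f` is at most a constant multiple of `g`. -/
def Bounded (f g : ℕ → ℕ) : Prop := ∃ A, ∀ n, 1 ≤ n → f n ≤ A * g n

namespace Bounded
variable {f f' g g' h : ℕ → ℕ}

theorem add (hf : Bounded f g) (hf' : Bounded f' g) : Bounded (fun n => f n + f' n) g := by
  obtain ⟨A, hA⟩ := hf
  obtain ⟨B, hB⟩ := hf'
  exact ⟨A + B, fun n hn => by rw [Nat.add_mul]; exact Nat.add_le_add (hA n hn) (hB n hn)⟩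

theorem mul (hf : Bounded f g) (hf' : Bounded f' g') :
    Bounded (fun n => f n * f' n) (fun n => g n * g' n) := by
  obtain ⟨A, hA⟩ := hf
  obtain ⟨B, hB⟩ := hf'
  refine ⟨A * B, fun n hn => (Nat.mul_le_mul (hA n hn) (hB n hn)).trans ?_⟩
  rw [Nat.mul_mul_mul_comm]

theorem const_mul (c : ℕ) (hf : Bounded f g) : Bounded (fun n => c * f n) g := by
  obtain ⟨A, hA⟩ := hf
  exact ⟨c * A, fun n hn => by rw [Nat.mul_assoc]; exact Nat.mul_le_mul_left _ (hA n hn)⟩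

theorem mul_const (c : ℕ) (hf : Bounded f g) : Bounded (fun n => f n * c) g := by
  simpa only [Nat.mul_comm] using hf.const_mul c

theorem of_le (c : ℕ) (h : ∀ n, 1 ≤ n → f n ≤ c * g n) : Bounded f g := ⟨c, h⟩

theorem trans (hf : Bounded f g) (h : ∀ n, 1 ≤ n → g n ≤ g' n) : Bounded f g' := by
  obtain ⟨A, hA⟩ := hf
  exact ⟨A, fun n hn => (hA n hn).trans (Nat.mul_le_mul_left _ (h n hn))⟩

end Bounded

theorem one_le_size {n : ℕ} (hn : 1 ≤ n) : 1 ≤ n.size := Nat.size_pos.2 hn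

theorem two_pow_size_le {n : ℕ} (hn : 1 ≤ n) : 2 ^ n.size ≤ 2 * n := by
  have h : n.size - 1 < n.size := by have := one_le_size hn; omega
  have := Nat.lt_size.1 h
  rw [show n.size = n.size - 1 + 1 by omega, pow_succ]
  omega

section costs
variable (P : Par)

theorem bounded_const (c : ℕ) : Bounded (fun _ => c) Nat.size :=
  .of_le c fun _ hn => Nat.le_mul_of_pos_right _ (one_le_size hn)

theorem bounded_size : Bounded Nat.size Nat.size := .of_le 1 fun _ _ => by simp

theorem bounded_J : Bounded (fun n => P.J n.size) Nat.size := .const_mul _ bounded_size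

theorem bounded_nb : Bounded (fun n => P.nb n.size) Nat.size := by
  refine .add (.of_le (4 * P.m * (2 * P.M)) fun n _ => (Nat.div_le_self _ _).trans ?_)
    (bounded_const 1)
  rw [Par.D, Par.d, Par.J]
  exact le_of_eq (by ring)

theorem bounded_nB : Bounded (fun n => P.nB n.size) Nat.size := by
  have h : Bounded (fun n => P.rho n.size) Nat.size :=
    .add (.const_mul _ (bounded_J P)) (.const_mul _ (bounded_size.add (bounded_const 1)))
  obtain ⟨A, hA⟩ := h
  exact .add (.of_le A fun n hn => (Nat.div_le_self _ _).trans (hA n hn)) (bounded_const 1)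

theorem bounded_of_size {f : ℕ → ℕ} (h : Bounded f Nat.size) :
    Bounded f (fun n => n * n.size) :=
  h.trans fun _ hn => Nat.le_mul_of_pos_left _ hn

theorem bounded_id : Bounded (fun n => n) (fun n => n) := .of_le 1 fun _ _ => by simp

theorem bounded_succ : Bounded (fun n => n + 1) (fun n => n) := .of_le 2 fun _ _ => by omega

theorem bounded_two_pow : Bounded (fun n => 2 * 2 ^ n.size) (fun n => n) :=
  .of_le 4 fun n hn => by have := two_pow_size_le hn; omega

theorem bounded_modulus : Bounded (fun n => modulus n.size) (fun n => n) :=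
  .of_le 4 fun n hn => by
    have := two_pow_size_le hn
    have := (modulus_spec n.size).2.2
    omega

theorem bounded_of_id {f : ℕ → ℕ} (h : Bounded f (fun n => n)) :
    Bounded f (fun n => n * n.size) :=
  h.trans fun _ hn => Nat.le_mul_of_pos_right _ (one_le_size hn)

theorem bounded_mul_const (c : ℕ) : Bounded (fun n => n * c) (fun n => n * n.size) :=
  bounded_of_id (bounded_id.mul_const c)

theorem bounded_succ_mul_const (c : ℕ) : Bounded (fun n => (n + 1) * c) (fun n => n * n.size) :=
  bounded_of_id (bounded_succ.mul_const c)

theorem bounded_constant (c : ℕ) : Bounded (fun _ => c) (fun n => n * n.size) :=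
  bounded_of_size (bounded_const c)

theorem bounded_sketchCost : Bounded (fun n => sketchCost P n.size n) (fun n => n * n.size) := by
  unfold sketchCost
  have h : Bounded (fun n => P.nb n.size * (3 * P.L + 8 + 2) + 8 + (2 * P.k * (3 + 2) + 2) + 3 + 2)
      Nat.size :=
    ((((bounded_nb P).mul_const _).add (bounded_const _)).add (bounded_const _)).add
      (bounded_const _) |>.add (bounded_const _)
  exact (((bounded_mul_const _).add (bounded_constant _)).add
    ((bounded_succ.mul h).add (bounded_constant _))).add (bounded_constant _)

theorem bounded_sieveCost : Bounded (fun n => sieveCost n.size) (fun n => n * n.size) := by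
  unfold sieveCost
  have h : Bounded (fun n => 3 * (n.size + 2) + 20) Nat.size :=
    ((bounded_size.add (bounded_const 2)).const_mul 3).add (bounded_const 20)
  exact (bounded_two_pow.mul h).add (bounded_constant _)

theorem bounded_greedyCost : Bounded (fun n => greedyCost P n.size n) (fun n => n * n.size) := by
  unfold greedyCost
  have hd : Bounded (fun n => n / P.d n.size) (fun n => n) :=
    .of_le 1 fun n _ => by simpa using Nat.div_le_self n _
  have hc : ∀ c, Bounded (fun _ => c) (fun n => n) := fun c =>
    .of_le c fun n hn => Nat.le_mul_of_pos_right _ hn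
  have h : Bounded (fun n => P.M * (n / P.d n.size * (3 * P.m + 13 + 2) + 8 + 2) + 2 +
    (n / P.d n.size * (3 * P.m + 13 + 2) + 2) + 4 + 2) (fun n => n) :=
    ((((((hd.mul_const _).add (hc _)).add (hc _)).const_mul _).add (hc _)).add
      ((hd.mul_const _).add (hc _))).add (hc _) |>.add (hc _)
  refine Bounded.add (Bounded.trans ((bounded_J P).mul h) fun n _ => ?_) (bounded_constant _)
  rw [Nat.mul_comm]

theorem bounded_decodeCost : Bounded (fun n => decodeCost P n.size n) (fun n => n * n.size) := by
  unfold decodeCost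
  have h : Bounded (fun n => P.nb n.size * (8 * P.L + 16 + 2) + 6 + 2) Nat.size :=
    (((bounded_nb P).mul_const _).add (bounded_const _)).add (bounded_const _)
  have h' := bounded_of_id (bounded_modulus.mul_const (2 * P.k * (3 + 2) + P.k + 12 + 2))
  exact ((((((bounded_sketchCost P).add (bounded_constant _)).add (bounded_constant _)).add
    ((bounded_succ_mul_const _).add (bounded_constant _))).add
    ((((h'.add (bounded_constant _)).add (bounded_constant _)).const_mul _).add
      (bounded_constant _))).add
    ((bounded_succ.mul h).add (bounded_constant _))).add (bounded_constant _)

theorem bounded_maskCost : Bounded (fun n => (n * (1 + 2) + 2) +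
    ((n + 1) * (8 * P.m + 16 + 2) + 2) + 1) (fun n => n * n.size) :=
  (((bounded_mul_const _).add (bounded_constant _)).add
    ((bounded_succ_mul_const _).add (bounded_constant _))).add (bounded_constant _)

theorem bounded_encodeCost : Bounded (fun n => encodeCost P n.size n) (fun n => n * n.size) := by
  unfold encodeCost
  have h := bounded_of_size ((bounded_J P).mul_const (5 * P.m + 6 + 2))
  have h' : Bounded (fun n => 5 * (n.size + 1) + 6 + 2) Nat.size :=
    (((bounded_size.add (bounded_const 1)).const_mul 5).add (bounded_const _)).add (bounded_const _)
  have h'' := bounded_of_size ((bounded_nB P).mul_const (13 * P.L + 16 + 2))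
  refine .add (.add (.add (.add (.add (.add (.add (.add (bounded_constant _)
    ((bounded_mul_const _).add (bounded_constant _)))
    (bounded_sieveCost.add (bounded_constant _))) (bounded_greedyCost P)) (bounded_maskCost P))
    ?_) ?_) (h''.add (bounded_constant _))) (bounded_constant _)
  · exact ((((bounded_sketchCost P).add (bounded_constant _)).add (bounded_constant _)).const_mul
      _).add (bounded_constant _)
  · exact ((h.add (bounded_constant _)).add
      ((bounded_of_size (h'.const_mul _)).add (bounded_constant _))).add (bounded_constant _)

theorem bounded_decoderCost : Bounded (fun n => decoderCost P n.size n) (fun n => n * n.size) := by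
  unfold decoderCost
  have h := bounded_of_size ((bounded_J P).mul_const (3 * P.m + 11 + 2))
  have h' : Bounded (fun n => 3 * (n.size + 1) + 11 + 2) Nat.size :=
    (((bounded_size.add (bounded_const 1)).const_mul 3).add (bounded_const _)).add (bounded_const _)
  have h'' := bounded_of_size ((bounded_nB P).mul_const (11 * P.L + 16 + 2))
  have h3 : Bounded (fun n => (n + 2 * P.L * P.nB n.size) * (8 + 2)) (fun n => n * n.size) :=
    ((bounded_of_id bounded_id).add (bounded_of_size ((bounded_nB P).const_mul _))).mul_const _
  refine .add (.add (.add (.add (.add (.add (.add (.add (bounded_constant _)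
    (h3.add (bounded_constant _))) (bounded_sieveCost.add (bounded_constant _)))
    (h''.add (bounded_constant _))) ?_) ?_) ((bounded_mul_const _).add (bounded_constant _)))
    (bounded_maskCost P)) (bounded_constant _)
  · exact ((h.add (bounded_constant _)).add
      ((bounded_of_size (h'.const_mul _)).add (bounded_constant _))).add (bounded_constant _)
  · exact (((((bounded_decodeCost P).add ((bounded_mul_const _).add (bounded_constant _))).add
      (bounded_constant _)).add (bounded_constant _)).const_mul _).add (bounded_constant _)

end costs
-- The pattern length and the redundancy
open Filter

/-- The length of the patterns. -/
def patternLength (k : ℕ) : ℕ := k.size + k.size.size + 5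

theorem pattern_pow_le {k : ℕ} (hk : 2 ≤ k) : 2 ^ patternLength k ≤ 128 * (k * k.size) := by
  have h1 := two_pow_size_le (n := k) (by omega)
  have h2 := two_pow_size_le (one_le_size (n := k) (by omega))
  rw [patternLength, pow_add, pow_add]
  calc _ ≤ 2 * k * (2 * k.size) * 2 ^ 5 := Nat.mul_le_mul_right _ (Nat.mul_le_mul h1 h2)
    _ = _ := by ring

theorem size_le_self (k : ℕ) : k.size ≤ k := Nat.size_le.2 Nat.lt_two_pow_self

theorem patternLength_le {k : ℕ} (hk : 2 ≤ k) : patternLength k ≤ 7 * k.size := by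
  have h1 := one_le_size (n := k) (by omega)
  have h2 := size_le_self k.size
  rw [patternLength]; omega

/-- The summand `5` of the pattern length supplies the factor `32`, which exceeds the `4 * 7 = 28`
on the left. -/
theorem lt_pattern_pow {k : ℕ} (hk : 2 ≤ k) : 4 * k * patternLength k < 2 ^ patternLength k := by
  have h1 := Nat.lt_size_self k
  have h2 := Nat.lt_size_self k.size
  have h3 := patternLength_le hk
  have h4 := one_le_size (n := k) (by omega)
  calc 4 * k * patternLength k ≤ 4 * k * (7 * k.size) := Nat.mul_le_mul_left _ h3
    _ < k * k.size * 2 ^ 5 := by nlinarith [Nat.mul_pos (by omega : 0 < k) h4]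
    _ ≤ 2 ^ k.size * 2 ^ k.size.size * 2 ^ 5 :=
      Nat.mul_le_mul_right _ (Nat.mul_le_mul h1.le h2.le)
    _ = _ := by rw [patternLength, pow_add, pow_add]

/-- The syndromes dominate; the mask costs `O(k (log k)^2)` times `ℓ`, and one factor `log k` is
absorbed by `k`. The constant is `2 * 896 + 4 * 128`. -/
theorem rho_le_of_pattern {P : Par} (hm : P.m = patternLength P.k) {ℓ : ℕ} (hℓ : 1 ≤ ℓ) :
    P.rho ℓ ≤ 2304 * (P.k ^ 2 * P.k.size * ℓ) := by
  have hk := P.two_le_k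
  have h1 := pattern_pow_le hk
  have h2 := patternLength_le hk
  have h3 := size_le_self P.k
  rw [← hm] at h1 h2
  have h4 : P.m * 2 ^ P.m ≤ 896 * (P.k ^ 2 * P.k.size) := by
    calc _ ≤ 7 * P.k.size * (128 * (P.k * P.k.size)) := Nat.mul_le_mul h2 h1
      _ = 896 * (P.k * P.k.size * P.k.size) := by ring
      _ ≤ 896 * (P.k * P.k.size * P.k) := by gcongr
      _ = _ := by ring
  have h5 : P.k * 2 ^ P.m ≤ 128 * (P.k ^ 2 * P.k.size) := by
    calc _ ≤ P.k * (128 * (P.k * P.k.size)) := Nat.mul_le_mul_left _ h1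
      _ = _ := by ring
  rw [Par.rho, Par.d, Par.J, Par.M]
  calc P.m * (2 * 2 ^ P.m * ℓ) + 2 * P.k * 2 ^ P.m * (ℓ + 1)
      ≤ P.m * (2 * 2 ^ P.m * ℓ) + 2 * P.k * 2 ^ P.m * (2 * ℓ) := by gcongr; omega
    _ = 2 * (P.m * 2 ^ P.m) * ℓ + 4 * (P.k * 2 ^ P.m) * ℓ := by ring
    _ ≤ 2 * (896 * (P.k ^ 2 * P.k.size)) * ℓ + 4 * (128 * (P.k ^ 2 * P.k.size)) * ℓ := by gcongr
    _ = _ := by ring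

theorem size_le_logb {n : ℕ} (hn : 2 ≤ n) : (n.size : ℝ) ≤ 2 * Real.logb 2 n := by
  have h1 := one_le_size (n := n) (by omega)
  have h2 : 2 ^ (n.size - 1) ≤ n := Nat.lt_size.1 (by omega)
  have h3 : ((n.size - 1 : ℕ) : ℝ) ≤ Real.logb 2 n := by
    rw [Real.le_logb_iff_rpow_le (by norm_num) (by positivity), Real.rpow_natCast]
    exact_mod_cast h2
  have h4 : (1 : ℝ) ≤ Real.logb 2 n := by
    rw [Real.le_logb_iff_rpow_le (by norm_num) (by positivity), Real.rpow_one]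
    exact_mod_cast hn
  rw [Nat.cast_sub h1, Nat.cast_one] at h3
  linarith

/-- The rate `1 / 2` doubles the redundancy, and rounding to whole blocks costs at most `2 * L ≤
n.size`: this gives `4609 = 2 * 2304 + 1`. Replacing two binary lengths by logarithms costs another
factor `4`. -/
theorem length_le {P : Par} (hm : P.m = patternLength P.k) {n : ℕ} (hn : 2 ≤ n)
    (hL : 2 * P.L ≤ n.size) : (P.length n : ℝ) ≤
      n + 18436 * ((P.k : ℝ) ^ 2 * Real.logb 2 P.k * Real.logb 2 n) := by
  have hk := P.two_le_k
  have hℓ := one_le_size (n := n) (by omega)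
  have hs := one_le_size (n := P.k) (by omega)
  have hnB : P.nB n.size * P.L ≤ P.rho n.size + P.L := by
    rw [Par.nB, Nat.add_mul, Nat.one_mul]
    exact Nat.add_le_add_right (Nat.div_mul_le_self _ _) _
  have hrho := rho_le_of_pattern hm hℓ
  have h1 : P.length n ≤ n + 4609 * (P.k ^ 2 * P.k.size * n.size) := by
    have : n.size ≤ P.k ^ 2 * P.k.size * n.size :=
      Nat.le_mul_of_pos_left _ (by positivity)
    rw [Par.length, show 2 * P.L * P.nB n.size = 2 * (P.nB n.size * P.L) by ring]
    omega
  have h2 : (P.length n : ℝ) ≤ n + 4609 * ((P.k : ℝ) ^ 2 * P.k.size * n.size) := by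
    exact_mod_cast h1
  have h3 := size_le_logb hk
  have h4 := size_le_logb hn
  have h5 : 0 ≤ Real.logb 2 P.k := by
    linarith [(Nat.cast_nonneg P.k.size : (0 : ℝ) ≤ P.k.size)]
  refine h2.trans (add_le_add le_rfl ?_)
  calc 4609 * ((P.k : ℝ) ^ 2 * P.k.size * n.size)
      ≤ 4609 * ((P.k : ℝ) ^ 2 * (2 * Real.logb 2 P.k) * (2 * Real.logb 2 n)) := by gcongr
    _ = _ := by ring

/-! ### From memory contents to bit strings -/

/-- The bits of a list. -/
def bits (l : List Bool) (j : ℕ) : ℕ := (l.getD j false).toNat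

theorem bits_le (l : List Bool) (j : ℕ) : bits l j ≤ 1 := Bool.toNat_le _

theorem init_fresh (l : List Bool) : Fresh (State.init l) where
  reg i hi := by simp [State.init, hi]
  arr a ha i := by simp [State.init, ha]
  bits i := by simpa [State.init] using Bool.toNat_le _

theorem init_arr (l : List Bool) : (State.init l).arr 0 = bits l := by
  funext j; simp [State.init, bits]

theorem init_bdd {l : List Bool} {b : ℕ} (h : l.length < 2 ^ b) (hb : 1 ≤ b) :
    (State.init l).Bdd b := by
  have h2 : 2 ≤ 2 ^ b := by simpa using Nat.pow_le_pow_right (n := 2) (by norm_num) hb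
  refine ⟨fun i => ?_, fun a j => ?_⟩
  · simp only [State.init]; split_ifs <;> omega
  · simp only [State.init]
    split_ifs
    · have := Bool.toNat_le (l.getD j false); omega
    · omega

/-- The list of the first `n` bits of a sequence. -/
def ofBits (n : ℕ) (X : ℕ → ℕ) : List.Vector Bool n := .ofFn fun i => decide (X i = 1)

theorem ofBits_getElem {n : ℕ} {X : ℕ → ℕ} (hX : ∀ i, X i ≤ 1) {i : ℕ}
    (hi : i < (ofBits n X).toList.length) : ((ofBits n X).toList[i]).toNat = X i := by
  have := hX i
  have h : (ofBits n X).toList[i] = decide (X i = 1) := by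
    simp [ofBits, List.Vector.toList_ofFn]
  rw [h]
  interval_cases X i <;> rfl

theorem bits_ofBits {n : ℕ} {X : ℕ → ℕ} (hX : ∀ i, X i ≤ 1) {i : ℕ} (hi : i < n) :
    bits (ofBits n X).toList i = X i := by
  have h : i < (ofBits n X).toList.length := by simpa using hi
  rw [← ofBits_getElem hX h, bits, List.getD_eq_getElem _ _ h]

theorem eq_of_bits {n : ℕ} {v w : List.Vector Bool n}
    (h : ∀ i < n, bits v.toList i = bits w.toList i) : v = w := by
  refine List.Vector.toList_injective (List.ext_getElem (by simp) fun i h1 h2 => ?_)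
  have := h i (by simpa using h1)
  rw [bits, bits, List.getD_eq_getElem _ _ h1, List.getD_eq_getElem _ _ h2] at this
  revert this
  cases v.toList[i] <;> cases w.toList[i] <;> simp

theorem Runs.returns {b c n : ℕ} {p : Prog} {l : List Bool} {Q : State → Prop}
    (h : Runs b p (State.init l) c Q) (hl : l.length < 2 ^ b) (hb : 1 ≤ b)
    (hQ : ∀ τ, Q τ → τ.reg 0 = 1 ∧ τ.reg 1 = n ∧ ∀ i, τ.arr 1 i ≤ 1) :
    ∃ τ, Q τ ∧ p.Returns l (some (ofBits n (τ.arr 1)).toList)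
      ((c * (p.mx * (b + 1) ^ 2) : ℕ) : ℝ) := by
  obtain ⟨t, τ, h1, h2, -, h4⟩ := h (init_bdd hl hb)
  obtain ⟨q1, q2, q3⟩ := hQ τ h4
  refine ⟨τ, h4, t, τ, h1, ⟨q1, by simpa using q2, fun j hj => ?_⟩, by exact_mod_cast h2⟩
  exact (ofBits_getElem q3 hj).symm

theorem exists_emb {k N : ℕ} {l l' : List Bool} (hl : l.length = N) (hl' : l'.length = N - k)
    (hk : k ≤ N) (h : l'.Sublist l) {y : ℕ → ℕ} (hy : ∀ i < N, y i = bits l i) :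
    ∃ f, Emb k N y (bits l') f := by
  obtain ⟨f, hf⟩ := List.sublist_iff_exists_orderEmbedding_getElem?_eq.1 h
  have hlt : ∀ i < N - k, f i < N := fun i hi => by
    have h1 := hf i
    rw [List.getElem?_eq_getElem (by omega)] at h1
    have := (List.getElem?_eq_some_iff.1 h1.symm).1
    omega
  refine ⟨fun i => if i < N - k then f i else i + k, hk, ?_, fun i hi => if_neg (by omega),
    fun i hi => ?_⟩
  · refine strictMono_nat_of_lt_succ fun i => ?_
    split_ifs with h1 h2 h2
    · exact f.strictMono (Nat.lt_succ_self i)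
    · have := hlt i h1; omega
    · omega
    · omega
  · rw [if_pos hi, hy _ (hlt i hi), bits, bits, List.getD_eq_getElem?_getD,
      List.getD_eq_getElem?_getD, hf i]

/-- There are `O(n log n)` steps on words of `8 * n.size` bits, each of quadratic cost, so three
logarithms suffice and the fourth is spare. The factors `81` and `8` come from `8 * n.size + 1 ≤ 9 *
n.size` and from `n.size ≤ 2 * Real.logb 2 n`. -/
theorem time_le (p : Prog) {cost : ℕ → ℕ} (h : Bounded cost (fun n => n * n.size)) :
    ∃ K : ℝ, 0 ≤ K ∧ ∀ n : ℕ, 2 ≤ n →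
      ((cost n * (p.mx * (8 * n.size + 1) ^ 2) : ℕ) : ℝ) ≤ K * (n * Real.logb 2 n ^ 4) := by
  obtain ⟨A, hA⟩ := h
  refine ⟨A * p.mx * 81 * 8, by positivity, fun n hn => ?_⟩
  have hs := one_le_size (n := n) (by omega)
  have h1 : cost n * (p.mx * (8 * n.size + 1) ^ 2) ≤ A * p.mx * 81 * (n * n.size ^ 3) := by
    calc _ ≤ A * (n * n.size) * (p.mx * (9 * n.size) ^ 2) := by
          gcongr
          · exact hA n (by omega)
          · omega
      _ = _ := by ring
  have h2 := size_le_logb hn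
  have h3 : (1 : ℝ) ≤ Real.logb 2 n := by
    rw [Real.le_logb_iff_rpow_le (by norm_num) (by positivity), Real.rpow_one]
    exact_mod_cast hn
  calc ((cost n * (p.mx * (8 * n.size + 1) ^ 2) : ℕ) : ℝ)
      ≤ A * p.mx * 81 * (n * (n.size : ℝ) ^ 3) := by exact_mod_cast h1
    _ ≤ A * p.mx * 81 * (n * (2 * Real.logb 2 n) ^ 3) := by gcongr
    _ = A * p.mx * 81 * 8 * (n * Real.logb 2 n ^ 3) := by ring
    _ ≤ _ := by
      gcongr
      norm_num
open Filter

theorem exists_encoder {P : Par} {n : ℕ} (S : Sizes P n.size n (8 * n.size)) {T : ℝ}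
    (hT : ((encodeCost P n.size n * ((encodeP P).mx * (8 * n.size + 1) ^ 2) : ℕ) : ℝ) ≤ T)
    (s : List.Vector Bool n) :
    ∃ c : List.Vector Bool (P.length n), (encodeP P).Returns s.toList (some c.toList) T ∧
      ∃ t R y, IsCodeword P n.size n (bits s.toList) t R y ∧
        ∀ i < P.length n, y i = bits c.toList i := by
  have hF := init_fresh s.toList
  have h0 : (State.init s.toList).reg 0 = n := by simp [State.init]
  have hl : s.toList.length < 2 ^ (8 * n.size) := by
    rw [List.Vector.toList_length]
    exact S.lt_of_lin (by have := S.n_lt; omega)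
  have hb : 1 ≤ 8 * n.size := by have := S.le_b; omega
  obtain ⟨τ, ⟨-, -, t, R, hc⟩, h2⟩ := (Runs.encodeP S hF h0).returns (n := P.length n) hl hb
    (by rintro τ ⟨q1, q2, t, R, q3⟩; exact ⟨q1, q2, q3.y_le⟩)
  rw [init_arr] at hc
  obtain ⟨t', υ, r1, r2, r3⟩ := h2
  exact ⟨_, ⟨t', υ, r1, r2, r3.trans hT⟩, t, R, _, hc, fun i hi => (bits_ofBits hc.y_le hi).symm⟩

theorem exists_decoder {P : Par} {n : ℕ} (S : Sizes P n.size n (8 * n.size)) (hkn : P.k ≤ n)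
    {T : ℝ}
    (hT : ((decoderCost P n.size n * ((decoderP P).mx * (8 * n.size + 1) ^ 2) : ℕ) : ℝ) ≤ T)
    (w : List.Vector Bool (P.length n - P.k)) :
    ∃ o : List.Vector Bool n, (decoderP P).Returns w.toList (some o.toList) T ∧
      ∀ (s : List.Vector Bool n) (c : List.Vector Bool (P.length n)),
        w.toList.Sublist c.toList →
        (∃ t R y, IsCodeword P n.size n (bits s.toList) t R y ∧
          ∀ i < P.length n, y i = bits c.toList i) → o = s := by
  have hlen : n ≤ P.length n := Nat.le_add_right _ _
  have hF := init_fresh w.toList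
  have h0 : (State.init w.toList).reg 0 + P.k = P.length n := by
    simp only [State.init, List.Vector.toList_length, if_true]; omega
  have hl : w.toList.length < 2 ^ (8 * n.size) := by
    rw [List.Vector.toList_length]
    refine S.lt_of_lin ?_
    have h1 := S.n_lt
    have h2 := S.code_le
    rw [Par.length]; omega
  have hb : 1 ≤ 8 * n.size := by have := S.le_b; omega
  obtain ⟨τ, ⟨-, -, h1, hd⟩, h2⟩ := (Runs.decoderP S hF h0 hkn).returns (n := n) hl hb
    (by rintro τ ⟨q1, q2, q3, -⟩; exact ⟨q1, q2, q3⟩)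
  rw [init_arr] at hd
  obtain ⟨t', υ, r1, r2, r3⟩ := h2
  refine ⟨_, ⟨t', υ, r1, r2, r3.trans hT⟩, ?_⟩
  rintro s c hs ⟨t, R, y, hc, hy⟩
  obtain ⟨f, hf⟩ := exists_emb (by simp) (by simp) (hkn.trans hlen) hs hy
  refine eq_of_bits fun i hi => ?_
  rw [bits_ofBits h1 hi]
  exact hd _ t R y f (bits_le _) hc hf i hi

end RAM

theorem theorem1 :
    ∃ C : ℝ, ∀ k : ℕ, 2 ≤ k →
      ∃ (K : ℝ) (encProg decProg : RAM.Prog), ∀ᶠ n : ℕ in Filter.atTop,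
        ∃ N : ℕ, k ≤ N ∧
          (N : ℝ) ≤ n + C * ((k : ℝ) ^ 2 * Real.logb 2 k * Real.logb 2 n) ∧
          ∃ (Enc : List.Vector Bool n → List.Vector Bool N)
            (Dec : List.Vector Bool (N - k) → Option (List.Vector Bool n)),
            Function.Injective Enc ∧
            (∀ s, encProg.Returns s.toList (some (Enc s).toList)
              (K * (n * Real.logb 2 n ^ 4))) ∧
            (∀ s', decProg.Returns s'.toList ((Dec s').map List.Vector.toList)
              (K * (n * Real.logb 2 n ^ 4))) ∧
            ∀ s s', s'.toList.Sublist (Enc s).toList → Dec s' = some s := by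
  refine ⟨18436, fun k hk => ?_⟩
  obtain ⟨P, rfl, hm⟩ := RAM.exists_par hk (by rw [RAM.patternLength]; omega)
    (RAM.lt_pattern_pow hk)
  obtain ⟨K₁, hK₁, hT₁⟩ := RAM.time_le (RAM.encodeP P) (RAM.bounded_encodeCost P)
  obtain ⟨K₂, hK₂, hT₂⟩ := RAM.time_le (RAM.decoderP P) (RAM.bounded_decoderCost P)
  refine ⟨K₁ + K₂, RAM.encodeP P, RAM.decoderP P, ?_⟩
  filter_upwards [RAM.eventually_sizes P, Filter.eventually_ge_atTop (P.k + 2)] with n S hn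
  have hlen : n ≤ P.length n := Nat.le_add_right _ _
  have h0 : (0 : ℝ) ≤ n * Real.logb 2 n ^ 4 := by positivity
  have hE : K₁ * (n * Real.logb 2 n ^ 4) ≤ (K₁ + K₂) * (n * Real.logb 2 n ^ 4) :=
    mul_le_mul_of_nonneg_right (by linarith) h0
  have hD : K₂ * (n * Real.logb 2 n ^ 4) ≤ (K₁ + K₂) * (n * Real.logb 2 n ^ 4) :=
    mul_le_mul_of_nonneg_right (by linarith) h0
  choose Enc hEnc hcode using RAM.exists_encoder S ((hT₁ n (by omega)).trans hE)
  choose Dec hDec hdec using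
    RAM.exists_decoder S (by omega) ((hT₂ n (by omega)).trans hD)
  -- The decoder never answers "Fail"; on a word that comes from no codeword it returns some string.
  refine ⟨P.length n, by omega, RAM.length_le hm (by omega) S.L_le, Enc, fun w => some (Dec w),
    fun s₁ s₂ h => ?_, hEnc, hDec, fun s w hw => congrArg some (hdec w s (Enc s) hw (hcode s))⟩
  -- Injectivity follows from decoding: strings with equal codewords share a received word, for
  -- instance a prefix, and it decodes to both.
  let w : List.Vector Bool (P.length n - P.k) :=
    ⟨(Enc s₁).toList.take (P.length n - P.k), by simp⟩
  have hw : w.toList.Sublist (Enc s₁).toList := List.take_sublist _ _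
  exact (hdec w s₁ (Enc s₁) hw (hcode s₁)).symm.trans (hdec w s₂ (Enc s₂) (h ▸ hw) (hcode s₂))
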